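/- **Setting.** Let $d\ge 1$, let $\mathbb T^d=\mathbb R^d/\mathbb Z^d$ with projection $\Pi:\mathbb R^d\to\mathbb T^d$ and Lebesgue measure $\pi$, and let $M\ge2$. Let $\check E_1,\dots,\check E_M$ be a partition of $[0,1)^d$ into nondegenerate axis-aligned cubes (intervals if $d=1$; each side may or may not contain its end points), $p_i=|\check E_i|$, $E_i=\Pi(\check E_i)$. Let $\check\varphi_i(x)=p_i^{-1/d}D_ix+e_i$ with $D_i$ an orthogonal matrix and $e_i\in\mathbb R^d$, such that $\check\varphi_i(\check E_i)\subseteq[0,1]^d$. Define $\varphi:\mathbb T^d\to\mathbb T^d$ by $\varphi(\Pi x)=\varphi_i(\Pi x)=\Pi(\check\varphi_i(x))$ for $x\in\check E_i$, and put $p_{\min}=\min_ip_i$, $p_{\max}=\max_ip_i$. Assume: 1. each $\varphi_i:E_i\to\mathbb T^d$ is a bijection; 2. for every $x\in\partial[0,1]^d$ there are $i$ and $y\in(0,1)^d\cap\overline{\check E_i}$ with $\Pi(\check\varphi_i(y))=\Pi(x)$; 3. if $d\ge2$, for every finite tuple $s=(s_0,\dots,s_{m-1})$ the cylinder set $\{x:\varphi^n(x)\in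 E_{s_n}\text{ for all }0\le n<m\}$ is, up to a null set, (the projection of) an axis-aligned cube contained in $[0,1]^d$. For every $\epsilon>0$ let $K_\epsilon$ be a probability density on $\mathbb T^d$ supported in the Euclidean ball of radius $\epsilon$ around $0$. Let $\zeta_1,\zeta_2,\dots$ be i.i.d. with density $K_\epsilon$, $X_{n+1}=\varphi(X_n)+\zeta_{n+1}$, $\theta_n(x)=\mathbb E^x\theta_0(X_n)$, and $$t_{\mathrm{dis}}(\delta)=\min\{n\in\mathbb N:\ \|\theta_n\|_{L^2(\pi)}\le\delta\|\theta_0\|_{L^2(\pi)}\text{ for all }\theta_0\in L^2(\pi)\text{ with mean }0\}.$$ Suppose that the Fourier coefficients of $K_\epsilon$ at frequencies of order at least $1/\epsilon$ are bounded away from $1$ uniformly in $\epsilon$: there is a function $\chi:(0,\infty)\to(0,\infty)$ such that for every $c>0$, $$\sup_{k\in\mathbb Z^d,\ |k|>c/\epsilon}|\hat K_\epsilon(k)|\le1-\chi(c)\qquad\text{for all sufficiently small }\epsilon>0 .$$ **Theorem.** There is a constant $C>0$, depending only on $d$, $p_{\min}$, $p_{\max}$ and the function $\chi$, such that for every $\delta\in(0,1)$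 and all sufficiently small $\epsilon>0$ the minimum defining $t_{\mathrm{dis}}(\delta)$ exists and $$\frac{d\ln\epsilon}{\ln p_{\min}}-C\bigl(1+|\ln(1-\delta)|\bigr)\ \le\ t_{\mathrm{dis}}(\delta)\ \le\ \frac{d\ln\epsilon}{\ln p_{\max}}+C\Bigl(1+\frac{|\ln\delta|}{\delta^2}\Bigr).$$ In particular the two bounds match if all pieces have equal measure $p_i=q$: then $$\Bigl|t_{\mathrm{dis}}(\delta)-\frac{d\ln\epsilon}{\ln q}\Bigr|\le C\Bigl(1+|\ln(1-\delta)|+\frac{|\ln\delta|}{\delta^2}\Bigr).$$ -/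

import Mathlib

open MeasureTheory

noncomputable section

namespace BernoulliTorus

/-- The canonical projection `ℝ^d → 𝕋^d = ℝ^d / ℤ^d`. -/
def proj {d : ℕ} (x : Fin d → ℝ) : UnitAddTorus (Fin d) := fun j => (x j : UnitAddCircle)

/-- The unique representative in `[0,1)^d` of a point of the torus. -/
def rep {d : ℕ} (x : UnitAddTorus (Fin d)) : Fin d → ℝ :=
  fun j => (AddCircle.equivIco (1 : ℝ) 0 (x j) : ℝ)

/-- The half-open unit cube `[0,1)^d`. -/
def unitCube (d : ℕ) : Set (Fin d → ℝ) := Set.univ.pi fun _ => Set.Ico (0 : ℝ) 1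

theorem rep_mem_unitCube {d : ℕ} (x : UnitAddTorus (Fin d)) : rep x ∈ unitCube d := by
  intro j _
  have h := (AddCircle.equivIco (1 : ℝ) 0 (x j)).2
  exact ⟨h.1, lt_of_lt_of_eq h.2 (zero_add 1)⟩

/-- The Euclidean distance on the torus from `x` to `0`. -/
def torusDist {d : ℕ} (x : UnitAddTorus (Fin d)) : ℝ := Real.sqrt (∑ j, ‖x j‖ ^ 2)

/-- The Euclidean length of a frequency `k ∈ ℤ^d`. -/
def freqNorm {d : ℕ} (k : Fin d → ℤ) : ℝ := Real.sqrt (∑ j, (k j : ℝ) ^ 2)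

/-- `Q` is a nondegenerate `d`-dimensional cube with sides parallel to the axes: a product of
bounded intervals of a common length `ℓ > 0`, where each interval may or may not contain its
end points.  For `d = 1` this is a nondegenerate bounded interval. -/
def IsAxisCube {d : ℕ} (Q : Set (Fin d → ℝ)) : Prop :=
  ∃ (a : Fin d → ℝ) (ℓ : ℝ) (I : Fin d → Set ℝ), 0 < ℓ ∧
    (∀ j, Set.Ioo (a j) (a j + ℓ) ⊆ I j ∧ I j ⊆ Set.Icc (a j) (a j + ℓ)) ∧
    Q = Set.univ.pi I

/-- The affine map `x ↦ p^{-1/d} D x + e` of `ℝ^d`. -/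
def affineBranch {d : ℕ} (p : ℝ) (D : Matrix (Fin d) (Fin d) ℝ) (e : Fin d → ℝ)
    (x : Fin d → ℝ) : Fin d → ℝ :=
  (p ^ (1 / (d : ℝ)))⁻¹ • D.mulVec x + e

/-- The data of a piecewise affine linear map: a partition of `[0,1)^d` into `M ≥ 2` axis-aligned
cubes (intervals if `d = 1`), and on each cube an affine map into the closed unit cube, with an
orthogonal linear part scaled by `p_i^{-1/d}`, `p_i` the volume of the cube. -/
structure PiecewiseAffine (d : ℕ) where
  M : ℕ
  two_le : 2 ≤ M
  cell : Fin M → Set (Fin d → ℝ)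
  cell_cube : ∀ i, IsAxisCube (cell i)
  cell_disjoint : Pairwise fun i j => Disjoint (cell i) (cell j)
  cell_cover : ⋃ i, cell i = unitCube d
  D : Fin M → Matrix (Fin d) (Fin d) ℝ
  D_orthogonal : ∀ i, D i ∈ Matrix.orthogonalGroup (Fin d) ℝ
  e : Fin M → Fin d → ℝ
  mapsTo : ∀ i, Set.MapsTo (affineBranch (volume.real (cell i)) (D i) (e i)) (cell i)
    (Set.Icc 0 1)

namespace PiecewiseAffine

variable {d : ℕ} (B : PiecewiseAffine d)

/-- `p_i`, the Lebesgue measure of the `i`-th piece. -/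
def p (i : Fin B.M) : ℝ := volume.real (B.cell i)

/-- The measure of the smallest piece. -/
def pMin : ℝ := ⨅ i, B.p i

/-- The measure of the largest piece. -/
def pMax : ℝ := ⨆ i, B.p i

/-- The `i`-th affine map, on `ℝ^d`. -/
def branch (i : Fin B.M) : (Fin d → ℝ) → (Fin d → ℝ) := affineBranch (B.p i) (B.D i) (B.e i)

/-- The `i`-th piece `E_i`, as a subset of the torus. -/
def torusCell (i : Fin B.M) : Set (UnitAddTorus (Fin d)) := proj '' B.cell i

/-- The `i`-th branch, on the torus. -/
def torusBranch (i : Fin B.M) (x : UnitAddTorus (Fin d)) : UnitAddTorus (Fin d) :=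
  proj (B.branch i (rep x))

theorem exists_index (x : UnitAddTorus (Fin d)) : ∃ i, rep x ∈ B.cell i := by
  have h := rep_mem_unitCube x
  rw [← B.cell_cover] at h
  exact Set.mem_iUnion.mp h

/-- The index of the piece that contains `x`. -/
def index (x : UnitAddTorus (Fin d)) : Fin B.M := Classical.choose (B.exists_index x)

/-- The map `φ : 𝕋^d → 𝕋^d`, equal to the `i`-th branch on the `i`-th piece. -/
def phi (x : UnitAddTorus (Fin d)) : UnitAddTorus (Fin d) := B.torusBranch (B.index x) x

/-- The cylinder set of a finite tuple `s`: the points `x` with `φ^n(x) ∈ E_{s_n}` for every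
index `n` of the tuple.  The empty tuple gives the whole torus. -/
def cylinder (s : List (Fin B.M)) : Set (UnitAddTorus (Fin d)) :=
  {x | ∀ (n : ℕ) (hn : n < s.length), B.phi^[n] x ∈ B.torusCell s[n]}

/-- The assumptions on `φ`.  In the second one `y` may lie on the boundary of the piece, and the
boundary point `x` of the unit cube is regarded as a point of the torus; in the third one null sets
are disregarded. -/
structure CubeAssumption : Prop where
  bijective : ∀ i, Set.BijOn (B.torusBranch i) (B.torusCell i) Set.univ
  mixing : ∀ x ∈ frontier (Set.Icc (0 : Fin d → ℝ) 1), ∃ i, ∃ y ∈ closure (B.cell i),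
    (∀ j, y j ∈ Set.Ioo (0 : ℝ) 1) ∧ proj (B.branch i y) = proj x
  cubes : 2 ≤ d → ∀ s : List (Fin B.M), ∃ Q : Set (Fin d → ℝ), IsAxisCube Q ∧
    Q ⊆ Set.Icc 0 1 ∧ B.cylinder s =ᵐ[volume] proj '' Q

end PiecewiseAffine

/-- `k` is a probability density on the torus. -/
structure IsDensity {d : ℕ} (k : UnitAddTorus (Fin d) → ℝ) : Prop where
  nonneg : ∀ᵐ x, 0 ≤ k x
  integrable : Integrable k
  integral_eq_one : ∫ x, k x = 1

/-- The probability measure with density `k`. -/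
def noiseLaw {d : ℕ} (k : UnitAddTorus (Fin d) → ℝ) : Measure (UnitAddTorus (Fin d)) :=
  volume.withDensity fun x => ENNReal.ofReal (k x)

/-- The process `X_0 = x`, `X_{n+1} = φ(X_n) + ζ_{n+1}`, as a function of the starting point `x` and
of the noises `(ζ_1, …, ζ_n)`. -/
def process {d : ℕ} (φ : UnitAddTorus (Fin d) → UnitAddTorus (Fin d)) :
    (n : ℕ) → UnitAddTorus (Fin d) → (Fin n → UnitAddTorus (Fin d)) → UnitAddTorus (Fin d)
  | 0, x, _ => x
  | n + 1, x, ζ => φ (process φ n x (Fin.init ζ)) + ζ (Fin.last n)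

/-- `θ_n(x) = 𝔼^x θ(X_n)`, for independent noises with the common density `k`. -/
def evolve {d : ℕ} (φ : UnitAddTorus (Fin d) → UnitAddTorus (Fin d))
    (k : UnitAddTorus (Fin d) → ℝ) (n : ℕ) (θ : UnitAddTorus (Fin d) → ℝ)
    (x : UnitAddTorus (Fin d)) : ℝ :=
  ∫ ζ, θ (process φ n x ζ) ∂(Measure.pi fun _ : Fin n => noiseLaw k)

/-- The set of times `n` such that `‖θ_n‖_{L²} ≤ δ ‖θ_0‖_{L²}` for all mean-zero `θ_0 ∈ L²`. -/
def dissipatedTimes {d : ℕ} (φ : UnitAddTorus (Fin d) → UnitAddTorus (Fin d))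
    (k : UnitAddTorus (Fin d) → ℝ) (δ : ℝ) : Set ℕ :=
  {n | ∀ θ : UnitAddTorus (Fin d) → ℝ, MemLp θ 2 volume → ∫ x, θ x = 0 →
    eLpNorm (evolve φ k n θ) 2 volume ≤ ENNReal.ofReal δ * eLpNorm θ 2 volume}

/-- `t` is the dissipation time `t_dis(δ)`: the minimum of the set above exists and equals `t`. -/
def IsDissipationTime {d : ℕ} (φ : UnitAddTorus (Fin d) → UnitAddTorus (Fin d))
    (k : UnitAddTorus (Fin d) → ℝ) (δ : ℝ) (t : ℕ) : Prop :=
  IsLeast (dissipatedTimes φ k δ) t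

/-- For every `ε > 0`, `K ε` is a probability density supported in the ball of radius `ε`. -/
def IsLocalNoise {d : ℕ} (K : ℝ → UnitAddTorus (Fin d) → ℝ) : Prop :=
  ∀ ε : ℝ, 0 < ε → IsDensity (K ε) ∧ ∀ᵐ x, ε < torusDist x → K ε x = 0

/-- The Fourier coefficients of `K ε` at the frequencies `|k| > c/ε` are bounded away from `1`:
for every `c > 0` and all sufficiently small `ε`, `sup_{|k| > c/ε} |K̂_ε(k)| ≤ 1 - χ c`. -/
def HasFourierGap {d : ℕ} (K : ℝ → UnitAddTorus (Fin d) → ℝ) (χ : ℝ → ℝ) : Prop :=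
  ∀ c : ℝ, 0 < c → ∃ ε₀ : ℝ, 0 < ε₀ ∧ ∀ ε : ℝ, 0 < ε → ε < ε₀ → ∀ k : Fin d → ℤ,
    c / ε < freqNorm k →
      ‖UnitAddTorus.mFourierCoeff (fun x => (K ε x : ℂ)) k‖ ≤ 1 - χ c

end BernoulliTorus

end

noncomputable section

namespace BernoulliTorus

/-! ### The torus, its fundamental domain and axis-aligned cubes -/

section

/-! One step of the evolution is `step`: average an observable over the noise, then compose with
`φ`. Each branch maps its cell onto the unit cube up to a null set, so `φ` preserves Lebesgue
measure and the norms `a j` of the evolved observable are nonincreasing. The two bounds on the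
dissipation time are proved separately.

Upper bound. By the Fourier gap, averaging damps all frequencies above `c / ε`. So the norm
contracts by a fixed factor at every step at which the frequencies below `c / ε` carry at most half
of it. To bound that low-frequency part, pair the evolved observable with the trigonometric
polynomial `g` whose coefficients are its own conjugated low-frequency coefficients, and move the
dynamics onto `g`: composition with `φ` becomes the transfer operator, and dropping the average
costs the L² change of `g` under a translation of size `ε`. The transfer operator does not increase
the L² norm and contracts the gradient by `κ = pMax ^ (1/d)` (`energy_transfer_le`). The iterated
functions are smooth on the closed cube but not periodic, so a translation has an interior cost and
a jump cost at the boundary, the latter controlled by a trace inequality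
(`integral_circle_shift_le`). For the `k`-th iterate the relative cost is of order `√c · λ ^ k + √ε`
with `λ = √κ`. After `N ≈ log ε / log κ = d log ε / log pMax` transfers the gradient is so small
that Poincaré's inequality makes the remaining pairing negligible.

Hence the low-frequency part is at most a small multiple of a geometrically weighted sum of past
norms, plus a small multiple of the initial norm (`sqrt_sum_low_le`). From time `N` on, one of three
things holds: the norm is already below the target; or it is much smaller than its weighted past,
which is itself decay; or the step contracts (`contraction_step`). A Lyapunov function combining the
norm with the weighted past then decays exponentially (`decay_of_contraction`), and the target is
reached after a number of further steps independent of `ε`.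

Lower bound. The distance to the boundary of the cube is Lipschitz and vanishes on that boundary.
Both properties survive composition with `φ`, the Lipschitz constant growing by at most `pMin ^
(-1/d)` (`isBump_comp_phi`): the vanishing compensates for the discontinuities of `φ`. The evolved
observable therefore stays uniformly within a geometric sum, of order `ε · pMin ^ (-n/d)`, of its
noiseless composition with `φ^[n]`, which has the full norm. Dissipation forces this sum to be of
order one. -/

instance isProbabilityMeasure_unitAddCircle :
    IsProbabilityMeasure (volume : Measure UnitAddCircle) :=
  ⟨UnitAddCircle.measure_univ⟩

instance isProbabilityMeasure_unitAddTorus {d : ℕ} :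
    IsProbabilityMeasure (volume : Measure (UnitAddTorus (Fin d))) :=
  inferInstanceAs (IsProbabilityMeasure (Measure.pi fun _ : Fin d => volume))

variable {d : ℕ}

theorem measurable_proj : Measurable (proj : (Fin d → ℝ) → UnitAddTorus (Fin d)) :=
  measurable_pi_lambda _ fun j => AddCircle.measurable_mk'.comp (measurable_pi_apply j)

theorem measurable_rep : Measurable (rep : UnitAddTorus (Fin d) → Fin d → ℝ) :=
  measurable_pi_lambda _ fun j => measurable_subtype_coe.comp
    ((AddCircle.measurableEquivIco (1 : ℝ) 0).measurable.comp (measurable_pi_apply j))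

theorem proj_rep (x : UnitAddTorus (Fin d)) : proj (rep x) = x :=
  funext fun _ => AddCircle.coe_equivIco

theorem rep_proj {x : Fin d → ℝ} (hx : x ∈ unitCube d) : rep (proj x) = x := by
  funext j
  have h : x j ∈ Set.Ico (0 : ℝ) (0 + 1) := by simpa using hx j trivial
  simp only [rep, proj, AddCircle.equivIco_coe_eq h]

theorem measurableSet_unitCube : MeasurableSet (unitCube d) :=
  MeasurableSet.univ_pi fun _ => measurableSet_Ico

theorem measurePreserving_proj :
    MeasurePreserving (proj : (Fin d → ℝ) → UnitAddTorus (Fin d))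
      (volume.restrict (unitCube d)) volume := by
  have h := measurePreserving_pi (fun _ : Fin d => volume.restrict (Set.Ico (0 : ℝ) 1))
    (fun _ : Fin d => (volume : Measure UnitAddCircle))
    (f := fun _ x => (x : UnitAddCircle)) (fun _ => by
      have := UnitAddCircle.measurePreserving_mk 0
      rw [zero_add] at this
      rwa [Measure.restrict_congr_set Ico_ae_eq_Ioc])
  rw [← Measure.restrict_pi_pi] at h
  exact h

theorem measurePreserving_rep :
    MeasurePreserving (rep : UnitAddTorus (Fin d) → Fin d → ℝ)
      volume (volume.restrict (unitCube d)) := by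
  refine ⟨measurable_rep, ?_⟩
  rw [← measurePreserving_proj.map_eq, Measure.map_map measurable_rep measurable_proj]
  conv_rhs => rw [← Measure.map_id (μ := volume.restrict (unitCube d))]
  refine Measure.map_congr ?_
  filter_upwards [ae_restrict_mem measurableSet_unitCube] with x hx using rep_proj hx

/-- The open unit cube `(0,1)^d`. -/
def openCube (d : ℕ) : Set (Fin d → ℝ) := Set.univ.pi fun _ => Set.Ioo (0 : ℝ) 1

theorem isOpen_openCube : IsOpen (openCube d) :=
  isOpen_set_pi Set.finite_univ fun _ _ => isOpen_Ioo

theorem openCube_ae_eq_Icc : openCube d =ᵐ[volume] Set.Icc (0 : Fin d → ℝ) 1 :=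
  Measure.univ_pi_Ioo_ae_eq_Icc

theorem unitCube_ae_eq_Icc : unitCube d =ᵐ[volume] Set.Icc (0 : Fin d → ℝ) 1 :=
  Measure.univ_pi_Ico_ae_eq_Icc

theorem ae_rep_mem_openCube : ∀ᵐ x : UnitAddTorus (Fin d), rep x ∈ openCube d := by
  refine measurePreserving_rep.quasiMeasurePreserving.ae (p := fun y => y ∈ openCube d) ?_
  rw [Measure.restrict_congr_set (unitCube_ae_eq_Icc.trans openCube_ae_eq_Icc.symm)]
  exact ae_restrict_mem isOpen_openCube.measurableSet

/-- A point of the closed unit cube which agrees with a point of the open cube modulo `ℤ^d`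
equals it. -/
theorem eq_of_proj_eq {x y : Fin d → ℝ} (hx : x ∈ Set.Icc (0 : Fin d → ℝ) 1)
    (hy : y ∈ openCube d) (h : proj x = proj y) : x = y := by
  funext j
  have hj : (x j : UnitAddCircle) = y j := congrFun h j
  have hy' := hy j trivial
  have h0 : 0 ≤ x j := hx.1 j
  have h1 : x j ≤ 1 := hx.2 j
  rcases eq_or_lt_of_le h0 with h | h
  · exact (AddCircle.coe_eq_coe_iff_of_mem_Ico (a := (0 : ℝ)) (p := 1)
      ⟨h0, by linarith⟩ ⟨hy'.1.le, by linarith [hy'.2]⟩).1 hj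
  · exact (AddCircle.coe_eq_coe_iff_of_mem_Ioc (a := (0 : ℝ)) (p := 1)
      ⟨h, by linarith⟩ ⟨hy'.1, by linarith [hy'.2]⟩).1 hj

theorem IsAxisCube.measurableSet {Q : Set (Fin d → ℝ)} (h : IsAxisCube Q) : MeasurableSet Q := by
  obtain ⟨a, l, I, hl, hI, rfl⟩ := h
  refine MeasurableSet.univ_pi fun j => ?_
  have h1 : I j = Set.Ioo (a j) (a j + l) ∪ (I j ∩ {a j, a j + l}) := by
    ext t
    constructor
    · intro ht
      rcases eq_or_lt_of_le ((hI j).2 ht).1 with h | h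
      · exact Or.inr ⟨ht, Or.inl h.symm⟩
      · rcases eq_or_lt_of_le ((hI j).2 ht).2 with h' | h'
        · exact Or.inr ⟨ht, Or.inr h'⟩
        · exact Or.inl ⟨h, h'⟩
    · rintro (h | h)
      · exact (hI j).1 h
      · exact h.1
  rw [h1]
  exact measurableSet_Ioo.union ((Set.toFinite _).subset Set.inter_subset_right).measurableSet

theorem IsAxisCube.volume_pos {Q : Set (Fin d → ℝ)} (h : IsAxisCube Q) : 0 < volume Q := by
  obtain ⟨a, l, I, hl, hI, rfl⟩ := h
  refine lt_of_lt_of_le ?_ (measure_mono (Set.pi_mono fun j _ => (hI j).1))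
  refine (isOpen_set_pi Set.finite_univ fun _ _ => isOpen_Ioo).measure_pos _ ?_
  refine ⟨fun j => a j + l / 2, fun j _ => ⟨by linarith, by linarith⟩⟩

end

/-! ### Affine branches, their inverses, and invariance of Lebesgue measure -/

section

namespace PiecewiseAffine
variable {d : ℕ} (B : PiecewiseAffine d)

theorem measurableSet_cell (i : Fin B.M) : MeasurableSet (B.cell i) := (B.cell_cube i).measurableSet

theorem cell_subset_unitCube (i : Fin B.M) : B.cell i ⊆ unitCube d := by
  rw [← B.cell_cover]; exact Set.subset_iUnion _ i

theorem volume_unitCube : volume (unitCube d) = 1 := by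
  simp [unitCube, volume_pi_pi]

theorem volume_cell_ne_top (i : Fin B.M) : volume (B.cell i) ≠ ⊤ :=
  ne_top_of_le_ne_top (by simp [volume_unitCube]) (measure_mono (B.cell_subset_unitCube i))

theorem p_pos (i : Fin B.M) : 0 < B.p i :=
  ENNReal.toReal_pos (B.cell_cube i).volume_pos.ne' (B.volume_cell_ne_top i)

theorem ofReal_p (i : Fin B.M) : ENNReal.ofReal (B.p i) = volume (B.cell i) :=
  ENNReal.ofReal_toReal (B.volume_cell_ne_top i)

theorem sum_volume_cell : ∑ i, volume (B.cell i) = 1 := by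
  rw [← volume_unitCube (d := d), ← B.cell_cover,
    measure_iUnion B.cell_disjoint B.measurableSet_cell, tsum_fintype]

theorem sum_p : ∑ i, B.p i = 1 := by
  have h := congrArg ENNReal.toReal B.sum_volume_cell
  rwa [ENNReal.toReal_sum fun i _ => B.volume_cell_ne_top i, ENNReal.toReal_one] at h

theorem p_lt_one (i : Fin B.M) : B.p i < 1 := by
  have : Nontrivial (Fin B.M) := Fin.nontrivial_iff_two_le.2 B.two_le
  obtain ⟨j, hj⟩ := exists_ne i
  have h := Finset.add_le_sum (f := B.p) (s := Finset.univ) (i := i) (j := j)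
    (fun k _ => (B.p_pos k).le) (Finset.mem_univ _) (Finset.mem_univ _) hj.symm
  linarith [B.sum_p, B.p_pos j]

theorem nonempty_index : Nonempty (Fin B.M) := ⟨⟨0, by linarith [B.two_le]⟩⟩

theorem pMin_le (i : Fin B.M) : B.pMin ≤ B.p i := ciInf_le (Set.finite_range _).bddBelow i

theorem le_pMax (i : Fin B.M) : B.p i ≤ B.pMax := le_ciSup (Set.finite_range _).bddAbove i

theorem pMin_pos : 0 < B.pMin := by
  have := B.nonempty_index
  obtain ⟨i, hi⟩ := exists_eq_ciInf_of_finite (f := B.p)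
  rw [pMin, ← hi]; exact B.p_pos i

theorem pMax_lt_one : B.pMax < 1 := by
  have := B.nonempty_index
  obtain ⟨i, hi⟩ := exists_eq_ciSup_of_finite (f := B.p)
  rw [pMax, ← hi]; exact B.p_lt_one i

theorem pMin_le_pMax : B.pMin ≤ B.pMax :=
  have i := B.nonempty_index.some
  (B.pMin_le i).trans (B.le_pMax i)

/-- The side length of the `i`-th piece. -/
def side (i : Fin B.M) : ℝ := B.p i ^ (1 / (d : ℝ))

theorem side_pos (i : Fin B.M) : 0 < B.side i := Real.rpow_pos_of_pos (B.p_pos i) _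

theorem side_pow [NeZero d] (i : Fin B.M) : B.side i ^ d = B.p i := by
  rw [side, ← Real.rpow_natCast, ← Real.rpow_mul (B.p_pos i).le,
    one_div_mul_cancel (Nat.cast_ne_zero.2 (NeZero.ne d)), Real.rpow_one]

/-- The inverse of the `i`-th affine map. -/
def invBranch (i : Fin B.M) (y : Fin d → ℝ) : Fin d → ℝ :=
  (B.side i • (B.D i).transpose).mulVec (y - B.e i)

theorem branch_invBranch (i : Fin B.M) (y : Fin d → ℝ) : B.branch i (B.invBranch i y) = y := by
  have h : B.D i * (B.D i).transpose = 1 := (Matrix.mem_orthogonalGroup_iff _ _).1 (B.D_orthogonal i)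
  have hs := (B.side_pos i).ne'
  unfold side at hs
  rw [branch, affineBranch, invBranch, side, Matrix.smul_mulVec, Matrix.mulVec_smul,
    Matrix.mulVec_mulVec, h, Matrix.one_mulVec, smul_smul, inv_mul_cancel₀ hs, one_smul,
    sub_add_cancel]

theorem invBranch_branch (i : Fin B.M) (x : Fin d → ℝ) : B.invBranch i (B.branch i x) = x := by
  have h : (B.D i).transpose * B.D i = 1 :=
    (Matrix.mem_orthogonalGroup_iff' _ _).1 (B.D_orthogonal i)
  have hs := (B.side_pos i).ne'
  unfold side at hs
  rw [branch, affineBranch, invBranch, side, add_sub_cancel_right, Matrix.smul_mulVec,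
    Matrix.mulVec_smul, Matrix.mulVec_mulVec, h, Matrix.one_mulVec, smul_smul, mul_inv_cancel₀ hs,
    one_smul]

theorem continuous_branch (i : Fin B.M) : Continuous (B.branch i) := by
  unfold branch affineBranch
  have h : Continuous fun x : Fin d → ℝ => (B.D i).mulVec x :=
    continuous_const.matrix_mulVec continuous_id
  exact (h.const_smul (B.p i ^ (1 / (d : ℝ)))⁻¹).add continuous_const

theorem continuous_invBranch (i : Fin B.M) : Continuous (B.invBranch i) := by
  unfold invBranch
  exact continuous_const.matrix_mulVec (continuous_id.sub continuous_const)

theorem map_invBranch_volume [NeZero d] (i : Fin B.M) :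
    Measure.map (B.invBranch i) volume = (ENNReal.ofReal (B.p i))⁻¹ • volume := by
  have hdet : |(B.side i • (B.D i).transpose).det| = B.p i := by
    have h := congrArg Matrix.det ((Matrix.mem_orthogonalGroup_iff _ _).1 (B.D_orthogonal i))
    have h1 : (B.D i).det * (B.D i).det = 1 := by simpa [Matrix.star_eq_conjTranspose] using h
    have h2 : |(B.D i).det| = 1 := by
      rcases mul_self_eq_one_iff.1 h1 with h | h <;> simp [h]
    rw [Matrix.det_smul, abs_mul, Matrix.det_transpose, h2, mul_one, Fintype.card_fin, B.side_pow,
      abs_of_pos (B.p_pos i)]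
  have hne : (B.side i • (B.D i).transpose).det ≠ 0 := by
    intro h
    rw [h, abs_zero] at hdet
    exact (B.p_pos i).ne hdet
  have hcomp : B.invBranch i =
      Matrix.toLin' (B.side i • (B.D i).transpose) ∘ fun y => y - B.e i := rfl
  have hmeas : Measurable (Matrix.toLin' (B.side i • (B.D i).transpose)) :=
    (LinearMap.continuous_of_finiteDimensional _).measurable
  rw [hcomp, ← Measure.map_map hmeas (measurable_id'.sub_const (B.e i)),
    (measurePreserving_sub_right volume (B.e i)).map_eq,
    Real.map_matrix_volume_pi_eq_smul_volume_pi hne, abs_inv, hdet,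
    ENNReal.ofReal_inv_of_pos (B.p_pos i)]

variable {B}

/-- Surjectivity of the torus branch gives a point of the cell with the same image modulo `ℤ^d`. Its
image lies in the closed cube and the given one in the open cube, so the two agree in `ℝ^d`, and the
affine map is injective. -/
theorem mem_cell_of_branch_mem_openCube (hB : B.CubeAssumption) {i : Fin B.M} {x : Fin d → ℝ}
    (hx : B.branch i x ∈ openCube d) : x ∈ B.cell i := by
  obtain ⟨t, ⟨z, hz, rfl⟩, ht⟩ := (hB.bijective i).surjOn (Set.mem_univ (proj (B.branch i x)))
  have h1 : rep (proj z) = z := rep_proj (B.cell_subset_unitCube i hz)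
  rw [torusBranch, h1] at ht
  have h2 := eq_of_proj_eq (B.mapsTo i hz) hx ht
  change B.branch i z = B.branch i x at h2
  rwa [← B.invBranch_branch i x, ← h2, B.invBranch_branch]

theorem invBranch_mem_cell (hB : B.CubeAssumption) (i : Fin B.M) {y : Fin d → ℝ}
    (hy : y ∈ openCube d) : B.invBranch i y ∈ B.cell i :=
  mem_cell_of_branch_mem_openCube hB (by rwa [B.branch_invBranch])

/-- The preimage is squeezed between the open and the closed cube, which differ by a null set. -/
theorem preimage_cell_ae_eq (hB : B.CubeAssumption) (i : Fin B.M) :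
    B.invBranch i ⁻¹' B.cell i =ᵐ[volume] unitCube d := by
  have h1 : openCube d ≤ᵐ[volume] B.invBranch i ⁻¹' B.cell i :=
    Filter.Eventually.of_forall fun y hy => invBranch_mem_cell hB i hy
  have h2 : B.invBranch i ⁻¹' B.cell i ≤ᵐ[volume] Set.Icc (0 : Fin d → ℝ) 1 :=
    Filter.Eventually.of_forall fun y hy => by
      have := B.mapsTo i hy
      change B.branch i _ ∈ _ at this
      rwa [B.branch_invBranch] at this
  exact (h2.trans unitCube_ae_eq_Icc.symm.le).antisymm
    ((unitCube_ae_eq_Icc.trans openCube_ae_eq_Icc.symm).le.trans h1)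

theorem map_invBranch_unitCube [NeZero d] (hB : B.CubeAssumption) (i : Fin B.M) :
    Measure.map (B.invBranch i) (volume.restrict (unitCube d)) =
      (ENNReal.ofReal (B.p i))⁻¹ • volume.restrict (B.cell i) := by
  rw [← Measure.restrict_congr_set (preimage_cell_ae_eq hB i),
    ← Measure.restrict_map (B.continuous_invBranch i).measurable (B.measurableSet_cell i),
    map_invBranch_volume, Measure.restrict_smul]

variable (B) in
/-- The inverse of the `i`-th branch on the torus. -/
def torusInv (i : Fin B.M) (y : UnitAddTorus (Fin d)) : UnitAddTorus (Fin d) :=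
  proj (B.invBranch i (rep y))

theorem measurable_torusInv (i : Fin B.M) : Measurable (B.torusInv i) :=
  measurable_proj.comp ((B.continuous_invBranch i).measurable.comp measurable_rep)

/-- Lebesgue measure on the torus is the average of its images under the inverse branches. -/
theorem sum_smul_map_torusInv [NeZero d] (hB : B.CubeAssumption) :
    ∑ i, ENNReal.ofReal (B.p i) • Measure.map (B.torusInv i) volume =
      (volume : Measure (UnitAddTorus (Fin d))) := by
  have h (i : Fin B.M) : ENNReal.ofReal (B.p i) • Measure.map (B.torusInv i) volume =
      Measure.map proj (volume.restrict (B.cell i)) := by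
    have h1 : B.torusInv i = proj ∘ B.invBranch i ∘ rep := rfl
    rw [h1, ← Measure.map_map measurable_proj
      ((B.continuous_invBranch i).measurable.comp measurable_rep),
      ← Measure.map_map (B.continuous_invBranch i).measurable measurable_rep,
      measurePreserving_rep.map_eq, map_invBranch_unitCube hB, Measure.map_smul, smul_smul,
      ENNReal.mul_inv_cancel (by simpa using B.p_pos i) ENNReal.ofReal_ne_top, one_smul]
  simp_rw [h]
  have h2 : ∑ i, volume.restrict (B.cell i) = volume.restrict (unitCube d) := by
    rw [← B.cell_cover, Measure.restrict_iUnion B.cell_disjoint B.measurableSet_cell,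
      Measure.sum_fintype]
  rw [← measurePreserving_proj.map_eq, ← h2]
  simpa only [Measure.mapₗ_apply_of_measurable measurable_proj] using
    (map_sum (Measure.mapₗ proj) (fun i => volume.restrict (B.cell i)) Finset.univ).symm

theorem rep_torusInv (hB : B.CubeAssumption) (i : Fin B.M) {y : UnitAddTorus (Fin d)}
    (hy : rep y ∈ openCube d) : rep (B.torusInv i y) = B.invBranch i (rep y) :=
  rep_proj (B.cell_subset_unitCube i (invBranch_mem_cell hB i hy))

theorem index_eq {x : UnitAddTorus (Fin d)} {i : Fin B.M} (h : rep x ∈ B.cell i) :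
    B.index x = i := by
  by_contra hne
  exact Set.disjoint_left.1 (B.cell_disjoint hne) (Classical.choose_spec (B.exists_index x)) h

theorem rep_mem_cell_index (x : UnitAddTorus (Fin d)) : rep x ∈ B.cell (B.index x) :=
  Classical.choose_spec (B.exists_index x)

theorem phi_torusInv (hB : B.CubeAssumption) (i : Fin B.M) {y : UnitAddTorus (Fin d)}
    (hy : rep y ∈ openCube d) : B.phi (B.torusInv i y) = y := by
  have h := rep_torusInv hB i hy
  have hi : B.index (B.torusInv i y) = i := index_eq (by
    rw [h]; exact invBranch_mem_cell hB i hy)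
  rw [phi, hi, torusBranch, h, branch_invBranch, proj_rep]

theorem measurable_phi : Measurable B.phi := by
  intro s hs
  have h : B.phi ⁻¹' s = ⋃ i, (rep ⁻¹' B.cell i) ∩ B.torusBranch i ⁻¹' s := by
    ext x
    simp only [Set.mem_iUnion, Set.mem_inter_iff, Set.mem_preimage]
    constructor
    · exact fun hx => ⟨_, rep_mem_cell_index x, hx⟩
    · rintro ⟨i, hi, hx⟩
      rwa [phi, index_eq hi]
  rw [h]
  refine MeasurableSet.iUnion fun i => ?_
  exact (measurable_rep (B.measurableSet_cell i)).inter
    ((measurable_proj.comp ((B.continuous_branch i).measurable.comp measurable_rep)) hs)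

/-- Lebesgue measure is the `p i`-weighted average of its images under the inverse branches, and `φ`
undoes each inverse branch almost everywhere. The weights sum to one. -/
theorem measurePreserving_phi [NeZero d] (hB : B.CubeAssumption) :
    MeasurePreserving B.phi volume volume := by
  refine ⟨measurable_phi, ?_⟩
  have h (i : Fin B.M) : Measure.map B.phi (Measure.map (B.torusInv i) volume) = volume := by
    rw [Measure.map_map measurable_phi (measurable_torusInv i)]
    conv_rhs => rw [← Measure.map_id (μ := (volume : Measure (UnitAddTorus (Fin d))))]
    refine Measure.map_congr ?_
    filter_upwards [ae_rep_mem_openCube] with y hy using phi_torusInv hB i hy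
  conv_lhs => rw [← sum_smul_map_torusInv hB]
  have h2 := map_sum (Measure.mapₗ B.phi) (fun i => ENNReal.ofReal (B.p i) •
    Measure.map (B.torusInv i) (volume : Measure (UnitAddTorus (Fin d)))) Finset.univ
  simp only [Measure.mapₗ_apply_of_measurable measurable_phi, Measure.map_smul, h] at h2
  rw [h2, ← Finset.sum_smul]
  simp_rw [B.ofReal_p]
  rw [B.sum_volume_cell, one_smul]

end PiecewiseAffine

end

/-! ### L² estimates for averaging, and the evolution as iteration of one step -/

section

section L2

variable {α E : Type*} [MeasurableSpace α] [NormedAddCommGroup E] {μ : Measure α}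

/-- The `L²` norm as a real number. -/
def l2norm (μ : Measure α) (f : α → E) : ℝ := Real.sqrt (∫ x, ‖f x‖ ^ 2 ∂μ)

theorem l2norm_nonneg (f : α → E) : 0 ≤ l2norm μ f := Real.sqrt_nonneg _

theorem sq_l2norm (f : α → E) : l2norm μ f ^ 2 = ∫ x, ‖f x‖ ^ 2 ∂μ :=
  Real.sq_sqrt (integral_nonneg fun _ => sq_nonneg _)

theorem eLpNorm_two_eq {f : α → E} (hf : MemLp f 2 μ) :
    eLpNorm f 2 μ = ENNReal.ofReal (l2norm μ f) := by
  rw [hf.eLpNorm_eq_integral_rpow_norm (by simp) (by simp), l2norm, Real.sqrt_eq_rpow]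
  simp

theorem integrable_norm_sq {f : α → E} (hf : MemLp f 2 μ) : Integrable (fun x => ‖f x‖ ^ 2) μ :=
  (memLp_two_iff_integrable_sq_norm hf.1).1 hf

theorem l2norm_add_le {f g : α → E} (hf : MemLp f 2 μ) (hg : MemLp g 2 μ) :
    l2norm μ (f + g) ≤ l2norm μ f + l2norm μ g := by
  have h := eLpNorm_add_le hf.1 hg.1 (p := 2) (by norm_num)
  rw [eLpNorm_two_eq hf, eLpNorm_two_eq hg, eLpNorm_two_eq (hf.add hg),
    ← ENNReal.ofReal_add (l2norm_nonneg _) (l2norm_nonneg _)] at h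
  exact (ENNReal.ofReal_le_ofReal_iff (add_nonneg (l2norm_nonneg _) (l2norm_nonneg _))).1 h

theorem norm_integral_mul_le {f g : α → ℂ} (hf : MemLp f 2 μ) (hg : MemLp g 2 μ) :
    ‖∫ x, f x * g x ∂μ‖ ≤ l2norm μ f * l2norm μ g := by
  refine (norm_integral_le_integral_norm _).trans ?_
  have h := integral_mul_norm_le_Lp_mul_Lq (μ := μ) (f := f) (g := g) Real.HolderConjugate.two_two
    (by simpa using hf) (by simpa using hg)
  simpa [l2norm, Real.sqrt_eq_rpow] using h

theorem l2norm_comp {β : Type*} [MeasurableSpace β] {ν : Measure β} {φ : β → α}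
    (hφ : MeasurePreserving φ ν μ) {f : α → E} (hf : AEStronglyMeasurable f μ) :
    l2norm ν (f ∘ φ) = l2norm μ f := by
  unfold l2norm
  congr 1
  have h : AEStronglyMeasurable (fun x => ‖f x‖ ^ 2) (Measure.map φ ν) := by
    rw [hφ.map_eq]; exact hf.norm.pow 2
  rw [← hφ.map_eq, integral_map hφ.measurable.aemeasurable h]
  rfl

/-- The variance of `‖f‖` is nonnegative. -/
theorem norm_integral_sq_le [NormedSpace ℝ E] [IsProbabilityMeasure μ] {f : α → E}
    (hf : MemLp f 2 μ) : ‖∫ x, f x ∂μ‖ ^ 2 ≤ ∫ x, ‖f x‖ ^ 2 ∂μ := by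
  set a := ∫ x, ‖f x‖ ∂μ
  have h1 : ‖∫ x, f x ∂μ‖ ≤ a := norm_integral_le_integral_norm _
  have hi : Integrable (fun x => ‖f x‖) μ := (hf.integrable (by norm_num)).norm
  have h2 : 0 ≤ ∫ x, (‖f x‖ - a) ^ 2 ∂μ := integral_nonneg fun _ => sq_nonneg _
  have h3 : ∫ x, (‖f x‖ - a) ^ 2 ∂μ = (∫ x, ‖f x‖ ^ 2 ∂μ) - 2 * a * a + a ^ 2 := by
    have : (fun x => (‖f x‖ - a) ^ 2) = fun x => (‖f x‖ ^ 2 - 2 * a * ‖f x‖) + a ^ 2 := by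
      funext x; ring
    have h4 : Integrable (fun x => ‖f x‖ ^ 2 - 2 * a * ‖f x‖) μ :=
      (integrable_norm_sq hf).sub (hi.const_mul _)
    rw [this, integral_add h4 (integrable_const _),
      integral_sub (integrable_norm_sq hf) (hi.const_mul _), integral_const_mul, integral_const]
    simp [a]
  nlinarith [norm_nonneg (∫ x, f x ∂μ)]

end L2

variable {d : ℕ} {E : Type*} [NormedAddCommGroup E] [NormedSpace ℝ E]

/-- The average of `f` over the translates by a random vector with law `ν`. -/
def avg (ν : Measure (UnitAddTorus (Fin d))) (f : UnitAddTorus (Fin d) → E)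
    (y : UnitAddTorus (Fin d)) : E := ∫ z, f (y + z) ∂ν

variable {ν : Measure (UnitAddTorus (Fin d))} [IsProbabilityMeasure ν]

/-- Fubini together with translation invariance for each fixed noise. It makes `f (y + z)`
meaningful for almost-everywhere classes, so that the estimates on `avg` reduce to Fubini on the
product. -/
theorem measurePreserving_add :
    MeasurePreserving (fun p : UnitAddTorus (Fin d) × UnitAddTorus (Fin d) => p.1 + p.2)
      (volume.prod ν) volume := by
  refine ⟨measurable_fst.add measurable_snd, Measure.ext fun s hs => ?_⟩
  have hm : Measurable fun p : UnitAddTorus (Fin d) × UnitAddTorus (Fin d) => p.1 + p.2 :=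
    measurable_fst.add measurable_snd
  rw [Measure.map_apply hm hs, Measure.prod_apply_symm (hm hs)]
  have (z : UnitAddTorus (Fin d)) :
      volume ((fun x => (x, z)) ⁻¹' ((fun p : UnitAddTorus (Fin d) × UnitAddTorus (Fin d) =>
        p.1 + p.2) ⁻¹' s)) = volume s :=
    measure_preimage_add_right volume z s
  simp [this]

theorem memLp_add {F : Type*} [NormedAddCommGroup F] {f : UnitAddTorus (Fin d) → F}
    (hf : MemLp f 2 volume) :
    MemLp (fun p : UnitAddTorus (Fin d) × UnitAddTorus (Fin d) => f (p.1 + p.2)) 2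
      (volume.prod ν) :=
  hf.comp_measurePreserving measurePreserving_add

theorem ae_memLp_section {F : Type*} [NormedAddCommGroup F] {f : UnitAddTorus (Fin d) → F}
    (hf : MemLp f 2 volume) :
    ∀ᵐ y, MemLp (fun z => f (y + z)) 2 ν := by
  have h := memLp_add (ν := ν) hf
  filter_upwards [h.1.prodMk_left, (integrable_norm_sq h).prod_right_ae] with y h1 h2
  exact (memLp_two_iff_integrable_sq_norm h1).2 h2

theorem avg_sq_le {f : UnitAddTorus (Fin d) → E} (hf : MemLp f 2 volume) :
    ∀ᵐ y, ‖avg ν f y‖ ^ 2 ≤ ∫ z, ‖f (y + z)‖ ^ 2 ∂ν := by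
  filter_upwards [ae_memLp_section (ν := ν) hf] with y hy using norm_integral_sq_le hy

theorem memLp_avg {f : UnitAddTorus (Fin d) → E} (hf : MemLp f 2 volume) :
    MemLp (avg ν f) 2 volume := by
  have h := memLp_add (ν := ν) hf
  have hm : AEStronglyMeasurable (avg ν f) volume := h.1.integral_prod_right'
  rw [memLp_two_iff_integrable_sq_norm hm]
  refine (integrable_norm_sq h).integral_prod_left.mono' (hm.norm.pow 2) ?_
  filter_upwards [avg_sq_le (ν := ν) hf] with y hy
  rwa [Real.norm_of_nonneg (sq_nonneg _)]

theorem l2norm_avg_le {f : UnitAddTorus (Fin d) → E} (hf : MemLp f 2 volume) :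
    l2norm volume (avg ν f) ≤ l2norm volume f := by
  have h := memLp_add (ν := ν) hf
  refine Real.sqrt_le_sqrt ?_
  calc ∫ y, ‖avg ν f y‖ ^ 2 ≤ ∫ y, ∫ z, ‖f (y + z)‖ ^ 2 ∂ν :=
        integral_mono_ae (integrable_norm_sq (memLp_avg hf))
          (integrable_norm_sq h).integral_prod_left (avg_sq_le hf)
    _ = ∫ p : UnitAddTorus (Fin d) × UnitAddTorus (Fin d), ‖f (p.1 + p.2)‖ ^ 2
          ∂(volume.prod ν) := (integral_prod _ (integrable_norm_sq h)).symm
    _ = ∫ y, ‖f y‖ ^ 2 := by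
        rw [← sq_l2norm, ← sq_l2norm, ← l2norm_comp (measurePreserving_add (ν := ν)) hf.1]
        rfl

/-- Fubini, then the substitution `y ↦ y - z` for each fixed `z`: the average is moved onto the
other factor as a translation in the opposite direction. -/
theorem integral_mul_avg {F h : UnitAddTorus (Fin d) → ℂ} (hF : MemLp F 2 volume)
    (hh : MemLp h 2 volume) :
    ∫ y, F y * avg ν h y = ∫ z, (∫ y, F (y - z) * h y) ∂ν := by
  have hi : Integrable (fun p : UnitAddTorus (Fin d) × UnitAddTorus (Fin d) =>
      F p.1 * h (p.1 + p.2)) (volume.prod ν) :=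
    (hF.comp_measurePreserving measurePreserving_fst).integrable_mul (memLp_add hh)
  simp_rw [avg, ← integral_const_mul]
  rw [← integral_prod _ hi, integral_prod_symm _ hi]
  refine integral_congr_ae (Filter.Eventually.of_forall fun z => ?_)
  simpa using (integral_add_right_eq_self (μ := volume)
    (fun y => F (y - z) * h y) z)

/-- A function which changes little under the translations in the support of `ν` is nearly
orthogonal to `avg ν h - h`. -/
theorem norm_integral_mul_avg_sub_le {F h : UnitAddTorus (Fin d) → ℂ} (hF : MemLp F 2 volume)
    (hh : MemLp h 2 volume) {b : ℝ}
    (hb : ∀ᵐ z ∂ν, l2norm volume (fun y => F (y - z) - F y) ≤ b) :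
    ‖(∫ y, F y * avg ν h y) - ∫ y, F y * h y‖ ≤ b * l2norm volume h := by
  have hFz (z : UnitAddTorus (Fin d)) : MemLp (fun y => F (y - z)) 2 volume :=
    hF.comp_measurePreserving (measurePreserving_sub_right volume z)
  have hi : Integrable (fun z => ∫ y, F (y - z) * h y) ν := by
    have hi : Integrable (fun p : UnitAddTorus (Fin d) × UnitAddTorus (Fin d) =>
      F p.1 * h (p.1 + p.2)) (volume.prod ν) :=
      (hF.comp_measurePreserving measurePreserving_fst).integrable_mul (memLp_add hh)
    refine hi.integral_prod_right.congr (Filter.Eventually.of_forall fun z => ?_)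
    simpa using (integral_add_right_eq_self (μ := volume)
      (fun y => F (y - z) * h y) z)
  have h1 : (∫ y, F y * avg ν h y) - ∫ y, F y * h y =
      ∫ z, ((∫ y, F (y - z) * h y) - ∫ y, F y * h y) ∂ν := by
    rw [integral_mul_avg hF hh, integral_sub hi (integrable_const _), integral_const]
    simp
  rw [h1]
  have h2 := norm_integral_le_of_norm_le_const (μ := ν) (C := b * l2norm volume h)
    (f := fun z => (∫ y, F (y - z) * h y) - ∫ y, F y * h y) ?_
  · simpa using h2
  · filter_upwards [hb] with z hz
    have h3 : (∫ y, F (y - z) * h y) - ∫ y, F y * h y = ∫ y, (F (y - z) - F y) * h y := by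
      simp_rw [sub_mul]
      exact (integral_sub ((hFz z).integrable_mul hh) (hF.integrable_mul hh)).symm
    rw [h3]
    exact (norm_integral_mul_le ((hFz z).sub hF) hh).trans
      (mul_le_mul_of_nonneg_right hz (l2norm_nonneg _))

/-- One step of the evolution of observables. -/
def step (φ : UnitAddTorus (Fin d) → UnitAddTorus (Fin d)) (ν : Measure (UnitAddTorus (Fin d)))
    (f : UnitAddTorus (Fin d) → E) (x : UnitAddTorus (Fin d)) : E := avg ν f (φ x)

variable {φ : UnitAddTorus (Fin d) → UnitAddTorus (Fin d)}

theorem memLp_step (hφ : MeasurePreserving φ volume volume) {f : UnitAddTorus (Fin d) → E}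
    (hf : MemLp f 2 volume) : MemLp (step φ ν f) 2 volume :=
  (memLp_avg hf).comp_measurePreserving hφ

theorem l2norm_step (hφ : MeasurePreserving φ volume volume) {f : UnitAddTorus (Fin d) → E}
    (hf : MemLp f 2 volume) : l2norm volume (step φ ν f) = l2norm volume (avg ν f) :=
  l2norm_comp hφ (memLp_avg hf).1

theorem memLp_step_iterate (hφ : MeasurePreserving φ volume volume)
    {f : UnitAddTorus (Fin d) → E} (hf : MemLp f 2 volume) (n : ℕ) :
    MemLp ((step φ ν)^[n] f) 2 volume := by
  induction n with
  | zero => exact hf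
  | succ n ih => rw [Function.iterate_succ_apply']; exact memLp_step hφ ih

theorem l2norm_step_iterate_succ_le (hφ : MeasurePreserving φ volume volume)
    {f : UnitAddTorus (Fin d) → E} (hf : MemLp f 2 volume) (n : ℕ) :
    l2norm volume ((step φ ν)^[n + 1] f) ≤ l2norm volume ((step φ ν)^[n] f) := by
  rw [Function.iterate_succ_apply', l2norm_step hφ (memLp_step_iterate hφ hf n)]
  exact l2norm_avg_le (memLp_step_iterate hφ hf n)

theorem l2norm_step_iterate_antitone (hφ : MeasurePreserving φ volume volume)
    {f : UnitAddTorus (Fin d) → E} (hf : MemLp f 2 volume) :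
    Antitone fun n => l2norm volume ((step φ ν)^[n] f) :=
  antitone_nat_of_succ_le (l2norm_step_iterate_succ_le hφ hf)

/-- Stationarity: from a uniform starting point every later state is uniform. This gives
integrability of `θ` along the process for almost every starting point. -/
theorem measurePreserving_process (hφ : MeasurePreserving φ volume volume) (n : ℕ) :
    MeasurePreserving (fun p : UnitAddTorus (Fin d) × (Fin n → UnitAddTorus (Fin d)) =>
      process φ n p.1 p.2) (volume.prod (Measure.pi fun _ => ν)) volume := by
  induction n with
  | zero => exact measurePreserving_fst
  | succ n ih =>
    have h1 := measurePreserving_piFinSuccAbove (fun _ : Fin (n + 1) => ν) (Fin.last n)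
    have h2 := (MeasurePreserving.id (volume : Measure (UnitAddTorus (Fin d)))).prod
      (Measure.measurePreserving_swap.comp h1)
    have h3 := (measurePreserving_prodAssoc (volume : Measure (UnitAddTorus (Fin d)))
      (Measure.pi fun _ : Fin n => ν) ν).symm
    have h4 := (hφ.comp ih).prod (MeasurePreserving.id ν)
    have h5 := (measurePreserving_add (ν := ν)).comp (h4.comp (h3.comp h2))
    convert h5 using 2 with p
    simp only [process, Function.comp_apply, Prod.map, id]
    congr 3
    funext j
    simp [Fin.init, MeasurableEquiv.piFinSuccAbove, MeasurableEquiv.prodAssoc]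

/-- Integrating out the last noise first replaces `θ` by `step φ _ θ` and leaves a process of `n`
steps. The equality holds almost everywhere because Fubini needs integrability in the noises. -/
theorem evolve_succ (hφ : MeasurePreserving φ volume volume)
    {k : UnitAddTorus (Fin d) → ℝ} [IsProbabilityMeasure (noiseLaw k)]
    {θ : UnitAddTorus (Fin d) → ℝ} (hθ : MemLp θ 2 volume) (n : ℕ) :
    evolve φ k (n + 1) θ =ᵐ[volume] evolve φ k n (step φ (noiseLaw k) θ) := by
  have h := (hθ.comp_measurePreserving (measurePreserving_process (ν := noiseLaw k) hφ (n + 1)))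
  filter_upwards [(h.integrable (by norm_num)).prod_right_ae] with x hx
  have h1 := measurePreserving_piFinSuccAbove (fun _ : Fin (n + 1) => noiseLaw k) (Fin.last n)
  set e := MeasurableEquiv.piFinSuccAbove (fun _ : Fin (n + 1) => UnitAddTorus (Fin d))
    (Fin.last n)
  set G : UnitAddTorus (Fin d) × (Fin n → UnitAddTorus (Fin d)) → ℝ :=
    fun p => θ (φ (process φ n x p.2) + p.1)
  have hG (ζ : Fin (n + 1) → UnitAddTorus (Fin d)) : θ (process φ (n + 1) x ζ) = G (e ζ) := by
    simp only [process, G, e]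
    congr 4
    funext j
    simp [Fin.init, MeasurableEquiv.piFinSuccAbove]
  have hGi : Integrable G ((noiseLaw k).prod (Measure.pi fun _ : Fin n => noiseLaw k)) := by
    rw [← h1.integrable_comp_emb e.measurableEmbedding]
    exact hx.congr (Filter.Eventually.of_forall hG)
  calc ∫ ζ, θ (process φ (n + 1) x ζ) ∂(Measure.pi fun _ : Fin (n + 1) => noiseLaw k)
      = ∫ ζ, G (e ζ) ∂(Measure.pi fun _ : Fin (n + 1) => noiseLaw k) := by simp_rw [hG]
    _ = ∫ p, G p ∂((noiseLaw k).prod (Measure.pi fun _ : Fin n => noiseLaw k)) :=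
        h1.integral_comp e.measurableEmbedding G
    _ = _ := integral_prod_symm _ hGi

theorem evolve_ae_eq (hφ : MeasurePreserving φ volume volume)
    {k : UnitAddTorus (Fin d) → ℝ} [IsProbabilityMeasure (noiseLaw k)]
    {θ : UnitAddTorus (Fin d) → ℝ} (hθ : MemLp θ 2 volume) (n : ℕ) :
    evolve φ k n θ =ᵐ[volume] (step φ (noiseLaw k))^[n] θ := by
  induction n generalizing θ with
  | zero =>
    refine Filter.Eventually.of_forall fun x => ?_
    simp [evolve, process]
  | succ n ih =>
    rw [Function.iterate_succ_apply]
    exact (evolve_succ hφ hθ n).trans (ih (memLp_step hφ hθ))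

/-- Observables are real while the Fourier estimates are complex; the evolution commutes with the
inclusion. -/
theorem ofReal_step_iterate {ν : Measure (UnitAddTorus (Fin d))} (f : UnitAddTorus (Fin d) → ℝ)
    (n : ℕ) (x : UnitAddTorus (Fin d)) :
    (((step φ ν)^[n] f x : ℝ) : ℂ) = (step φ ν)^[n] (fun y => (f y : ℂ)) x := by
  induction n generalizing f with
  | zero => rfl
  | succ n ih =>
    rw [Function.iterate_succ_apply, Function.iterate_succ_apply, ih]
    have h : (fun y => ((step φ ν f y : ℝ) : ℂ)) = step φ ν fun y => (f y : ℂ) := by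
      funext y
      exact integral_ofReal.symm
    rw [h]

theorem IsDensity.isProbabilityMeasure {k : UnitAddTorus (Fin d) → ℝ} (hk : IsDensity k) :
    IsProbabilityMeasure (noiseLaw k) := by
  refine ⟨?_⟩
  rw [noiseLaw, withDensity_apply _ MeasurableSet.univ, Measure.restrict_univ,
    ← ofReal_integral_eq_lintegral_ofReal hk.integrable hk.nonneg, hk.integral_eq_one,
    ENNReal.ofReal_one]

end

/-! ### Translation estimates on the circle for functions that may jump at `0` -/

section

/-- The representative in `[0,1)` of a point of the circle. -/
def circleRep (t : UnitAddCircle) : ℝ := (AddCircle.equivIco (1 : ℝ) 0 t : ℝ)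

theorem circleRep_mem (t : UnitAddCircle) : circleRep t ∈ Set.Ico (0 : ℝ) 1 := by
  have h := (AddCircle.equivIco (1 : ℝ) 0 t).2
  exact ⟨h.1, h.2.trans_eq (zero_add 1)⟩

theorem coe_circleRep (t : UnitAddCircle) : (circleRep t : UnitAddCircle) = t :=
  AddCircle.coe_equivIco

theorem circleRep_coe {x : ℝ} (hx : x ∈ Set.Ico (0 : ℝ) 1) : circleRep x = x := by
  rw [circleRep, AddCircle.equivIco_coe_eq (by rwa [zero_add])]

theorem measurable_circleRep : Measurable circleRep :=
  measurable_subtype_coe.comp (AddCircle.measurableEquivIco (1 : ℝ) 0).measurable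

theorem measurePreserving_circleRep :
    MeasurePreserving circleRep volume (volume.restrict (Set.Ioc (0 : ℝ) 1)) := by
  refine ⟨measurable_circleRep, ?_⟩
  have h := UnitAddCircle.measurePreserving_mk 0
  rw [zero_add] at h
  rw [← h.map_eq, Measure.map_map measurable_circleRep h.measurable]
  conv_rhs => rw [← Measure.map_id (μ := volume.restrict (Set.Ioc (0 : ℝ) 1))]
  refine Measure.map_congr ?_
  rw [← Measure.restrict_congr_set Ico_ae_eq_Ioc]
  filter_upwards [ae_restrict_mem measurableSet_Ico] with x hx using circleRep_coe hx

theorem integral_circleRep {f : ℝ → ℝ} (hf : AEStronglyMeasurable f) :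
    ∫ t, f (circleRep t) = ∫ t in (0 : ℝ)..1, f t := by
  rw [intervalIntegral.integral_of_le zero_le_one, ← measurePreserving_circleRep.map_eq,
    integral_map measurable_circleRep.aemeasurable]
  rw [measurePreserving_circleRep.map_eq]
  exact hf.restrict

theorem sq_intervalIntegral_le {g : ℝ → ℝ} (hg : Continuous g) {a b : ℝ} (hab : a ≤ b) :
    (∫ t in a..b, g t) ^ 2 ≤ (b - a) * ∫ t in a..b, g t ^ 2 := by
  rcases hab.eq_or_lt with rfl | h
  · simp
  have hl : 0 < b - a := sub_pos.2 h
  set m := (∫ t in a..b, g t) / (b - a) with hm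
  have hm' : ∫ t in a..b, g t = m * (b - a) := by rw [hm]; field_simp
  have h1 : 0 ≤ ∫ t in a..b, (g t - m) ^ 2 :=
    intervalIntegral.integral_nonneg hab fun _ _ => sq_nonneg _
  have h2 : ∫ t in a..b, (g t - m) ^ 2 =
      (∫ t in a..b, g t ^ 2) - 2 * m * (m * (b - a)) + (b - a) * m ^ 2 := by
    have : (fun t => (g t - m) ^ 2) = fun t => (g t ^ 2 - 2 * m * g t) + m ^ 2 := by
      funext t; ring
    rw [this, intervalIntegral.integral_add, intervalIntegral.integral_sub,
      intervalIntegral.integral_const_mul, intervalIntegral.integral_const, hm', smul_eq_mul]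
    all_goals exact Continuous.intervalIntegrable (by fun_prop) _ _
  rw [hm']
  nlinarith

section OneDim

variable {u u' : ℝ → ℂ}

theorem norm_sub_le_integral (hu : ∀ t, HasDerivAt u (u' t) t) (hu' : Continuous u') {a b : ℝ}
    (hab : a ≤ b) : ‖u b - u a‖ ≤ ∫ t in a..b, ‖u' t‖ := by
  rw [← intervalIntegral.integral_eq_sub_of_hasDerivAt (fun t _ => hu t)
    (hu'.intervalIntegrable _ _)]
  exact intervalIntegral.norm_integral_le_integral_norm hab

theorem norm_sub_sq_le (hu : ∀ t, HasDerivAt u (u' t) t) (hu' : Continuous u') {a b : ℝ}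
    (hab : a ≤ b) : ‖u b - u a‖ ^ 2 ≤ (b - a) * ∫ t in a..b, ‖u' t‖ ^ 2 :=
  (pow_le_pow_left₀ (norm_nonneg _) (norm_sub_le_integral hu hu' hab) 2).trans
    (sq_intervalIntegral_le hu'.norm hab)

theorem integral_mono_unit {g : ℝ → ℝ} (hg : Continuous g) (h0 : ∀ t, 0 ≤ g t) {a b : ℝ}
    (ha : 0 ≤ a) (hab : a ≤ b) (hb : b ≤ 1) :
    ∫ t in a..b, g t ≤ ∫ t in (0 : ℝ)..1, g t :=
  intervalIntegral.integral_mono_interval ha hab hb (Filter.Eventually.of_forall h0)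
    (hg.intervalIntegrable _ _)

theorem norm_sub_sq_le_unit (hu : ∀ t, HasDerivAt u (u' t) t) (hu' : Continuous u') {a b : ℝ}
    (ha : a ∈ Set.Icc (0 : ℝ) 1) (hb : b ∈ Set.Icc (0 : ℝ) 1) :
    ‖u b - u a‖ ^ 2 ≤ ∫ t in (0 : ℝ)..1, ‖u' t‖ ^ 2 := by
  wlog hab : a ≤ b generalizing a b
  · rw [norm_sub_rev]
    exact this hb ha (le_of_not_ge hab)
  have h1 := norm_sub_sq_le hu hu' hab
  have h2 : ∫ t in a..b, ‖u' t‖ ^ 2 ≤ ∫ t in (0 : ℝ)..1, ‖u' t‖ ^ 2 :=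
    integral_mono_unit (hu'.norm.pow 2) (fun _ => sq_nonneg _) ha.1 hab hb.2
  have h3 : 0 ≤ ∫ t in a..b, ‖u' t‖ ^ 2 :=
    intervalIntegral.integral_nonneg hab fun _ _ => sq_nonneg _
  have h4 : (b - a) * ∫ t in a..b, ‖u' t‖ ^ 2 ≤ 1 * ∫ t in a..b, ‖u' t‖ ^ 2 :=
    mul_le_mul_of_nonneg_right (by linarith [ha.1, hb.2]) h3
  linarith

theorem norm_sq_sub_le (hu : ∀ t, HasDerivAt u (u' t) t) (hu' : Continuous u') {a b : ℝ}
    (ha : a ∈ Set.Icc (0 : ℝ) 1) (hb : b ∈ Set.Icc (0 : ℝ) 1) :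
    |‖u b‖ ^ 2 - ‖u a‖ ^ 2| ≤ ∫ t in (0 : ℝ)..1, 2 * (‖u t‖ * ‖u' t‖) := by
  wlog hab : a ≤ b generalizing a b
  · rw [abs_sub_comm]
    exact this hb ha (le_of_not_ge hab)
  have huc : Continuous u := continuous_iff_continuousAt.2 fun t => (hu t).continuousAt
  have hd (t : ℝ) : HasDerivAt (fun t => ‖u t‖ ^ 2) (2 * inner ℝ (u t) (u' t)) t :=
    (hu t).norm_sq
  have hc : Continuous fun t => 2 * inner ℝ (u t) (u' t) :=
    continuous_const.mul (huc.inner hu')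
  rw [← intervalIntegral.integral_eq_sub_of_hasDerivAt (fun t _ => hd t)
    (hc.intervalIntegrable _ _)]
  refine (intervalIntegral.abs_integral_le_integral_abs hab).trans ?_
  refine (intervalIntegral.integral_mono_on hab (hc.abs.intervalIntegrable _ _)
    (Continuous.intervalIntegrable (u := fun t => 2 * (‖u t‖ * ‖u' t‖)) (by fun_prop) _ _)
    fun t _ => ?_).trans
    (integral_mono_unit (by fun_prop) (fun _ => by positivity) ha.1 hab hb.2)
  rw [abs_mul, abs_two]
  exact mul_le_mul_of_nonneg_left (abs_real_inner_le_norm _ _) zero_le_two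

/-- A trace inequality: compare `‖u a‖ ^ 2` with its mean over `[0, 1]` through the derivative of
`‖u‖ ^ 2`, and split `2 ‖u‖ ‖u'‖` with weight `α`. The weight stays free because it is later matched
to the frequency scale of `u`, where both terms are comparable. -/
theorem norm_sq_le (hu : ∀ t, HasDerivAt u (u' t) t) (hu' : Continuous u') {α : ℝ} (hα : 0 < α)
    {a : ℝ} (ha : a ∈ Set.Icc (0 : ℝ) 1) :
    ‖u a‖ ^ 2 ≤ (1 + α) * (∫ t in (0 : ℝ)..1, ‖u t‖ ^ 2) +
      α⁻¹ * ∫ t in (0 : ℝ)..1, ‖u' t‖ ^ 2 := by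
  have huc : Continuous u := continuous_iff_continuousAt.2 fun t => (hu t).continuousAt
  have h1 : ∫ t in (0 : ℝ)..1, 2 * (‖u t‖ * ‖u' t‖) ≤
      α * (∫ t in (0 : ℝ)..1, ‖u t‖ ^ 2) + α⁻¹ * ∫ t in (0 : ℝ)..1, ‖u' t‖ ^ 2 := by
    rw [← intervalIntegral.integral_const_mul, ← intervalIntegral.integral_const_mul,
      ← intervalIntegral.integral_add]
    · refine intervalIntegral.integral_mono_on zero_le_one ?_ ?_ fun t _ => ?_
      · exact Continuous.intervalIntegrable (by fun_prop) _ _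
      · exact Continuous.intervalIntegrable (by fun_prop) _ _
      · have h : 0 ≤ α⁻¹ * (α * ‖u t‖ - ‖u' t‖) ^ 2 := by positivity
        have h' : α⁻¹ * (α * ‖u t‖ - ‖u' t‖) ^ 2 =
            α * ‖u t‖ ^ 2 + α⁻¹ * ‖u' t‖ ^ 2 - 2 * (‖u t‖ * ‖u' t‖) := by
          field_simp; ring
        linarith
    all_goals exact Continuous.intervalIntegrable (by fun_prop) _ _
  have h2 : ∫ _t in (0 : ℝ)..1, ‖u a‖ ^ 2 ≤ ∫ t in (0 : ℝ)..1,
      (‖u t‖ ^ 2 + ∫ t in (0 : ℝ)..1, 2 * (‖u t‖ * ‖u' t‖)) := by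
    refine intervalIntegral.integral_mono_on zero_le_one ?_ ?_ fun t ht => ?_
    · exact Continuous.intervalIntegrable (by fun_prop) _ _
    · exact Continuous.intervalIntegrable (by fun_prop) _ _
    · linarith [(abs_le.1 (norm_sq_sub_le hu hu' ht ha)).2]
  rw [intervalIntegral.integral_add (Continuous.intervalIntegrable (by fun_prop) _ _)
    (Continuous.intervalIntegrable (by fun_prop) _ _)] at h2
  simp only [intervalIntegral.integral_const, sub_zero, one_smul] at h2
  linarith

/-- With `V` the primitive of `‖u'‖ ^ 2`, Cauchy–Schwarz bounds the integrand by `s * (V (t + s) - V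
t)`. The integral of this difference telescopes to two end pieces of length `s`. Here no translate
wraps around the circle. -/
theorem integral_norm_shift_sub_sq_le (hu : ∀ t, HasDerivAt u (u' t) t) (hu' : Continuous u')
    {s : ℝ} (hs0 : 0 ≤ s) (hs1 : s ≤ 1) :
    ∫ t in (0 : ℝ)..(1 - s), ‖u (t + s) - u t‖ ^ 2 ≤
      s ^ 2 * ∫ t in (0 : ℝ)..1, ‖u' t‖ ^ 2 := by
  have huc : Continuous u := continuous_iff_continuousAt.2 fun t => (hu t).continuousAt
  set V : ℝ → ℝ := fun t => ∫ τ in (0 : ℝ)..t, ‖u' τ‖ ^ 2 with hV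
  have hi (a b : ℝ) : IntervalIntegrable (fun τ => ‖u' τ‖ ^ 2) volume a b :=
    (hu'.norm.pow 2).intervalIntegrable _ _
  have hVc : Continuous V := intervalIntegral.continuous_primitive hi 0
  have hVi (a b : ℝ) : IntervalIntegrable V volume a b := hVc.intervalIntegrable _ _
  have h1 : ∫ t in (0 : ℝ)..(1 - s), ‖u (t + s) - u t‖ ^ 2 ≤
      ∫ t in (0 : ℝ)..(1 - s), s * (V (t + s) - V t) := by
    refine intervalIntegral.integral_mono_on (by linarith) ?_ ?_ fun t _ => ?_
    · exact Continuous.intervalIntegrable (by fun_prop) _ _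
    · exact Continuous.intervalIntegrable (by fun_prop) _ _
    · have h := norm_sub_sq_le hu hu' (show t ≤ t + s by linarith)
      rwa [add_sub_cancel_left, ← intervalIntegral.integral_interval_sub_left (hi 0 _) (hi 0 _)]
        at h
  have h2 : ∫ t in (0 : ℝ)..(1 - s), s * (V (t + s) - V t) =
      s * ((∫ t in (1 - s)..1, V t) - ∫ t in (0 : ℝ)..s, V t) := by
    rw [intervalIntegral.integral_const_mul, intervalIntegral.integral_sub
      (Continuous.intervalIntegrable (by fun_prop) _ _) (hVi _ _),
      intervalIntegral.integral_comp_add_right V s, zero_add, sub_add_cancel,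
      ← intervalIntegral.integral_add_adjacent_intervals (hVi s (1 - s)) (hVi (1 - s) 1),
      ← intervalIntegral.integral_add_adjacent_intervals (hVi 0 s) (hVi s (1 - s))]
    ring
  have h3 : ∫ t in (1 - s)..1, V t ≤ s * V 1 := by
    have : ∫ t in (1 - s)..1, V t ≤ ∫ _t in (1 - s)..1, V 1 :=
      intervalIntegral.integral_mono_on (by linarith) (hVi _ _)
        (continuous_const.intervalIntegrable _ _) fun t ht =>
          integral_mono_unit (hu'.norm.pow 2) (fun _ => sq_nonneg _) le_rfl
            (by linarith [ht.1]) ht.2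
    simpa using this
  have h4 : 0 ≤ ∫ t in (0 : ℝ)..s, V t :=
    intervalIntegral.integral_nonneg hs0 fun t ht =>
      intervalIntegral.integral_nonneg ht.1 fun _ _ => sq_nonneg _
  calc _ ≤ s * ((∫ t in (1 - s)..1, V t) - ∫ t in (0 : ℝ)..s, V t) := h1.trans h2.le
    _ ≤ s * (s * V 1) := mul_le_mul_of_nonneg_left (by linarith) hs0
    _ = _ := by ring

theorem exists_abs_eq_norm (z : UnitAddCircle) : ∃ s : ℝ, (s : UnitAddCircle) = z ∧ |s| = ‖z‖ := by
  have h := (AddCircle.equivIco (1 : ℝ) (-(1 / 2)) z).2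
  refine ⟨_, AddCircle.coe_equivIco (p := (1 : ℝ)) (a := -(1 / 2)) (y := z), ?_⟩
  have h2 := (AddCircle.norm_coe_eq_abs_iff (1 : ℝ) (x := AddCircle.equivIco (1 : ℝ) (-(1 / 2)) z)
    one_ne_zero).2 (by rw [abs_one, abs_le]; exact ⟨h.1, by linarith [h.2]⟩)
  rw [← h2, AddCircle.coe_equivIco]

theorem norm_le_half (z : UnitAddCircle) : ‖z‖ ≤ 1 / 2 := by
  simpa using AddCircle.norm_le_half_period (1 : ℝ) one_ne_zero (x := z)

/-- The change of `u ∘ circleRep` under a translation of the circle, in terms of `‖u'‖`. -/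
theorem integral_circle_shift_le_deriv (hu : ∀ t, HasDerivAt u (u' t) t) (hu' : Continuous u')
    (z : UnitAddCircle) :
    ∫ t, ‖u (circleRep (t + z)) - u (circleRep t)‖ ^ 2 ≤ ∫ t, ‖u' (circleRep t)‖ ^ 2 := by
  rw [integral_circleRep (f := fun t => ‖u' t‖ ^ 2) (hu'.norm.pow 2).aestronglyMeasurable]
  have h := integral_mono_of_nonneg (μ := (volume : Measure UnitAddCircle))
    (f := fun t => ‖u (circleRep (t + z)) - u (circleRep t)‖ ^ 2)
    (g := fun _ => ∫ t in (0 : ℝ)..1, ‖u' t‖ ^ 2)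
    (Filter.Eventually.of_forall fun _ => sq_nonneg _) (integrable_const _)
    (Filter.Eventually.of_forall fun t => norm_sub_sq_le_unit hu hu'
      (Set.Ico_subset_Icc_self (circleRep_mem _)) (Set.Ico_subset_Icc_self (circleRep_mem _)))
  simpa using h

/-- Points whose translate does not cross `0` are handled by the derivative. The others form a set
of measure `‖z‖`, on which the squared difference is at most four times the trace bound on `‖u‖ ^
2`; this is the price of the possible jump at `0`. -/
theorem integral_circle_shift_le (hu : ∀ t, HasDerivAt u (u' t) t) (hu' : Continuous u')
    {α : ℝ} (hα : 0 < α) (z : UnitAddCircle) :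
    ∫ t, ‖u (circleRep (t + z)) - u (circleRep t)‖ ^ 2 ≤
      ‖z‖ ^ 2 * (∫ t, ‖u' (circleRep t)‖ ^ 2) + 4 * ‖z‖ *
        ((1 + α) * (∫ t, ‖u (circleRep t)‖ ^ 2) + α⁻¹ * ∫ t, ‖u' (circleRep t)‖ ^ 2) := by
  have huc : Continuous u := continuous_iff_continuousAt.2 fun t => (hu t).continuousAt
  rw [integral_circleRep (f := fun t => ‖u' t‖ ^ 2) (hu'.norm.pow 2).aestronglyMeasurable,
    integral_circleRep (f := fun t => ‖u t‖ ^ 2) (huc.norm.pow 2).aestronglyMeasurable]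
  obtain ⟨s, rfl, hs⟩ := exists_abs_eq_norm z
  -- A negative shift reduces to a positive one by translating the variable of integration, which
  -- exchanges the two terms of the difference.
  wlog h0 : 0 ≤ s generalizing s
  · have h := this (-s) (by rw [abs_neg, hs, AddCircle.coe_neg, norm_neg]) (by linarith)
    rw [AddCircle.coe_neg, norm_neg] at h
    refine le_trans (le_of_eq ?_) h
    rw [← integral_add_right_eq_self (μ := (volume : Measure UnitAddCircle))
      (fun t => ‖u (circleRep (t + ↑s)) - u (circleRep t)‖ ^ 2) (-(s : UnitAddCircle))]
    refine integral_congr_ae (Filter.Eventually.of_forall fun t => ?_)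
    simp only [neg_add_cancel_right]
    rw [norm_sub_rev]
  have hs1 : s ≤ 1 / 2 := by
    have := norm_le_half (s : UnitAddCircle)
    rwa [← hs, abs_of_nonneg h0] at this
  rw [← hs, abs_of_nonneg h0]
  set S := (1 + α) * (∫ t in (0 : ℝ)..1, ‖u t‖ ^ 2) + α⁻¹ * ∫ t in (0 : ℝ)..1, ‖u' t‖ ^ 2
  -- The pointwise majorant: the plain shift where there is no wrap-around, and the trace bound on
  -- the last stretch of length `s`.
  set G : ℝ → ℝ := (Set.Iio (1 - s)).indicator (fun t => ‖u (t + s) - u t‖ ^ 2) +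
    (Set.Ici (1 - s)).indicator (fun _ => 4 * S) with hG
  have hsup {a : ℝ} (ha : a ∈ Set.Icc (0 : ℝ) 1) : ‖u a‖ ^ 2 ≤ S := norm_sq_le hu hu' hα ha
  have hpt (t : UnitAddCircle) :
      ‖u (circleRep (t + s)) - u (circleRep t)‖ ^ 2 ≤ G (circleRep t) := by
    have hr := circleRep_mem t
    rcases lt_or_ge (circleRep t) (1 - s) with h | h
    · have h1 : circleRep (t + s) = circleRep t + s := by
        conv_lhs => rw [← coe_circleRep t, ← AddCircle.coe_add]
        exact circleRep_coe ⟨by linarith [hr.1], by linarith⟩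
      simp [hG, h, h1, not_le.2 h]
    · have h1 := hsup (Set.Ico_subset_Icc_self (circleRep_mem (t + s)))
      have h2 := hsup (Set.Ico_subset_Icc_self hr)
      simp only [hG, Pi.add_apply, Set.mem_Iio, not_lt.2 h, not_false_eq_true,
        Set.indicator_of_notMem, Set.mem_Ici, h, Set.indicator_of_mem, zero_add]
      have h3 := norm_sub_le (u (circleRep (t + s))) (u (circleRep t))
      have h4 := pow_le_pow_left₀ (norm_nonneg _) h3 2
      nlinarith [sq_nonneg (‖u (circleRep (t + s))‖ - ‖u (circleRep t)‖)]
  have hGm : Measurable G := by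
    refine Measurable.add (Measurable.indicator ?_ measurableSet_Iio)
      (Measurable.indicator measurable_const measurableSet_Ici)
    exact Continuous.measurable (by fun_prop)
  have hc : Continuous fun t => ‖u (t + s) - u t‖ ^ 2 := by fun_prop
  have hG1 : IntervalIntegrable ((Set.Iio (1 - s)).indicator (fun t => ‖u (t + s) - u t‖ ^ 2))
      volume 0 1 :=
    ⟨((hc.intervalIntegrable 0 1).1).indicator measurableSet_Iio,
      ((hc.intervalIntegrable 0 1).2).indicator measurableSet_Iio⟩
  have hG2 : IntervalIntegrable ((Set.Ici (1 - s)).indicator (fun _ => 4 * S))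
      volume 0 1 :=
    ⟨((continuous_const.intervalIntegrable 0 1).1).indicator measurableSet_Ici,
      ((continuous_const.intervalIntegrable 0 1).2).indicator measurableSet_Ici⟩
  have hGi : Integrable fun t => G (circleRep t) :=
    measurePreserving_circleRep.integrable_comp_of_integrable
      ((intervalIntegrable_iff_integrableOn_Ioc_of_le zero_le_one).1 (hG1.add hG2))
  have h1 := integral_mono_of_nonneg (μ := (volume : Measure UnitAddCircle))
    (Filter.Eventually.of_forall fun t => sq_nonneg ‖u (circleRep (t + s)) - u (circleRep t)‖)
    hGi (Filter.Eventually.of_forall hpt)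
  rw [integral_circleRep hGm.aestronglyMeasurable] at h1
  refine h1.trans ?_
  have h2 : ∫ t in (0 : ℝ)..1, G t =
      (∫ t in (0 : ℝ)..(1 - s), ‖u (t + s) - u t‖ ^ 2) + s * (4 * S) := by
    simp only [hG, Pi.add_apply]
    rw [intervalIntegral.integral_add hG1 hG2, intervalIntegral.integral_of_le zero_le_one,
      intervalIntegral.integral_of_le zero_le_one, integral_indicator measurableSet_Iio,
      integral_indicator measurableSet_Ici, Measure.restrict_restrict measurableSet_Iio,
      Measure.restrict_restrict measurableSet_Ici,
      intervalIntegral.integral_of_le (by linarith : (0 : ℝ) ≤ 1 - s)]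
    have e1 : Set.Iio (1 - s) ∩ Set.Ioc 0 1 = Set.Ioo 0 (1 - s) := by
      ext t; simp only [Set.mem_inter_iff, Set.mem_Iio, Set.mem_Ioc, Set.mem_Ioo]
      constructor
      · rintro ⟨h1, h2, -⟩; exact ⟨h2, h1⟩
      · rintro ⟨h1, h2⟩; exact ⟨h2, h1, by linarith⟩
    have e2 : Set.Ici (1 - s) ∩ Set.Ioc 0 1 = Set.Icc (1 - s) 1 := by
      ext t; simp only [Set.mem_inter_iff, Set.mem_Ici, Set.mem_Ioc, Set.mem_Icc]
      constructor
      · rintro ⟨h1, -, h2⟩; exact ⟨h1, h2⟩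
      · rintro ⟨h1, h2⟩; exact ⟨h1, by linarith, h2⟩
    rw [e1, e2, integral_Ioc_eq_integral_Ioo, setIntegral_const, Measure.real, Real.volume_Icc,
      ENNReal.toReal_ofReal (by linarith), smul_eq_mul]
    ring
  rw [h2]
  linarith [integral_norm_shift_sub_sq_le hu hu' h0 (by linarith : s ≤ 1)]

end OneDim

end

/-! ### Translation estimates on the cube, by slicing along coordinate lines -/

section

variable {d : ℕ}

theorem rep_mem_Icc (x : UnitAddTorus (Fin d)) : rep x ∈ Set.Icc (0 : Fin d → ℝ) 1 :=
  ⟨fun j => (rep_mem_unitCube x j trivial).1, fun j => (rep_mem_unitCube x j trivial).2.le⟩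

theorem memLp_comp_rep {E : Type*} [NormedAddCommGroup E] [SecondCountableTopology E]
    [MeasurableSpace E] [BorelSpace E] {f : (Fin d → ℝ) → E} (hf : Continuous f)
    (p : ENNReal) : MemLp (fun x : UnitAddTorus (Fin d) => f (rep x)) p volume := by
  obtain ⟨C, hC⟩ := (isCompact_Icc (a := (0 : Fin d → ℝ)) (b := 1)).exists_bound_of_continuousOn
    hf.continuousOn
  exact MemLp.of_bound (hf.measurable.comp measurable_rep).aestronglyMeasurable C
    (Filter.Eventually.of_forall fun x => hC _ (rep_mem_Icc x))

theorem integrable_comp_rep {f : (Fin d → ℝ) → ℝ} (hf : Continuous f) :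
    Integrable (fun x : UnitAddTorus (Fin d) => f (rep x)) :=
  memLp_one_iff_integrable.1 (memLp_comp_rep hf 1)

/-- Resampling one coordinate independently preserves the uniform law. This is the form of Fubini
that carries estimates on the circle to coordinate lines of the torus. -/
theorem measurePreserving_update (j : Fin d) :
    MeasurePreserving (fun p : UnitAddTorus (Fin d) × UnitAddCircle => Function.update p.1 j p.2)
      (volume.prod volume) volume := by
  have hm : Measurable fun p : UnitAddTorus (Fin d) × UnitAddCircle =>
      Function.update p.1 j p.2 := measurable_update'.comp measurable_id
  refine ⟨hm, (Measure.pi_eq fun s hs => ?_).symm⟩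
  rw [Measure.map_apply hm (MeasurableSet.univ_pi hs)]
  have h : (fun p : UnitAddTorus (Fin d) × UnitAddCircle => Function.update p.1 j p.2) ⁻¹'
      Set.univ.pi s = (Set.univ.pi (Function.update s j Set.univ)) ×ˢ s j := by
    ext ⟨x, t⟩
    simp only [Set.mem_preimage, Set.mem_pi, Set.mem_univ, forall_const, Set.mem_prod]
    constructor
    · intro h
      refine ⟨fun i => ?_, by simpa using h j⟩
      rcases eq_or_ne i j with rfl | hi
      · simp
      · simpa [hi] using h i
    · rintro ⟨h1, h2⟩ i
      rcases eq_or_ne i j with rfl | hi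
      · simpa using h2
      · simpa [hi] using h1 i
  have h2 : (volume : Measure (UnitAddTorus (Fin d))) (Set.univ.pi (Function.update s j Set.univ)) =
      ∏ i, volume (Function.update s j Set.univ i) := volume_pi_pi _
  rw [h, Measure.prod_prod, h2, ← Finset.mul_prod_erase _ _ (Finset.mem_univ j),
    ← Finset.mul_prod_erase Finset.univ (fun i => volume (s i)) (Finset.mem_univ j)]
  rw [Function.update_self, UnitAddCircle.measure_univ, one_mul, mul_comm]
  congr 1
  refine Finset.prod_congr rfl fun i hi => ?_
  rw [Function.update_of_ne (Finset.ne_of_mem_erase hi)]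

theorem integral_update {G : UnitAddTorus (Fin d) → ℝ} (hG : Integrable G) (j : Fin d) :
    ∫ x, G x = ∫ x, ∫ t, G (Function.update x j t) := by
  have h := measurePreserving_update (d := d) j
  rw [← integral_prod (fun p : UnitAddTorus (Fin d) × UnitAddCircle =>
    G (Function.update p.1 j p.2)) (h.integrable_comp_of_integrable hG)]
  conv_lhs => rw [← h.map_eq]
  rw [integral_map h.measurable.aemeasurable]
  rw [h.map_eq]; exact hG.1

theorem rep_update (x : UnitAddTorus (Fin d)) (j : Fin d) (t : UnitAddCircle) :
    rep (Function.update x j t) = Function.update (rep x) j (circleRep t) := by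
  funext i
  rcases eq_or_ne i j with rfl | hi
  · simp [rep, circleRep]
  · simp [rep, hi]

theorem add_single_update (x : UnitAddTorus (Fin d)) (j : Fin d) (t z : UnitAddCircle) :
    Function.update x j t + Pi.single j z = Function.update x j (t + z) := by
  funext i
  rcases eq_or_ne i j with rfl | hi
  · simp
  · simp [hi]

/-- The `j`-th partial derivative. -/
def pderiv (f : (Fin d → ℝ) → ℂ) (j : Fin d) (x : Fin d → ℝ) : ℂ :=
  fderiv ℝ f x (Pi.single j 1)

/-- The squared `L²` norm on the unit cube. -/
def normSqCube (f : (Fin d → ℝ) → ℂ) : ℝ := ∫ x : UnitAddTorus (Fin d), ‖f (rep x)‖ ^ 2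

/-- The Dirichlet energy on the unit cube. -/
def energy (f : (Fin d → ℝ) → ℂ) : ℝ :=
  ∑ j, ∫ x : UnitAddTorus (Fin d), ‖pderiv f j (rep x)‖ ^ 2

theorem normSqCube_nonneg (f : (Fin d → ℝ) → ℂ) : 0 ≤ normSqCube f :=
  integral_nonneg fun _ => sq_nonneg _

theorem energy_nonneg (f : (Fin d → ℝ) → ℂ) : 0 ≤ energy f :=
  Finset.sum_nonneg fun _ _ => integral_nonneg fun _ => sq_nonneg _

variable {f : (Fin d → ℝ) → ℂ}

theorem continuous_pderiv (hf : ContDiff ℝ 1 f) (j : Fin d) : Continuous (pderiv f j) :=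
  (hf.continuous_fderiv one_ne_zero).clm_apply continuous_const

theorem integral_pderiv_le_energy (j : Fin d) :
    ∫ x : UnitAddTorus (Fin d), ‖pderiv f j (rep x)‖ ^ 2 ≤ energy f :=
  Finset.single_le_sum (f := fun j => ∫ x : UnitAddTorus (Fin d), ‖pderiv f j (rep x)‖ ^ 2)
    (fun _ _ => integral_nonneg fun _ => sq_nonneg _) (Finset.mem_univ j)

theorem hasDerivAt_line (hf : ContDiff ℝ 1 f) (x : Fin d → ℝ) (j : Fin d) (t : ℝ) :
    HasDerivAt (fun t => f (Function.update x j t)) (pderiv f j (Function.update x j t)) t :=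
  ((hf.differentiable one_ne_zero) _).hasFDerivAt.comp_hasDerivAt t (hasDerivAt_update x j t)

theorem continuous_line (hf : ContDiff ℝ 1 f) (x : Fin d → ℝ) (j : Fin d) :
    Continuous fun t => pderiv f j (Function.update x j t) :=
  (continuous_pderiv hf j).comp (continuous_const.update j continuous_id)

theorem memLp_shift (hf : Continuous f) (z : UnitAddTorus (Fin d)) :
    MemLp (fun x => f (rep (x + z)) - f (rep x)) 2 volume :=
  ((memLp_comp_rep hf 2).comp_measurePreserving (measurePreserving_add_right volume z)).sub
    (memLp_comp_rep hf 2)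

/-- Apply the circle estimate on every line in direction `j` and integrate over the lines. The
circle estimate is a hypothesis with free constants so that both the crude and the refined version
can be inserted. -/
theorem integral_single_shift (hf : ContDiff ℝ 1 f) (j : Fin d) (z : UnitAddCircle) {c₀ c₁ : ℝ}
    (h : ∀ u u' : ℝ → ℂ, (∀ t, HasDerivAt u (u' t) t) → Continuous u' →
      ∫ t, ‖u (circleRep (t + z)) - u (circleRep t)‖ ^ 2 ≤
        c₁ * (∫ t, ‖u' (circleRep t)‖ ^ 2) + c₀ * ∫ t, ‖u (circleRep t)‖ ^ 2) :
    ∫ x : UnitAddTorus (Fin d), ‖f (rep (x + Pi.single j z)) - f (rep x)‖ ^ 2 ≤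
      c₁ * (∫ x : UnitAddTorus (Fin d), ‖pderiv f j (rep x)‖ ^ 2) + c₀ * normSqCube f := by
  have hu := measurePreserving_update (d := d) j
  have i0 : Integrable fun x : UnitAddTorus (Fin d) =>
      ‖f (rep (x + Pi.single j z)) - f (rep x)‖ ^ 2 :=
    integrable_norm_sq (memLp_shift hf.continuous _)
  have i1 : Integrable fun x : UnitAddTorus (Fin d) => ‖pderiv f j (rep x)‖ ^ 2 :=
    integrable_comp_rep (f := fun x => ‖pderiv f j x‖ ^ 2) ((continuous_pderiv hf j).norm.pow 2)
  have i2 : Integrable fun x : UnitAddTorus (Fin d) => ‖f (rep x)‖ ^ 2 :=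
    integrable_comp_rep (f := fun x => ‖f x‖ ^ 2) (hf.continuous.norm.pow 2)
  have k0 := (hu.integrable_comp_of_integrable i0).integral_prod_left
  have k1 := (hu.integrable_comp_of_integrable i1).integral_prod_left
  have k2 := (hu.integrable_comp_of_integrable i2).integral_prod_left
  rw [normSqCube, integral_update i0 j, integral_update i1 j, integral_update i2 j,
    ← integral_const_mul, ← integral_const_mul]
  refine le_of_le_of_eq ?_ (integral_add (k1.const_mul c₁) (k2.const_mul c₀))
  refine integral_mono k0 ((k1.const_mul _).add (k2.const_mul _)) fun x => ?_
  have := h _ _ (hasDerivAt_line hf (rep x) j) (continuous_line hf (rep x) j)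
  simpa only [Function.comp_apply, add_single_update, rep_update, Pi.add_apply] using this

theorem l2norm_single_shift_le_energy (hf : ContDiff ℝ 1 f) (j : Fin d) (z : UnitAddCircle) :
    l2norm volume (fun x : UnitAddTorus (Fin d) => f (rep (x + Pi.single j z)) - f (rep x)) ≤
      Real.sqrt (energy f) := by
  refine Real.sqrt_le_sqrt ?_
  have h := integral_single_shift hf j z (c₀ := 0) (c₁ := 1) fun u u' hu hu' => by
    simpa using integral_circle_shift_le_deriv hu hu' z
  linarith [integral_pderiv_le_energy (f := f) j]

theorem l2norm_single_shift_le (hf : ContDiff ℝ 1 f) {α : ℝ} (hα : 0 < α) {ε : ℝ} (j : Fin d)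
    {z : UnitAddCircle} (hz : ‖z‖ ≤ ε) :
    l2norm volume (fun x : UnitAddTorus (Fin d) => f (rep (x + Pi.single j z)) - f (rep x)) ≤
      Real.sqrt (ε ^ 2 * energy f + 4 * ε * ((1 + α) * normSqCube f + α⁻¹ * energy f)) := by
  refine Real.sqrt_le_sqrt ?_
  have h := integral_single_shift hf j z (c₀ := 4 * ‖z‖ * (1 + α))
    (c₁ := ‖z‖ ^ 2 + 4 * ‖z‖ * α⁻¹) fun u u' hu hu' =>
      (integral_circle_shift_le hu hu' hα z).trans_eq (by ring)
  have hz0 := norm_nonneg z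
  have hε := hz0.trans hz
  have h1 := integral_pderiv_le_energy (f := f) j
  have hN := normSqCube_nonneg f
  have hE := energy_nonneg f
  calc _ ≤ _ := h
    _ ≤ (ε ^ 2 + 4 * ε * α⁻¹) * energy f + 4 * ε * (1 + α) * normSqCube f := by gcongr
    _ = _ := by ring

/-- Write `z` as a sum of `d` coordinate translations and telescope. Translations are isometries of
L², so each one costs at most `b`. -/
theorem l2norm_shift_le_of_single (hf : Continuous f) (z : UnitAddTorus (Fin d)) {b : ℝ}
    (h : ∀ j, l2norm volume (fun x : UnitAddTorus (Fin d) =>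
      f (rep (x + Pi.single j (z j))) - f (rep x)) ≤ b) :
    l2norm volume (fun x : UnitAddTorus (Fin d) => f (rep (x + z)) - f (rep x)) ≤ d * b := by
  have key (s : Finset (Fin d)) : l2norm volume (fun x : UnitAddTorus (Fin d) =>
      f (rep (x + ∑ j ∈ s, Pi.single j (z j))) - f (rep x)) ≤ s.card * b := by
    induction s using Finset.induction_on with
    | empty => simp [l2norm]
    | insert j s hj ih =>
      rw [Finset.sum_insert hj, Finset.card_insert_of_notMem hj, Nat.cast_succ, add_mul, one_mul,
        add_comm ((s.card : ℝ) * b)]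
      set w := ∑ i ∈ s, Pi.single i (z i)
      have h1 := memLp_shift hf (Pi.single j (z j) : UnitAddTorus (Fin d))
      have hw := measurePreserving_add_right (volume : Measure (UnitAddTorus (Fin d))) w
      have h2 := l2norm_add_le (h1.comp_measurePreserving hw) (memLp_shift hf w)
      rw [l2norm_comp hw h1.1] at h2
      refine le_trans (le_of_eq ?_) (h2.trans (add_le_add (h j) ih))
      congr 1
      funext x
      simp only [Pi.add_apply, Function.comp_apply]
      rw [add_assoc x w, add_comm w]
      ring
  have h2 := key Finset.univ
  rwa [Finset.univ_sum_single, Finset.card_univ, Fintype.card_fin] at h2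

/-- No smallness of `z` is needed here: this is the input for Poincaré's inequality, where one
averages over all translations. -/
theorem l2norm_shift_le_energy (hf : ContDiff ℝ 1 f) (z : UnitAddTorus (Fin d)) :
    l2norm volume (fun x : UnitAddTorus (Fin d) => f (rep (x - z)) - f (rep x)) ≤
      d * Real.sqrt (energy f) := by
  simp_rw [sub_eq_add_neg _ z]
  exact l2norm_shift_le_of_single hf.continuous _ fun j => l2norm_single_shift_le_energy hf j _

theorem norm_apply_le_torusDist (z : UnitAddTorus (Fin d)) (j : Fin d) : ‖z j‖ ≤ torusDist z := by
  refine Real.le_sqrt_of_sq_le ?_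
  exact Finset.single_le_sum (f := fun j => ‖z j‖ ^ 2) (fun _ _ => sq_nonneg _) (Finset.mem_univ j)

theorem l2norm_shift_le (hf : ContDiff ℝ 1 f) {α : ℝ} (hα : 0 < α) {ε : ℝ}
    {z : UnitAddTorus (Fin d)} (hz : torusDist z ≤ ε) :
    l2norm volume (fun x : UnitAddTorus (Fin d) => f (rep (x - z)) - f (rep x)) ≤
      d * Real.sqrt (ε ^ 2 * energy f + 4 * ε * ((1 + α) * normSqCube f + α⁻¹ * energy f)) := by
  simp_rw [sub_eq_add_neg _ z]
  exact l2norm_shift_le_of_single hf.continuous _ fun j => l2norm_single_shift_le hf hα j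
    (by rw [Pi.neg_apply, norm_neg]; exact (norm_apply_le_torusDist z j).trans hz)

end

/-! ### The transfer operator: duality, and contraction of norm and energy -/

section

namespace PiecewiseAffine

variable {d : ℕ} {B : PiecewiseAffine d}

theorem integral_eq_sum_torusInv [NeZero d] (hB : B.CubeAssumption)
    {E : Type*} [NormedAddCommGroup E] [NormedSpace ℝ E] {f : UnitAddTorus (Fin d) → E}
    (hf : Integrable f) : ∫ x, f x = ∑ i, B.p i • ∫ y, f (B.torusInv i y) := by
  have hi (i : Fin B.M) : Integrable f
      (ENNReal.ofReal (B.p i) • Measure.map (B.torusInv i) volume) := by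
    refine hf.mono_measure ?_
    conv_rhs => rw [← sum_smul_map_torusInv hB, ← Measure.sum_fintype]
    exact Measure.le_sum (fun i => ENNReal.ofReal (B.p i) •
      Measure.map (B.torusInv i) (volume : Measure (UnitAddTorus (Fin d)))) i
  conv_lhs => rw [← sum_smul_map_torusInv hB]
  rw [integral_finsetSum_measure fun i _ => hi i]
  refine Finset.sum_congr rfl fun i _ => ?_
  have hm : AEStronglyMeasurable f (Measure.map (B.torusInv i) volume) := by
    have := (hi i).1.smul_measure (ENNReal.ofReal (B.p i))⁻¹
    rwa [smul_smul, ENNReal.inv_mul_cancel (by simpa using B.p_pos i) ENNReal.ofReal_ne_top,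
      one_smul] at this
  rw [integral_smul_measure, ENNReal.toReal_ofReal (B.p_pos i).le,
    integral_map (measurable_torusInv i).aemeasurable hm]

theorem sum_integral_invBranch [NeZero d] (hB : B.CubeAssumption) {G : (Fin d → ℝ) → ℝ}
    (hG : Continuous G) :
    ∑ i, B.p i * ∫ y : UnitAddTorus (Fin d), G (B.invBranch i (rep y)) =
      ∫ x : UnitAddTorus (Fin d), G (rep x) := by
  rw [integral_eq_sum_torusInv hB (integrable_comp_rep hG)]
  refine Finset.sum_congr rfl fun i _ => ?_
  rw [smul_eq_mul]
  congr 1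
  refine integral_congr_ae ?_
  filter_upwards [ae_rep_mem_openCube] with y hy
  rw [rep_torusInv hB i hy]

variable (B) in
/-- The transfer operator, acting on functions on `ℝ^d`. -/
def transfer (f : (Fin d → ℝ) → ℂ) (y : Fin d → ℝ) : ℂ :=
  ∑ i, (B.p i : ℂ) * f (B.invBranch i y)

theorem contDiff_invBranch (i : Fin B.M) : ContDiff ℝ 1 (B.invBranch i) := by
  have h : B.invBranch i =
      fun y => (Matrix.toLin' (B.side i • (B.D i).transpose)).toContinuousLinearMap
        (y - B.e i) := rfl
  rw [h]
  exact (ContinuousLinearMap.contDiff _).comp (contDiff_id.sub contDiff_const)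

/-- Smoothness is the reason for working on `ℝ^d`: the inverse branches are affine there, whereas on
the torus the transferred function may jump across the boundary of the fundamental domain. -/
theorem contDiff_transfer {f : (Fin d → ℝ) → ℂ} (hf : ContDiff ℝ 1 f) :
    ContDiff ℝ 1 (B.transfer f) := by
  unfold transfer
  exact ContDiff.sum fun i _ => contDiff_const.mul (hf.comp (contDiff_invBranch i))

theorem continuous_transfer {f : (Fin d → ℝ) → ℂ} (hf : Continuous f) :
    Continuous (B.transfer f) := by
  unfold transfer
  exact continuous_finsetSum _ fun i _ =>
    continuous_const.mul (hf.comp (B.continuous_invBranch i))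

/-- The transfer operator is dual to the composition with `φ`. -/
theorem integral_mul_comp_phi [NeZero d] (hB : B.CubeAssumption) {g : (Fin d → ℝ) → ℂ}
    (hg : Continuous g) {h : UnitAddTorus (Fin d) → ℂ} (hh : MemLp h 2 volume) :
    ∫ x, g (rep x) * h (B.phi x) = ∫ y, B.transfer g (rep y) * h y := by
  have hi : Integrable fun x => g (rep x) * h (B.phi x) :=
    (memLp_comp_rep hg 2).integrable_mul (hh.comp_measurePreserving (measurePreserving_phi hB))
  have hk (i : Fin B.M) : Integrable fun y => (B.p i : ℂ) * (g (B.invBranch i (rep y)) * h y) :=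
    (((memLp_comp_rep (f := fun y => g (B.invBranch i y))
      (hg.comp (B.continuous_invBranch i)) 2)).integrable_mul hh).const_mul _
  rw [integral_eq_sum_torusInv hB hi]
  simp_rw [transfer, Finset.sum_mul, mul_assoc]
  rw [integral_finsetSum _ fun i _ => hk i]
  refine Finset.sum_congr rfl fun i _ => ?_
  rw [integral_const_mul, Complex.real_smul]
  congr 1
  refine integral_congr_ae ?_
  filter_upwards [ae_rep_mem_openCube] with y hy
  rw [rep_torusInv hB i hy, phi_torusInv hB i hy]

theorem norm_sum_p_mul_sq_le (b : Fin B.M → ℂ) :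
    ‖∑ i, (B.p i : ℂ) * b i‖ ^ 2 ≤ ∑ i, B.p i * ‖b i‖ ^ 2 := by
  have h1 : ‖∑ i, (B.p i : ℂ) * b i‖ ≤ ∑ i, B.p i * ‖b i‖ := by
    refine (norm_sum_le _ _).trans (Finset.sum_le_sum fun i _ => ?_)
    rw [norm_mul, Complex.norm_real, Real.norm_of_nonneg (B.p_pos i).le]
  exact (pow_le_pow_left₀ (norm_nonneg _) h1 2).trans
    (Real.pow_arith_mean_le_arith_mean_pow _ _ _ (fun i _ => (B.p_pos i).le) B.sum_p
      (fun i _ => norm_nonneg _) 2)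

/-- Jensen's inequality with the weights `p i`, then the decomposition of Lebesgue measure along the
inverse branches. -/
theorem normSqCube_transfer_le [NeZero d] (hB : B.CubeAssumption) {f : (Fin d → ℝ) → ℂ}
    (hf : Continuous f) : normSqCube (B.transfer f) ≤ normSqCube f := by
  have hc (i : Fin B.M) : Integrable fun y : UnitAddTorus (Fin d) =>
      B.p i * ‖f (B.invBranch i (rep y))‖ ^ 2 :=
    (integrable_comp_rep (f := fun y => ‖f (B.invBranch i y)‖ ^ 2)
      ((hf.comp (B.continuous_invBranch i)).norm.pow 2)).const_mul _
  unfold normSqCube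
  rw [← sum_integral_invBranch hB (G := fun x => ‖f x‖ ^ 2) (hf.norm.pow 2)]
  simp_rw [← integral_const_mul]
  rw [← integral_finsetSum _ fun i _ => hc i]
  exact integral_mono (integrable_comp_rep (f := fun y => ‖B.transfer f y‖ ^ 2)
    ((continuous_transfer hf).norm.pow 2)) (integrable_finsetSum _ fun i _ => hc i)
    fun y => norm_sum_p_mul_sq_le _

/-- A real orthogonal matrix acts isometrically on the real and the imaginary parts separately. -/
theorem sum_norm_transpose_sq {D : Matrix (Fin d) (Fin d) ℝ}
    (hD : D ∈ Matrix.orthogonalGroup (Fin d) ℝ) (a : Fin d → ℂ) :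
    ∑ j, ‖∑ k, (D j k : ℂ) * a k‖ ^ 2 = ∑ k, ‖a k‖ ^ 2 := by
  have h : D.transpose * D = 1 := (Matrix.mem_orthogonalGroup_iff' _ _).1 hD
  have hr (v : Fin d → ℝ) : ∑ j, (∑ k, D j k * v k) ^ 2 = ∑ k, v k ^ 2 := by
    have h1 : (D.mulVec v) ⬝ᵥ (D.mulVec v) = v ⬝ᵥ v := by
      rw [Matrix.dotProduct_mulVec, ← Matrix.mulVec_transpose, Matrix.mulVec_mulVec, h,
        Matrix.one_mulVec]
    simpa [dotProduct, Matrix.mulVec, sq] using h1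
  have hn (z : ℂ) : ‖z‖ ^ 2 = z.re ^ 2 + z.im ^ 2 := by
    rw [← Complex.normSq_eq_norm_sq, Complex.normSq_apply]; ring
  simp_rw [hn, Finset.sum_add_distrib, Complex.re_sum, Complex.im_sum, Complex.re_ofReal_mul,
    Complex.im_ofReal_mul, hr]

theorem pderiv_transfer {f : (Fin d → ℝ) → ℂ} (hf : ContDiff ℝ 1 f) (j : Fin d)
    (y : Fin d → ℝ) :
    pderiv (B.transfer f) j y = ∑ i, (B.p i : ℂ) *
      ((B.side i : ℂ) * ∑ k, (B.D i j k : ℂ) * pderiv f k (B.invBranch i y)) := by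
  have hψ (i : Fin B.M) : HasFDerivAt (B.invBranch i)
      (Matrix.toLin' (B.side i • (B.D i).transpose)).toContinuousLinearMap y := by
    have h := ((Matrix.toLin' (B.side i • (B.D i).transpose)).toContinuousLinearMap).hasFDerivAt
      (x := y - B.e i)
    exact h.comp y ((hasFDerivAt_id y).sub_const (B.e i))
  have hF (i : Fin B.M) := (((hf.differentiable one_ne_zero) _).hasFDerivAt.comp y
    (hψ i)).const_mul (B.p i : ℂ)
  have hS := HasFDerivAt.fun_sum fun i (_ : i ∈ Finset.univ) => hF i
  have hT : HasFDerivAt (B.transfer f) _ y := hS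
  rw [pderiv, hT.fderiv, sum_apply]
  refine Finset.sum_congr rfl fun i _ => ?_
  have hcol : Matrix.toLin' (B.side i • (B.D i).transpose) (Pi.single j 1) =
      ∑ k, (B.side i * B.D i j k) • (Pi.single k 1 : Fin d → ℝ) := by
    funext l
    simp [Finset.sum_apply, Pi.single_apply]
  rw [smul_apply, ContinuousLinearMap.comp_apply, LinearMap.coe_toContinuousLinearMap', hcol]
  simp only [smul_eq_mul, map_sum, map_smul, Complex.real_smul]
  congr 1
  rw [Finset.mul_sum]
  refine Finset.sum_congr rfl fun k _ => ?_
  rw [pderiv, Complex.ofReal_mul, mul_assoc]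

theorem side_le (i : Fin B.M) : B.side i ≤ B.pMax ^ (1 / (d : ℝ)) :=
  Real.rpow_le_rpow (B.p_pos i).le (B.le_pMax i) (by positivity)

/-- Each inverse branch is a similarity of ratio `side i ≤ pMax ^ (1/d)`, so it scales the gradient
of the composition by that ratio, and the orthogonal part leaves its length alone. Jensen and
invariance then conclude as for the L² norm. -/
theorem energy_transfer_le [NeZero d] (hB : B.CubeAssumption) {f : (Fin d → ℝ) → ℂ}
    (hf : ContDiff ℝ 1 f) :
    energy (B.transfer f) ≤ (B.pMax ^ (1 / (d : ℝ))) ^ 2 * energy f := by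
  have hpt (y : Fin d → ℝ) : ∑ j, ‖pderiv (B.transfer f) j y‖ ^ 2 ≤
      ∑ i, B.p i * ((B.pMax ^ (1 / (d : ℝ))) ^ 2 *
        ∑ k, ‖pderiv f k (B.invBranch i y)‖ ^ 2) := by
    calc ∑ j, ‖pderiv (B.transfer f) j y‖ ^ 2
        ≤ ∑ j, ∑ i, B.p i * ‖(B.side i : ℂ) *
            ∑ k, (B.D i j k : ℂ) * pderiv f k (B.invBranch i y)‖ ^ 2 := by
          refine Finset.sum_le_sum fun j _ => ?_
          rw [pderiv_transfer hf]
          exact norm_sum_p_mul_sq_le _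
      _ = ∑ i, B.p i * (B.side i ^ 2 * ∑ k, ‖pderiv f k (B.invBranch i y)‖ ^ 2) := by
          rw [Finset.sum_comm]
          refine Finset.sum_congr rfl fun i _ => ?_
          rw [← Finset.mul_sum]
          congr 1
          rw [← sum_norm_transpose_sq (B.D_orthogonal i) (fun k => pderiv f k (B.invBranch i y)),
            Finset.mul_sum]
          refine Finset.sum_congr rfl fun j _ => ?_
          rw [norm_mul, mul_pow, Complex.norm_real, Real.norm_of_nonneg (B.side_pos i).le]
      _ ≤ _ := by
          refine Finset.sum_le_sum fun i _ => mul_le_mul_of_nonneg_left ?_ (B.p_pos i).le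
          exact mul_le_mul_of_nonneg_right
            (pow_le_pow_left₀ (B.side_pos i).le (side_le i) 2)
            (Finset.sum_nonneg fun _ _ => sq_nonneg _)
  have hG : Continuous fun x => ∑ k, ‖pderiv f k x‖ ^ 2 :=
    continuous_finsetSum _ fun k _ => (continuous_pderiv hf k).norm.pow 2
  have hI (g : (Fin d → ℝ) → ℂ) (hg : ContDiff ℝ 1 g) :
      energy g = ∫ x : UnitAddTorus (Fin d), ∑ k, ‖pderiv g k (rep x)‖ ^ 2 :=
    (integral_finsetSum _ fun k _ => integrable_comp_rep (f := fun x => ‖pderiv g k x‖ ^ 2)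
      ((continuous_pderiv hg k).norm.pow 2)).symm
  have hc (i : Fin B.M) : Integrable fun y : UnitAddTorus (Fin d) =>
      B.p i * ((B.pMax ^ (1 / (d : ℝ))) ^ 2 *
        ∑ k, ‖pderiv f k (B.invBranch i (rep y))‖ ^ 2) :=
    ((integrable_comp_rep (f := fun y => ∑ k, ‖pderiv f k (B.invBranch i y)‖ ^ 2)
      (hG.comp (B.continuous_invBranch i))).const_mul _).const_mul _
  rw [hI _ (contDiff_transfer hf), hI f hf, ← sum_integral_invBranch hB hG, Finset.mul_sum]
  simp_rw [mul_left_comm _ (B.p _) (∫ y : UnitAddTorus (Fin d), _), ← integral_const_mul]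
  rw [← integral_finsetSum _ fun i _ => hc i]
  refine integral_mono (integrable_comp_rep
    (f := fun y => ∑ k, ‖pderiv (B.transfer f) k y‖ ^ 2) (continuous_finsetSum _ fun k _ =>
      (continuous_pderiv (contDiff_transfer hf) k).norm.pow 2))
    (integrable_finsetSum _ fun i _ => hc i) fun y => hpt _

end PiecewiseAffine

end

/-! ### Fourier series: damping of high frequencies and trigonometric polynomials -/

section

open UnitAddTorus

variable {d : ℕ}

theorem pi_haarAddCircle_eq_volume :
    (Measure.pi fun _ : Fin d => (AddCircle.haarAddCircle : Measure UnitAddCircle)) = volume := by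
  have h : (AddCircle.haarAddCircle : Measure UnitAddCircle) = volume := by
    rw [AddCircle.volume_eq_smul_haarAddCircle, ENNReal.ofReal_one, one_smul]
  rw [h]
  rfl

theorem mFourierCoeff_eq (f : UnitAddTorus (Fin d) → ℂ) (n : Fin d → ℤ) :
    mFourierCoeff f n = ∫ x, mFourier (-n) x * f x := by
  rw [← pi_haarAddCircle_eq_volume]
  rfl

theorem hasSum_sq_mFourierCoeff_of_memLp {f : UnitAddTorus (Fin d) → ℂ} (hf : MemLp f 2 volume) :
    HasSum (fun n => ‖mFourierCoeff f n‖ ^ 2) (l2norm volume f ^ 2) := by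
  rw [sq_l2norm]
  rw [← pi_haarAddCircle_eq_volume] at hf ⊢
  have h := hasSum_sq_mFourierCoeff hf.toLp
  have h1 (n : Fin d → ℤ) : mFourierCoeff hf.toLp n = mFourierCoeff f n :=
    integral_congr_ae (hf.coeFn_toLp.mono fun x hx => by simp only [hx])
  simp_rw [h1] at h
  convert h using 1
  exact integral_congr_ae (hf.coeFn_toLp.mono fun x hx => by simp only [hx])

theorem integral_mFourier (n : Fin d → ℤ) :
    ∫ x, mFourier n x = if n = 0 then 1 else 0 := by
  have h := orthonormal_iff_ite.1 (orthonormal_mFourier (d := Fin d)) 0 n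
  rw [ContinuousMap.inner_toLp] at h
  rw [← pi_haarAddCircle_eq_volume]
  simp only [mFourier_zero, eq_comm (a := (0 : Fin d → ℤ))] at h
  rw [← h]
  refine integral_congr_ae (Filter.Eventually.of_forall fun x => ?_)
  simp

theorem memLp_mFourier (n : Fin d → ℤ) {μ : Measure (UnitAddTorus (Fin d))} [IsFiniteMeasure μ]
    (p : ENNReal) : MemLp (mFourier n) p μ :=
  MemLp.of_bound (mFourier n).continuous.aestronglyMeasurable 1
    (Filter.Eventually.of_forall fun x =>
      ((mFourier n).norm_coe_le_norm x).trans_eq mFourier_norm)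

theorem mFourier_add_apply (n : Fin d → ℤ) (x y : UnitAddTorus (Fin d)) :
    mFourier n (x + y) = mFourier n x * mFourier n y := by
  simp only [mFourier, ContinuousMap.coe_mk, Pi.add_apply, ← Finset.prod_mul_distrib, fourier_apply,
    smul_add, AddCircle.toCircle_add, Circle.coe_mul]

theorem mFourier_neg_apply (n : Fin d → ℤ) (x : UnitAddTorus (Fin d)) :
    mFourier (-n) (-x) = mFourier n x := by
  simp only [mFourier, ContinuousMap.coe_mk, Pi.neg_apply, fourier_apply, smul_neg, neg_smul,
    neg_neg]

/-- Since `avg` uses `f (y + z)`, it is a correlation and not a convolution: the multiplier at `n`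
is the coefficient of the noise at `-n`. Hence the sign in the damping estimate. -/
theorem mFourierCoeff_avg {ν : Measure (UnitAddTorus (Fin d))} [IsProbabilityMeasure ν]
    {f : UnitAddTorus (Fin d) → ℂ} (hf : MemLp f 2 volume) (n : Fin d → ℤ) :
    mFourierCoeff (avg ν f) n = (∫ z, mFourier n z ∂ν) * mFourierCoeff f n := by
  rw [mFourierCoeff_eq, mFourierCoeff_eq, integral_mul_avg (memLp_mFourier _ _) hf,
    ← integral_mul_const]
  refine integral_congr_ae (Filter.Eventually.of_forall fun z => ?_)
  simp only
  rw [← integral_const_mul]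
  refine integral_congr_ae (Filter.Eventually.of_forall fun y => ?_)
  simp only [sub_eq_add_neg y z]
  rw [mFourier_add_apply, mFourier_neg_apply]
  ring

theorem integral_mFourier_noiseLaw {k : UnitAddTorus (Fin d) → ℝ} (hk : IsDensity k)
    (n : Fin d → ℤ) :
    ∫ z, mFourier n z ∂(noiseLaw k) = mFourierCoeff (fun x => (k x : ℂ)) (-n) := by
  rw [mFourierCoeff_eq, neg_neg, noiseLaw, integral_withDensity_eq_integral_toReal_smul₀
    hk.integrable.1.aemeasurable.ennreal_ofReal (by simp)]
  refine integral_congr_ae (hk.nonneg.mono fun x hx => ?_)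
  simp only
  rw [ENNReal.toReal_ofReal hx, Complex.real_smul, mul_comm]

theorem freqNorm_neg (n : Fin d → ℤ) : freqNorm (-n) = freqNorm n := by
  simp [freqNorm]

/-- Averaging damps the frequencies outside `S` by the factor `q`. -/
theorem sq_l2norm_avg_le {k : UnitAddTorus (Fin d) → ℝ} (hk : IsDensity k)
    {f : UnitAddTorus (Fin d) → ℂ} (hf : MemLp f 2 volume) {q : ℝ} (S : Finset (Fin d → ℤ))
    (hq : ∀ n ∉ S, ‖mFourierCoeff (fun x => (k x : ℂ)) (-n)‖ ≤ q) :
    l2norm volume (avg (noiseLaw k) f) ^ 2 ≤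
      q ^ 2 * l2norm volume f ^ 2 + (1 - q ^ 2) * ∑ n ∈ S, ‖mFourierCoeff f n‖ ^ 2 := by
  have := hk.isProbabilityMeasure
  have h1 := hasSum_sq_mFourierCoeff_of_memLp (memLp_avg (ν := noiseLaw k) hf)
  have h2 := (hasSum_sq_mFourierCoeff_of_memLp hf).mul_left (q ^ 2)
  have h3 : HasSum (fun n => if n ∈ S then (1 - q ^ 2) * ‖mFourierCoeff f n‖ ^ 2 else 0)
      (∑ n ∈ S, (1 - q ^ 2) * ‖mFourierCoeff f n‖ ^ 2) := by
    have h := hasSum_sum_of_ne_finset_zero (s := S) (L := SummationFilter.unconditional _)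
      (f := fun n => if n ∈ S then (1 - q ^ 2) * ‖mFourierCoeff f n‖ ^ 2 else 0)
      (fun n hn => if_neg hn)
    rwa [Finset.sum_congr rfl fun n hn => if_pos hn] at h
  rw [Finset.mul_sum]
  -- The comparison is termwise: off `S` the multiplier is at most `q`, and on `S` it is at most `1
  -- = q ^ 2 + (1 - q ^ 2)` after squaring.
  refine hasSum_le (fun n => ?_) h1 (h2.add h3)
  rw [mFourierCoeff_avg hf, norm_mul, mul_pow]
  have ha := sq_nonneg ‖mFourierCoeff f n‖
  split_ifs with hn
  · have hle : ‖∫ z, mFourier n z ∂(noiseLaw k)‖ ≤ 1 := by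
      refine (norm_integral_le_of_norm_le_const (C := 1) (Filter.Eventually.of_forall fun x =>
        ((mFourier n).norm_coe_le_norm x).trans_eq mFourier_norm)).trans ?_
      simp
    have := pow_le_one₀ (n := 2) (norm_nonneg _) hle
    nlinarith
  · rw [add_zero, integral_mFourier_noiseLaw hk]
    exact mul_le_mul_of_nonneg_right (pow_le_pow_left₀ (norm_nonneg _) (hq n hn) 2) ha

/-- The trigonometric polynomial with coefficients `a` on `S`. -/
def trigPoly (S : Finset (Fin d → ℤ)) (a : (Fin d → ℤ) → ℂ) (x : Fin d → ℝ) : ℂ :=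
  ∑ n ∈ S, a n * Complex.exp (-(2 * Real.pi * Complex.I) * ∑ j, (n j : ℂ) * (x j : ℂ))

variable (S : Finset (Fin d → ℤ)) (a : (Fin d → ℤ) → ℂ)

theorem trigPoly_rep (x : UnitAddTorus (Fin d)) :
    trigPoly S a (rep x) = ∑ n ∈ S, a n * mFourier (-n) x := by
  refine Finset.sum_congr rfl fun n _ => ?_
  congr 1
  conv_rhs => rw [← proj_rep x]
  simp only [mFourier, ContinuousMap.coe_mk, proj, Pi.neg_apply]
  rw [Finset.mul_sum, Complex.exp_sum]
  refine Finset.prod_congr rfl fun j _ => ?_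
  rw [fourier_coe_apply]
  congr 1
  push_cast
  ring

theorem contDiff_trigPoly : ContDiff ℝ 1 (trigPoly S a) := by
  unfold trigPoly
  refine ContDiff.sum fun n _ => contDiff_const.mul (ContDiff.cexp ?_)
  refine contDiff_const.mul (ContDiff.sum fun j _ => contDiff_const.mul ?_)
  exact Complex.ofRealCLM.contDiff.comp (contDiff_apply ℝ ℝ j)

theorem pderiv_trigPoly (j : Fin d) :
    pderiv (trigPoly S a) j =
      trigPoly S fun n => a n * (-(2 * Real.pi * Complex.I) * (n j : ℂ)) := by
  funext x
  have hl := hasDerivAt_line (contDiff_trigPoly S a) x j (x j)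
  rw [Function.update_eq_self] at hl
  refine hl.unique ?_
  have hin (n : Fin d → ℤ) : HasDerivAt
      (fun t : ℝ => ∑ i, (n i : ℂ) * ((Function.update x j t i : ℝ) : ℂ)) (n j : ℂ) (x j) := by
    have h := HasDerivAt.fun_sum (u := Finset.univ) (A := fun i (t : ℝ) =>
      (n i : ℂ) * ((Function.update x j t i : ℝ) : ℂ))
      (A' := fun i => (n i : ℂ) * ((Pi.single j (1 : ℝ) : Fin d → ℝ) i : ℂ)) (x := x j)
      fun i _ => (((hasDerivAt_pi.1 (hasDerivAt_update x j (x j))) i).ofReal_comp).const_mul _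
    refine h.congr_deriv ?_
    rw [Finset.sum_eq_single j]
    · simp
    · intro i _ hi
      simp [hi]
    · exact fun h => absurd (Finset.mem_univ j) h
  have hterm (n : Fin d → ℤ) := ((((hin n).const_mul
    (-(2 * Real.pi * Complex.I))).cexp).const_mul (a n))
  have hs := HasDerivAt.fun_sum (u := S) fun n _ => hterm n
  refine HasDerivAt.congr_deriv hs ?_
  rw [Function.update_eq_self, trigPoly]
  refine Finset.sum_congr rfl fun n _ => ?_
  ring

theorem normSqCube_trigPoly : normSqCube (trigPoly S a) = ∑ n ∈ S, ‖a n‖ ^ 2 := by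
  have h1 : ((normSqCube (trigPoly S a) : ℝ) : ℂ) = ((∑ n ∈ S, ‖a n‖ ^ 2 : ℝ) : ℂ) := by
    rw [normSqCube, ← integral_complex_ofReal]
    have h (x : UnitAddTorus (Fin d)) : ((‖trigPoly S a (rep x)‖ ^ 2 : ℝ) : ℂ) =
        ∑ n ∈ S, ∑ m ∈ S, (a n * (starRingEnd ℂ) (a m)) * mFourier (-n + m) x := by
      rw [Complex.ofReal_pow, ← Complex.mul_conj', trigPoly_rep, map_sum, Finset.sum_mul_sum]
      refine Finset.sum_congr rfl fun n _ => Finset.sum_congr rfl fun m _ => ?_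
      rw [map_mul, ← mFourier_neg, neg_neg, mFourier_add]
      ring
    simp_rw [h]
    have hi (n m : Fin d → ℤ) : Integrable fun x : UnitAddTorus (Fin d) =>
        (a n * (starRingEnd ℂ) (a m)) * mFourier (-n + m) x :=
      (memLp_one_iff_integrable.1 (memLp_mFourier _ 1)).const_mul _
    rw [integral_finsetSum _ fun n _ => integrable_finsetSum _ fun m _ => hi n m]
    rw [Complex.ofReal_sum]
    refine Finset.sum_congr rfl fun n hn => ?_
    rw [integral_finsetSum _ fun m _ => hi n m]
    simp_rw [integral_const_mul, integral_mFourier]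
    rw [Finset.sum_eq_single n]
    · rw [neg_add_cancel, if_pos rfl, mul_one, Complex.mul_conj', Complex.ofReal_pow]
    · intro m _ hm
      rw [if_neg, mul_zero]
      intro h0
      exact hm (by rw [neg_add_eq_zero] at h0; exact h0.symm)
    · exact fun h => absurd hn h
  exact_mod_cast h1

/-- Bernstein's inequality in L²: differentiation multiplies the coefficient at `n` by `2π n j` in
modulus, and the exponentials are orthonormal. -/
theorem energy_trigPoly_le {R : ℝ} (hS : ∀ n ∈ S, freqNorm n ≤ R) :
    energy (trigPoly S a) ≤ (2 * Real.pi * R) ^ 2 * normSqCube (trigPoly S a) := by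
  have h (j : Fin d) : ∫ x : UnitAddTorus (Fin d), ‖pderiv (trigPoly S a) j (rep x)‖ ^ 2 =
      ∑ n ∈ S, (2 * Real.pi) ^ 2 * (n j : ℝ) ^ 2 * ‖a n‖ ^ 2 := by
    rw [pderiv_trigPoly]
    refine (normSqCube_trigPoly S _).trans (Finset.sum_congr rfl fun n _ => ?_)
    simp only [norm_mul, norm_neg, Complex.norm_real, Complex.norm_I, Complex.norm_ofNat,
      Complex.norm_intCast, mul_pow, sq_abs, Real.norm_eq_abs]
    ring
  rw [energy, normSqCube_trigPoly]
  simp_rw [h]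
  rw [Finset.sum_comm, Finset.mul_sum]
  refine Finset.sum_le_sum fun n hn => ?_
  rw [← Finset.sum_mul, ← Finset.mul_sum]
  refine mul_le_mul_of_nonneg_right ?_ (sq_nonneg _)
  rw [mul_pow _ R]
  refine mul_le_mul_of_nonneg_left ?_ (sq_nonneg _)
  have h0 : 0 ≤ ∑ j, (n j : ℝ) ^ 2 := Finset.sum_nonneg fun _ _ => sq_nonneg _
  rw [← Real.sq_sqrt h0]
  exact pow_le_pow_left₀ (Real.sqrt_nonneg _) (hS n hn) 2

/-- The negative exponents in `trigPoly` are chosen for this: a pairing without conjugation returns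
the Fourier coefficients of `f` themselves. -/
theorem integral_trigPoly_mul {f : UnitAddTorus (Fin d) → ℂ} (hf : MemLp f 2 volume) :
    ∫ x, trigPoly S a (rep x) * f x = ∑ n ∈ S, a n * mFourierCoeff f n := by
  simp_rw [trigPoly_rep, Finset.sum_mul, mul_assoc]
  have hi (n : Fin d → ℤ) : Integrable fun x => a n * (mFourier (-n) x * f x) :=
    ((memLp_mFourier (-n) 2).integrable_mul hf).const_mul (a n)
  rw [integral_finsetSum _ fun n _ => hi n]
  simp_rw [integral_const_mul, mFourierCoeff_eq]

theorem finite_freqNorm_le (R : ℝ) : {n : Fin d → ℤ | freqNorm n ≤ R}.Finite := by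
  refine (Set.Finite.pi' fun _ : Fin d => Set.finite_Icc (-⌊R⌋) ⌊R⌋).subset fun n hn j => ?_
  have h1 : |(n j : ℝ)| ≤ R := by
    refine le_trans ?_ (show freqNorm n ≤ R from hn)
    refine Real.le_sqrt_of_sq_le ?_
    rw [sq_abs]
    exact Finset.single_le_sum (f := fun j => (n j : ℝ) ^ 2) (fun _ _ => sq_nonneg _)
      (Finset.mem_univ j)
  rw [abs_le] at h1
  refine ⟨?_, Int.le_floor.2 h1.2⟩
  rw [neg_le]
  exact Int.le_floor.2 (by push_cast; linarith [h1.1])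

end

/-! ### Sequences with memory, Poincaré's inequality and the iterated transfer operator -/

section

section Sequence

/-- The exponentially weighted sum of the past values of a sequence. -/
def memorySum (lam : ℝ) (a : ℕ → ℝ) (j : ℕ) : ℝ :=
  ∑ k ∈ Finset.range j, lam ^ (k + 1) * a (j - (k + 1))

variable {lam : ℝ} {a : ℕ → ℝ}

/-- This recursion turns the pair of `a j` and its weighted past into a closed two-component system,
to which a Lyapunov function applies. -/
theorem memorySum_succ (j : ℕ) : memorySum lam a (j + 1) = lam * (a j + memorySum lam a j) := by
  rw [memorySum, Finset.sum_range_succ', memorySum, mul_add, Finset.mul_sum]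
  simp only [Nat.add_sub_add_right, zero_add, pow_one, Nat.add_sub_cancel]
  rw [add_comm]
  congr 1
  exact Finset.sum_congr rfl fun k _ => by ring

theorem memorySum_nonneg (h0 : 0 ≤ lam) (ha : ∀ j, 0 ≤ a j) (j : ℕ) : 0 ≤ memorySum lam a j :=
  Finset.sum_nonneg fun _ _ => mul_nonneg (pow_nonneg h0 _) (ha _)

theorem memorySum_le (h0 : 0 ≤ lam) (h1 : lam < 1) (ha : ∀ j, 0 ≤ a j) (hanti : Antitone a)
    (j : ℕ) : memorySum lam a j ≤ (1 - lam)⁻¹ * a 0 := by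
  have hp : 0 < 1 - lam := by linarith
  induction j with
  | zero => simpa [memorySum] using mul_nonneg (inv_nonneg.2 hp.le) (ha 0)
  | succ j ih =>
    rw [memorySum_succ]
    have hj := hanti (Nat.zero_le j)
    calc lam * (a j + memorySum lam a j) ≤ lam * (a 0 + (1 - lam)⁻¹ * a 0) := by gcongr
      _ = lam * (2 - lam) * ((1 - lam)⁻¹ * a 0) := by field_simp; ring
      _ ≤ 1 * ((1 - lam)⁻¹ * a 0) := by
        -- The factor `lam * (2 - lam)` equals `1 - (1 - lam) ^ 2`.
        refine mul_le_mul_of_nonneg_right ?_ (mul_nonneg (inv_nonneg.2 hp.le) (ha 0))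
        nlinarith [sq_nonneg (1 - lam)]
      _ = _ := one_mul _

/-- A nonincreasing sequence which contracts by the factor `1 - τ` whenever it is not much smaller
than its weighted past decays exponentially. -/
theorem decay_of_contraction (h0 : 0 ≤ lam) (h1 : lam < 1) (ha : ∀ j, 0 ≤ a j)
    (hanti : Antitone a) {τ : ℝ} (hτ0 : 0 < τ) (hτ1 : τ ≤ 1) {δ : ℝ} {N : ℕ}
    (h : ∀ j, N ≤ j → (1 - lam) / 4 * memorySum lam a j ≤ a j → δ * a 0 ≤ a j →
      a (j + 1) ≤ (1 - τ) * a j) (n : ℕ) :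
    a (N + n) ≤ δ * a 0 ∨
      a (N + n) ≤ max (1 - τ / 2) ((1 + lam) / 2) ^ n * ((1 + (1 - lam)⁻¹) * a 0) := by
  set ρ := max (1 - τ / 2) ((1 + lam) / 2) with hρ
  have hρ1 : 1 - τ / 2 ≤ ρ := le_max_left _ _
  have hρ2 : (1 + lam) / 2 ≤ ρ := le_max_right _ _
  have hρ0 : 0 ≤ ρ := by linarith
  have hS := memorySum_nonneg h0 ha
  -- The Lyapunov function is `a + (τ / 2) * memorySum`. As long as the target is not reached, it
  -- contracts by `ρ` at each step.
  have key : a (N + n) ≤ δ * a 0 ∨ a (N + n) + τ / 2 * memorySum lam a (N + n) ≤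
      ρ ^ n * ((1 + (1 - lam)⁻¹) * a 0) := by
    induction n with
    | zero =>
      right
      have e1 := memorySum_le h0 h1 ha hanti N
      have e2 := hanti (Nat.zero_le N)
      have e3 := hS N
      simp only [add_zero, pow_zero, one_mul]
      nlinarith
    | succ n ih =>
      rw [← add_assoc]
      have hle := hanti (Nat.le_succ (N + n))
      simp only [Nat.succ_eq_add_one] at hle
      by_cases hd : a (N + n) ≤ δ * a 0
      · exact Or.inl (hle.trans hd)
      have ih' := ih.resolve_left hd
      right
      rw [pow_succ']
      have hs := hS (N + n)
      have haj := ha (N + n)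
      have hstep : a (N + n + 1) + τ / 2 * memorySum lam a (N + n + 1) ≤
          ρ * (a (N + n) + τ / 2 * memorySum lam a (N + n)) := by
        rw [memorySum_succ]
        set x := a (N + n)
        set s := memorySum lam a (N + n)
        by_cases hg : (1 - lam) / 4 * s ≤ x
        -- The sequence itself contracts. The gain `τ` pays for the `τ / 2 * lam` by which the new
        -- memory grows, leaving `1 - τ / 2`, while the old memory decays by `lam ≤ ρ`.
        · have h2 := h (N + n) (Nat.le_add_right _ _) hg (le_of_not_ge hd)
          have h3 : (1 - τ / 2) * x ≤ ρ * x := mul_le_mul_of_nonneg_right hρ1 haj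
          have h4 : τ / 2 * (lam * s) ≤ τ / 2 * (ρ * s) := by
            refine mul_le_mul_of_nonneg_left (mul_le_mul_of_nonneg_right ?_ hs) (by linarith)
            linarith
          have h5 : τ / 2 * (lam * x) ≤ τ / 2 * x :=
            mul_le_mul_of_nonneg_left (by nlinarith) (by linarith)
          nlinarith
        -- No contraction is available, but `x` is below `(1 - lam) / 4` times the memory. The
        -- excess `τ * x` is absorbed by the memory, raising its rate from `lam` to `lam + (1 - lam)
        -- / 2 = (1 + lam) / 2`.
        · have h2 : (1 + τ / 2 * lam - ρ) * x ≤ τ * x := by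
            refine mul_le_mul_of_nonneg_right ?_ haj
            nlinarith
          have h3 : τ * x ≤ τ * ((1 - lam) / 4 * s) :=
            mul_le_mul_of_nonneg_left (le_of_not_ge hg) hτ0.le
          have h4 : τ / 2 * ((1 + lam) / 2 * s) ≤ τ / 2 * (ρ * s) :=
            mul_le_mul_of_nonneg_left (mul_le_mul_of_nonneg_right hρ2 hs) (by linarith)
          nlinarith
      calc _ ≤ _ := hstep
        _ ≤ ρ * (ρ ^ n * ((1 + (1 - lam)⁻¹) * a 0)) := mul_le_mul_of_nonneg_left ih' hρ0
        _ = _ := by ring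
  refine key.imp_right fun h => ?_
  have := mul_nonneg (by linarith : 0 ≤ τ / 2) (hS (N + n))
  linarith

end Sequence

variable {d : ℕ}

theorem ae_torusDist_le {k : UnitAddTorus (Fin d) → ℝ} (hk : IsDensity k) {ε : ℝ}
    (hs : ∀ᵐ x, ε < torusDist x → k x = 0) : ∀ᵐ z ∂(noiseLaw k), torusDist z ≤ ε := by
  rw [noiseLaw, ae_withDensity_iff' hk.integrable.1.aemeasurable.ennreal_ofReal]
  filter_upwards [hs] with x hx h
  by_contra hlt
  exact h (by rw [hx (not_le.1 hlt), ENNReal.ofReal_zero])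

theorem integral_avg {ν : Measure (UnitAddTorus (Fin d))} [IsProbabilityMeasure ν]
    {h : UnitAddTorus (Fin d) → ℂ} (hh : MemLp h 2 volume) : ∫ y, avg ν h y = ∫ y, h y := by
  have := integral_mul_avg (ν := ν) (F := fun _ => 1) (memLp_const 1) hh
  simpa using this

theorem integral_step_iterate {φ : UnitAddTorus (Fin d) → UnitAddTorus (Fin d)}
    (hφ : MeasurePreserving φ volume volume)
    {ν : Measure (UnitAddTorus (Fin d))} [IsProbabilityMeasure ν]
    {h : UnitAddTorus (Fin d) → ℂ} (hh : MemLp h 2 volume) (n : ℕ) :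
    ∫ y, (step φ ν)^[n] h y = ∫ y, h y := by
  induction n with
  | zero => rfl
  | succ n ih =>
    have hm := memLp_step_iterate (ν := ν) hφ hh n
    rw [Function.iterate_succ_apply', ← ih, ← integral_avg (ν := ν) hm]
    conv_rhs => rw [← hφ.map_eq]
    rw [integral_map hφ.measurable.aemeasurable]
    · rfl
    · rw [hφ.map_eq]; exact (memLp_avg hm).1

/-- Poincaré's inequality on the cube, in dual form. -/
theorem norm_integral_mul_le_energy {f : (Fin d → ℝ) → ℂ} (hf : ContDiff ℝ 1 f)
    {h : UnitAddTorus (Fin d) → ℂ} (hh : MemLp h 2 volume) (h0 : ∫ x, h x = 0) :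
    ‖∫ x, f (rep x) * h x‖ ≤ d * Real.sqrt (energy f) * l2norm volume h := by
  -- With uniform noise the average of a mean-zero function vanishes, so near-orthogonality to `avg
  -- h - h` bounds the pairing with `h` itself.
  have hz (y : UnitAddTorus (Fin d)) : avg volume h y = 0 := by
    rw [avg, ← h0]
    exact integral_add_left_eq_self h y
  have := norm_integral_mul_avg_sub_le (ν := (volume : Measure (UnitAddTorus (Fin d))))
    (memLp_comp_rep hf.continuous 2) hh
    (Filter.Eventually.of_forall fun z => l2norm_shift_le_energy hf z)
  simpa [hz] using this

namespace PiecewiseAffine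

variable {B : PiecewiseAffine d}

theorem contDiff_transfer_iterate {f : (Fin d → ℝ) → ℂ} (hf : ContDiff ℝ 1 f) (n : ℕ) :
    ContDiff ℝ 1 (B.transfer^[n] f) := by
  induction n with
  | zero => exact hf
  | succ n ih => rw [Function.iterate_succ_apply']; exact contDiff_transfer ih

theorem normSqCube_transfer_iterate_le [NeZero d] (hB : B.CubeAssumption)
    {f : (Fin d → ℝ) → ℂ} (hf : ContDiff ℝ 1 f) (n : ℕ) :
    normSqCube (B.transfer^[n] f) ≤ normSqCube f := by
  induction n with
  | zero => exact le_rfl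
  | succ n ih =>
    rw [Function.iterate_succ_apply']
    exact (normSqCube_transfer_le hB (contDiff_transfer_iterate hf n).continuous).trans ih

theorem energy_transfer_iterate_le [NeZero d] (hB : B.CubeAssumption)
    {f : (Fin d → ℝ) → ℂ} (hf : ContDiff ℝ 1 f) (n : ℕ) :
    energy (B.transfer^[n] f) ≤ ((B.pMax ^ (1 / (d : ℝ))) ^ n) ^ 2 * energy f := by
  induction n with
  | zero => simp
  | succ n ih =>
    rw [Function.iterate_succ_apply']
    refine (energy_transfer_le hB (contDiff_transfer_iterate hf n)).trans ?_
    calc _ ≤ _ := mul_le_mul_of_nonneg_left ih (sq_nonneg _)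
      _ = _ := by ring

/-- The evolution is peeled off one step at a time: duality exchanges `φ` for one more transfer,
after which the average is dropped at a cost governed by the translation modulus of the transferred
function. The first modulus to appear is already that of one transfer, hence the index `k + 1`. -/
theorem norm_integral_mul_step_iterate_le [NeZero d] (hB : B.CubeAssumption)
    {ν : Measure (UnitAddTorus (Fin d))} [IsProbabilityMeasure ν]
    {g : (Fin d → ℝ) → ℂ} (hg : ContDiff ℝ 1 g)
    {θ : UnitAddTorus (Fin d) → ℂ} (hθ : MemLp θ 2 volume) {b : ℕ → ℝ}
    (hb : ∀ k, ∀ᵐ z ∂ν, l2norm volume (fun x : UnitAddTorus (Fin d) =>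
      (B.transfer^[k] g) (rep (x - z)) - (B.transfer^[k] g) (rep x)) ≤ b k) (n m : ℕ) :
    ‖∫ x, g (rep x) * (step B.phi ν)^[m + n] θ x‖ ≤
      ‖∫ x, (B.transfer^[n] g) (rep x) * (step B.phi ν)^[m] θ x‖ +
      ∑ k ∈ Finset.range n, b (k + 1) * l2norm volume ((step B.phi ν)^[m + n - (k + 1)] θ) := by
  have hφ := measurePreserving_phi hB
  induction n generalizing m with
  | zero => simp
  | succ n ih =>
    have h1 := ih (m + 1)
    have e : m + 1 + n = m + (n + 1) := by ring
    rw [e] at h1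
    rw [Finset.sum_range_succ, show m + (n + 1) - (n + 1) = m by omega]
    have hm := memLp_step_iterate (ν := ν) hφ hθ m
    have h2 : ∫ x, (B.transfer^[n] g) (rep x) * (step B.phi ν)^[m + 1] θ x =
        ∫ x, (B.transfer^[n + 1] g) (rep x) * avg ν ((step B.phi ν)^[m] θ) x := by
      rw [Function.iterate_succ_apply' (step B.phi ν), Function.iterate_succ_apply' B.transfer]
      exact integral_mul_comp_phi hB (contDiff_transfer_iterate hg n).continuous (memLp_avg hm)
    have h3 := norm_integral_mul_avg_sub_le
      (memLp_comp_rep (contDiff_transfer_iterate (B := B) hg (n + 1)).continuous 2) hm (hb (n + 1))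
    rw [← h2] at h3
    have h4 := norm_sub_norm_le (∫ x, (B.transfer^[n] g) (rep x) * (step B.phi ν)^[m + 1] θ x)
      (∫ x, (B.transfer^[n + 1] g) (rep x) * (step B.phi ν)^[m] θ x)
    linarith

end PiecewiseAffine

end

/-! ### The contraction step and dissipation at fixed noise level -/

section

open UnitAddTorus
namespace PiecewiseAffine

variable {d : ℕ} {B : PiecewiseAffine d}

/-- Here `A` bounds the ratio of gradient to norm after `k` transfers, and taking it as weight in
the trace inequality balances the two terms. With `w = c * κ ^ k` one has `ε * A = 2π w` and `w ≤
1`, so the interior and jump terms together are at most `100 w + 4 ε`, up to the factor `M ^ 2`.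
Taking the root gives the constants `10` and `2`. -/
theorem sqrt_shift_bound_le {c κ lam ε A E N M : ℝ} {k : ℕ} (hc : 0 < c) (hc1 : c ≤ 1)
    (hlam : 0 ≤ lam) (hκ : lam ^ 2 = κ) (hκ0 : 0 < κ) (hκ1 : κ ≤ 1) (hε : 0 < ε)
    (hA : A = 2 * Real.pi * c * κ ^ k / ε) (hM : 0 ≤ M) (hN : N ≤ M ^ 2)
    (hE : E ≤ A ^ 2 * M ^ 2) :
    Real.sqrt (ε ^ 2 * E + 4 * ε * ((1 + A) * N + A⁻¹ * E)) ≤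
      M * (10 * Real.sqrt c * lam ^ k + 2 * Real.sqrt ε) := by
  have hA0 : 0 < A := by rw [hA]; positivity
  have hs : Real.sqrt c ^ 2 = c := Real.sq_sqrt hc.le
  have hse : Real.sqrt ε ^ 2 = ε := Real.sq_sqrt hε.le
  have hl : (lam ^ k) ^ 2 = κ ^ k := by rw [← hκ, ← pow_mul, ← pow_mul, mul_comm]
  have ha : ε * A = 2 * Real.pi * (c * κ ^ k) := by rw [hA]; field_simp
  have hk1 : κ ^ k ≤ 1 := pow_le_one₀ hκ0.le hκ1
  have hk0 : 0 < κ ^ k := pow_pos hκ0 k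
  set w := c * κ ^ k with hw
  have hw0 : 0 < w := mul_pos hc hk0
  have hw1 : w ≤ 1 := mul_le_one₀ hc1 hk0.le hk1
  have hpi := Real.pi_lt_d2
  have hpi0 := Real.pi_pos
  refine Real.sqrt_le_iff.2 ⟨by positivity, ?_⟩
  calc ε ^ 2 * E + 4 * ε * ((1 + A) * N + A⁻¹ * E)
      ≤ ε ^ 2 * (A ^ 2 * M ^ 2) + 4 * ε * ((1 + A) * M ^ 2 + A⁻¹ * (A ^ 2 * M ^ 2)) := by gcongr
    _ = M ^ 2 * ((ε * A) ^ 2 + 8 * (ε * A) + 4 * ε) := by field_simp; ring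
    _ ≤ M ^ 2 * (10 * Real.sqrt c * lam ^ k + 2 * Real.sqrt ε) ^ 2 := by
        refine mul_le_mul_of_nonneg_left ?_ (sq_nonneg _)
        have e1 : (10 * Real.sqrt c * lam ^ k + 2 * Real.sqrt ε) ^ 2 =
            100 * w + 4 * ε + 40 * (Real.sqrt c * lam ^ k * Real.sqrt ε) := by
          have : (10 * Real.sqrt c * lam ^ k + 2 * Real.sqrt ε) ^ 2 =
            100 * (Real.sqrt c ^ 2 * (lam ^ k) ^ 2) + 4 * Real.sqrt ε ^ 2 +
              40 * (Real.sqrt c * lam ^ k * Real.sqrt ε) := by ring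
          rw [this, hs, hl, hse]
        have e2 : 0 ≤ Real.sqrt c * lam ^ k * Real.sqrt ε := by positivity
        rw [e1, ha]
        have e3 : (2 * Real.pi * w) ^ 2 ≤ 6.3 * (2 * Real.pi * w) := by
          rw [sq]
          refine mul_le_mul_of_nonneg_right ?_ (by positivity)
          nlinarith
        nlinarith [mul_pos hpi0 hw0]
    _ = _ := by ring

/-- The low-frequency part of the evolved observable is controlled by its weighted past. -/
theorem sqrt_sum_low_le [NeZero d] (hB : B.CubeAssumption) {k : UnitAddTorus (Fin d) → ℝ}
    (hk : IsDensity k) {ε : ℝ} (hε : 0 < ε) (hs : ∀ᵐ x, ε < torusDist x → k x = 0)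
    {c lam : ℝ} (hc : 0 < c) (hc1 : c ≤ 1) (hlam : 0 ≤ lam)
    (hκ : lam ^ 2 = B.pMax ^ (1 / (d : ℝ)))
    {θ : UnitAddTorus (Fin d) → ℂ} (hθ : MemLp θ 2 volume) (h0 : ∫ x, θ x = 0)
    {S : Finset (Fin d → ℤ)} (hS : ∀ n ∈ S, freqNorm n ≤ c / ε) (n m : ℕ) :
    Real.sqrt (∑ i ∈ S, ‖mFourierCoeff ((step B.phi (noiseLaw k))^[m + n] θ) i‖ ^ 2) ≤
      d * (10 * Real.sqrt c *
        memorySum lam (fun j => l2norm volume ((step B.phi (noiseLaw k))^[j] θ)) (m + n) +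
        (2 * n * Real.sqrt ε + 7 * (B.pMax ^ (1 / (d : ℝ))) ^ n / ε) * l2norm volume θ) := by
  have := hk.isProbabilityMeasure
  have hφ := measurePreserving_phi hB
  set ν := noiseLaw k
  set κ := B.pMax ^ (1 / (d : ℝ)) with hκdef
  have hpm : 0 < B.pMax := B.pMin_pos.trans_le B.pMin_le_pMax
  have hκ0 : 0 < κ := Real.rpow_pos_of_pos hpm _
  have hκ1 : κ ≤ 1 := Real.rpow_le_one hpm.le B.pMax_lt_one.le (by positivity)
  set a : ℕ → ℝ := fun j => l2norm volume ((step B.phi ν)^[j] θ) with ha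
  have ha0 : ∀ j, 0 ≤ a j := fun j => l2norm_nonneg _
  have hanti : Antitone a := l2norm_step_iterate_antitone hφ hθ
  set θj := (step B.phi ν)^[m + n] θ
  have hθj : MemLp θj 2 volume := memLp_step_iterate hφ hθ _
  -- The test function is the conjugated low-frequency part of the evolved observable, so that the
  -- pairing equals `M ^ 2`, which is also the squared norm of `g`.
  set g := trigPoly S fun i => (starRingEnd ℂ) (mFourierCoeff θj i) with hgdef
  have hg : ContDiff ℝ 1 g := contDiff_trigPoly _ _
  set M := Real.sqrt (∑ i ∈ S, ‖mFourierCoeff θj i‖ ^ 2) with hM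
  have hM0 : 0 ≤ M := Real.sqrt_nonneg _
  have hMsq : M ^ 2 = ∑ i ∈ S, ‖mFourierCoeff θj i‖ ^ 2 :=
    Real.sq_sqrt (Finset.sum_nonneg fun _ _ => sq_nonneg _)
  have hNg : normSqCube g = M ^ 2 := by
    rw [hMsq, hgdef, normSqCube_trigPoly]
    simp
  have hpair : ‖∫ x, g (rep x) * θj x‖ = M ^ 2 := by
    rw [hgdef, integral_trigPoly_mul S _ hθj, hMsq]
    simp_rw [Complex.conj_mul']
    have hcast : (∑ i ∈ S, ((‖mFourierCoeff θj i‖ : ℝ) : ℂ) ^ 2) =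
      ((∑ i ∈ S, ‖mFourierCoeff θj i‖ ^ 2 : ℝ) : ℂ) := by push_cast; rfl
    rw [hcast, Complex.norm_real,
      Real.norm_of_nonneg (Finset.sum_nonneg fun _ _ => sq_nonneg _)]
  have hEk (j : ℕ) : energy (B.transfer^[j] g) ≤ (2 * Real.pi * c * κ ^ j / ε) ^ 2 * M ^ 2 := by
    refine (energy_transfer_iterate_le hB hg j).trans ?_
    have h := energy_trigPoly_le S (fun i => (starRingEnd ℂ) (mFourierCoeff θj i)) hS
    rw [← hgdef, hNg] at h
    calc _ ≤ _ := mul_le_mul_of_nonneg_left h (sq_nonneg _)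
      _ = _ := by ring
  have hNk (j : ℕ) : normSqCube (B.transfer^[j] g) ≤ M ^ 2 :=
    (normSqCube_transfer_iterate_le hB hg j).trans_eq hNg
  have hb (j : ℕ) : ∀ᵐ z ∂ν, l2norm volume (fun x : UnitAddTorus (Fin d) =>
      (B.transfer^[j] g) (rep (x - z)) - (B.transfer^[j] g) (rep x)) ≤
        d * (M * (10 * Real.sqrt c * lam ^ j + 2 * Real.sqrt ε)) := by
    filter_upwards [ae_torusDist_le hk hs] with z hz
    refine (l2norm_shift_le (contDiff_transfer_iterate hg j)
      (α := 2 * Real.pi * c * κ ^ j / ε) (by positivity) hz).trans ?_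
    refine mul_le_mul_of_nonneg_left ?_ (Nat.cast_nonneg d)
    exact sqrt_shift_bound_le hc hc1 hlam hκ hκ0 hκ1 hε rfl hM0 (hNk j) (hEk j)
  have h1 := norm_integral_mul_step_iterate_le hB (ν := ν) hg hθ hb n m
  have h2 := norm_integral_mul_le_energy (contDiff_transfer_iterate (B := B) hg n)
    (memLp_step_iterate (ν := ν) hφ hθ m) (by rw [integral_step_iterate hφ hθ, h0])
  have h3 : Real.sqrt (energy (B.transfer^[n] g)) ≤ M * (7 * κ ^ n / ε) := by
    refine Real.sqrt_le_iff.2 ⟨by positivity, (hEk n).trans ?_⟩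
    rw [← mul_pow]
    refine pow_le_pow_left₀ (by positivity) ?_ 2
    rw [mul_comm]
    refine mul_le_mul_of_nonneg_left ?_ hM0
    -- The constant `7` bounds `2π`, as `c ≤ 1`.
    have : 2 * Real.pi * c ≤ 7 := by nlinarith [Real.pi_lt_d2, Real.pi_pos]
    gcongr
  have h4 : ∑ j ∈ Finset.range n, (d * (M * (10 * Real.sqrt c * lam ^ (j + 1) +
      2 * Real.sqrt ε))) * a (m + n - (j + 1)) ≤
      M * (d * (10 * Real.sqrt c * memorySum lam a (m + n) + 2 * n * Real.sqrt ε * a 0)) := by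
    have e1 : ∑ j ∈ Finset.range n, lam ^ (j + 1) * a (m + n - (j + 1)) ≤
        memorySum lam a (m + n) :=
      Finset.sum_le_sum_of_subset_of_nonneg
        (Finset.range_mono (Nat.le_add_left n m)) fun j _ _ => mul_nonneg (pow_nonneg hlam _) (ha0 _)
    have e2 : ∑ j ∈ Finset.range n, a (m + n - (j + 1)) ≤ n * a 0 := by
      refine (Finset.sum_le_card_nsmul _ _ (a 0) fun j _ => hanti (Nat.zero_le _)).trans ?_
      simp
    have e3 : ∑ j ∈ Finset.range n, (d * (M * (10 * Real.sqrt c * lam ^ (j + 1) +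
        2 * Real.sqrt ε))) * a (m + n - (j + 1)) =
        M * (d * (10 * Real.sqrt c * ∑ j ∈ Finset.range n, lam ^ (j + 1) * a (m + n - (j + 1)) +
          2 * Real.sqrt ε * ∑ j ∈ Finset.range n, a (m + n - (j + 1)))) := by
      rw [Finset.mul_sum, Finset.mul_sum, ← Finset.sum_add_distrib, Finset.mul_sum,
        Finset.mul_sum]
      exact Finset.sum_congr rfl fun j _ => by ring
    rw [e3]
    refine mul_le_mul_of_nonneg_left (mul_le_mul_of_nonneg_left ?_ (Nat.cast_nonneg d)) hM0
    have e4 := mul_le_mul_of_nonneg_left e1 (by positivity : 0 ≤ 10 * Real.sqrt c)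
    have e5 := mul_le_mul_of_nonneg_left e2 (by positivity : 0 ≤ 2 * Real.sqrt ε)
    linarith
  have h5 : d * Real.sqrt (energy (B.transfer^[n] g)) * a m ≤
      M * (d * (7 * κ ^ n / ε * a 0)) := by
    calc d * Real.sqrt (energy (B.transfer^[n] g)) * a m ≤ d * (M * (7 * κ ^ n / ε)) * a 0 := by
          have h := hanti (Nat.zero_le m)
          have h' := ha0 m
          gcongr
      _ = _ := by ring
  -- Every error term is linear in the size `M` of the test function, so one factor `M` cancels at
  -- the end.
  have h6 : M * M ≤ M * (d * (10 * Real.sqrt c * memorySum lam a (m + n) +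
      (2 * n * Real.sqrt ε + 7 * κ ^ n / ε) * a 0)) := by
    rw [← sq, ← hpair]
    refine h1.trans ((add_le_add (h2.trans h5) h4).trans_eq ?_)
    ring
  rcases hM0.eq_or_lt with hz | hpos
  · rw [← hz]
    have := memorySum_nonneg hlam ha0 (m + n)
    have := ha0 0
    positivity
  · exact le_of_mul_le_mul_left h6 hpos

/-- The smallness of `c` and the length `N` of the mixing phase, together with the assumed lower
bounds on the current norm, make the low frequencies carry at most half of it. The remaining
frequencies are damped by `1 - x`. -/
theorem contraction_step [NeZero d] (hB : B.CubeAssumption) {k : UnitAddTorus (Fin d) → ℝ}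
    (hk : IsDensity k) {ε : ℝ} (hε : 0 < ε) (hs : ∀ᵐ x, ε < torusDist x → k x = 0)
    {c lam x : ℝ} (hc : 0 < c) (hc1 : c ≤ 1) (hlam : 0 ≤ lam)
    (hκ : lam ^ 2 = B.pMax ^ (1 / (d : ℝ))) (hx : 0 < x) (hx1 : x ≤ 1)
    (hgap : ∀ n : Fin d → ℤ, c / ε < freqNorm n → ‖mFourierCoeff (fun y => (k y : ℂ)) n‖ ≤ 1 - x)
    (hcl : d * (10 * Real.sqrt c) ≤ (1 - lam) / 16) {δ : ℝ} {N : ℕ}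
    (hN : d * (2 * N * Real.sqrt ε + 7 * (B.pMax ^ (1 / (d : ℝ))) ^ N / ε) ≤ δ / 4)
    {θ : UnitAddTorus (Fin d) → ℂ} (hθ : MemLp θ 2 volume) (h0 : ∫ x, θ x = 0) {j : ℕ}
    (hj : N ≤ j)
    (hmem : (1 - lam) / 4 *
      memorySum lam (fun j => l2norm volume ((step B.phi (noiseLaw k))^[j] θ)) j ≤
        l2norm volume ((step B.phi (noiseLaw k))^[j] θ))
    (hδj : δ * l2norm volume θ ≤ l2norm volume ((step B.phi (noiseLaw k))^[j] θ)) :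
    l2norm volume ((step B.phi (noiseLaw k))^[j + 1] θ) ≤
      (1 - 3 * x / 8) * l2norm volume ((step B.phi (noiseLaw k))^[j] θ) := by
  have := hk.isProbabilityMeasure
  have hφ := measurePreserving_phi hB
  set S := (finite_freqNorm_le (d := d) (c / ε)).toFinset with hS
  have hSle : ∀ n ∈ S, freqNorm n ≤ c / ε := fun n hn => by simpa [hS] using hn
  obtain ⟨m, rfl⟩ := Nat.exists_eq_add_of_le' hj
  have hlow := sqrt_sum_low_le hB hk hε hs hc hc1 hlam hκ hθ h0 hSle N m
  set ν := noiseLaw k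
  set θj := (step B.phi ν)^[m + N] θ
  have hθj : MemLp θj 2 volume := memLp_step_iterate hφ hθ _
  set s := memorySum lam (fun j => l2norm volume ((step B.phi ν)^[j] θ)) (m + N)
  have hs0 : 0 ≤ s := memorySum_nonneg hlam (fun j => l2norm_nonneg _) _
  set M := Real.sqrt (∑ i ∈ S, ‖mFourierCoeff θj i‖ ^ 2) with hM
  have hMsq : M ^ 2 = ∑ i ∈ S, ‖mFourierCoeff θj i‖ ^ 2 :=
    Real.sq_sqrt (Finset.sum_nonneg fun _ _ => sq_nonneg _)
  have hM0 : 0 ≤ M := Real.sqrt_nonneg _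
  have h00 : 0 ≤ l2norm volume θ := l2norm_nonneg _
  have haj : 0 ≤ l2norm volume θj := l2norm_nonneg _
  -- The memory term contributes `(1 - lam) / 16 * s`, at most a quarter of the norm by `hmem`. The
  -- other terms contribute `δ / 4` of the initial norm, again at most a quarter by `hδj`.
  have hM2 : M ≤ 1 / 2 * l2norm volume θj := by
    have e1 := mul_le_mul_of_nonneg_right hcl hs0
    have e2 := mul_le_mul_of_nonneg_right hN h00
    nlinarith
  have hq : ∀ n ∉ S, ‖mFourierCoeff (fun y => (k y : ℂ)) (-n)‖ ≤ 1 - x := fun n hn => by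
    refine hgap _ ?_
    rw [freqNorm_neg]
    simpa [hS] using hn
  have h1 := sq_l2norm_avg_le hk hθj S hq
  rw [Function.iterate_succ_apply', l2norm_step hφ hθj]
  rw [← hMsq] at h1
  have h2 : M ^ 2 ≤ 1 / 4 * l2norm volume θj ^ 2 := by
    calc M ^ 2 ≤ (1 / 2 * l2norm volume θj) ^ 2 := pow_le_pow_left₀ hM0 hM2 2
      _ = _ := by ring
  have hx8 : 0 ≤ 1 - 3 * x / 8 := by linarith
  refine (pow_le_pow_iff_left₀ (l2norm_nonneg _) (mul_nonneg hx8 haj) two_ne_zero).1 ?_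
  set y := l2norm volume θj ^ 2 with hy
  have hy0 : 0 ≤ y := sq_nonneg _
  have hq1 : 0 ≤ 1 - (1 - x) ^ 2 := by nlinarith
  calc _ ≤ _ := h1
    _ ≤ (1 - x) ^ 2 * y + (1 - (1 - x) ^ 2) * (1 / 4 * y) := by
        have := mul_le_mul_of_nonneg_left h2 hq1
        linarith
    _ = (1 / 4 + 3 / 4 * (1 - x) ^ 2) * y := by ring
    _ ≤ (1 - 3 * x / 8) ^ 2 * y := by
        refine mul_le_mul_of_nonneg_right ?_ hy0
        -- With `0 ≤ x ≤ 1`, the left side is `1 - 3x/2 + 3x²/4` and the right side is `1 - 3x/4 +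
        -- 9x²/64`.
        nlinarith
    _ = _ := by rw [hy]; ring

/-- Dissipation happens after `N` mixing steps and `n` damping steps. -/
theorem add_mem_dissipatedTimes [NeZero d] (hB : B.CubeAssumption)
    {k : UnitAddTorus (Fin d) → ℝ}
    (hk : IsDensity k) {ε : ℝ} (hε : 0 < ε) (hs : ∀ᵐ x, ε < torusDist x → k x = 0)
    {c lam x : ℝ} (hc : 0 < c) (hc1 : c ≤ 1) (hlam : 0 ≤ lam) (hlam1 : lam < 1)
    (hκ : lam ^ 2 = B.pMax ^ (1 / (d : ℝ))) (hx : 0 < x) (hx1 : x ≤ 1)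
    (hgap : ∀ n : Fin d → ℤ, c / ε < freqNorm n → ‖mFourierCoeff (fun y => (k y : ℂ)) n‖ ≤ 1 - x)
    (hcl : d * (10 * Real.sqrt c) ≤ (1 - lam) / 16) {δ : ℝ} (hδ : 0 < δ) {N : ℕ}
    (hN : d * (2 * N * Real.sqrt ε + 7 * (B.pMax ^ (1 / (d : ℝ))) ^ N / ε) ≤ δ / 4)
    {n : ℕ} (hn : max (1 - 3 * x / 8 / 2) ((1 + lam) / 2) ^ n * (1 + (1 - lam)⁻¹) ≤ δ) :
    N + n ∈ dissipatedTimes B.phi k δ := by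
  intro θ hθ h0
  have := hk.isProbabilityMeasure
  have hφ := measurePreserving_phi hB
  set θc : UnitAddTorus (Fin d) → ℂ := fun x => (θ x : ℂ) with hθc
  have hc2 : MemLp θc 2 volume := hθ.ofReal
  have hc0 : ∫ x, θc x = 0 := by
    have h := integral_ofReal (𝕜 := ℂ) (μ := volume) (f := θ)
    rwa [h0] at h
  set a : ℕ → ℝ := fun j => l2norm volume ((step B.phi (noiseLaw k))^[j] θc) with ha
  have hreal (j : ℕ) : l2norm volume ((step B.phi (noiseLaw k))^[j] θ) = a j := by
    simp only [ha, l2norm]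
    simp_rw [hθc, ← ofReal_step_iterate, Complex.norm_real]
  have key := decay_of_contraction hlam hlam1 (a := a) (fun _ => l2norm_nonneg _)
    (l2norm_step_iterate_antitone hφ hc2) (τ := 3 * x / 8) (by linarith) (by linarith)
    (δ := δ) (N := N) (fun j hj h1 h2 => contraction_step hB hk hε hs hc hc1 hlam hκ hx hx1 hgap hcl
      hN hc2 hc0 hj h1 h2) n
  have hfin : a (N + n) ≤ δ * a 0 := by
    rcases key with h | h
    · exact h
    · refine h.trans ?_
      rw [← mul_assoc]
      exact mul_le_mul_of_nonneg_right hn (l2norm_nonneg _)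
  rw [eLpNorm_congr_ae (evolve_ae_eq hφ hθ (N + n)), eLpNorm_two_eq (memLp_step_iterate hφ hθ _),
    eLpNorm_two_eq hθ, ← ENNReal.ofReal_mul hδ.le, hreal]
  refine ENNReal.ofReal_le_ofReal (hfin.trans_eq ?_)
  rw [← hreal 0]
  rfl

end PiecewiseAffine

end

/-! ### The lower bound: Lipschitz bumps and a slow observable -/

section

variable {d : ℕ}

/-- The Euclidean norm on `ℝ^d`. -/
def euclNorm (v : Fin d → ℝ) : ℝ := Real.sqrt (∑ j, v j ^ 2)

theorem abs_le_euclNorm (v : Fin d → ℝ) (j : Fin d) : |v j| ≤ euclNorm v := by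
  refine Real.le_sqrt_of_sq_le ?_
  rw [sq_abs]
  exact Finset.single_le_sum (f := fun j => v j ^ 2) (fun _ _ => sq_nonneg _) (Finset.mem_univ j)

theorem euclNorm_smul_mulVec {D : Matrix (Fin d) (Fin d) ℝ}
    (hD : D ∈ Matrix.orthogonalGroup (Fin d) ℝ) {s : ℝ} (hs : 0 ≤ s) (v : Fin d → ℝ) :
    euclNorm (s • D.mulVec v) = s * euclNorm v := by
  have h : D.transpose * D = 1 := (Matrix.mem_orthogonalGroup_iff' _ _).1 hD
  have h1 : (D.mulVec v) ⬝ᵥ (D.mulVec v) = v ⬝ᵥ v := by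
    rw [Matrix.dotProduct_mulVec, ← Matrix.mulVec_transpose, Matrix.mulVec_mulVec, h,
      Matrix.one_mulVec]
  have h2 : ∑ j, (D.mulVec v) j ^ 2 = ∑ j, v j ^ 2 := by simpa [dotProduct, sq] using h1
  simp only [euclNorm, Pi.smul_apply, smul_eq_mul, mul_pow, ← Finset.mul_sum, h2]
  rw [Real.sqrt_mul (sq_nonneg s), Real.sqrt_sq hs]

theorem norm_coe_le_abs (t : ℝ) : ‖(t : UnitAddCircle)‖ ≤ |t| :=
  QuotientAddGroup.norm_mk_le_norm

theorem torusDist_proj_le (v : Fin d → ℝ) : torusDist (proj v) ≤ euclNorm v := by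
  refine Real.sqrt_le_sqrt (Finset.sum_le_sum fun j _ => ?_)
  rw [← sq_abs (v j)]
  exact pow_le_pow_left₀ (norm_nonneg _) (norm_coe_le_abs _) 2

theorem exists_proj_eq_euclNorm_eq (z : UnitAddTorus (Fin d)) :
    ∃ v : Fin d → ℝ, proj v = z ∧ euclNorm v = torusDist z := by
  choose v hv1 hv2 using fun j => exists_abs_eq_norm (z j)
  refine ⟨v, funext hv1, ?_⟩
  simp only [euclNorm, torusDist, ← hv2, sq_abs]

theorem proj_sub (v w : Fin d → ℝ) : proj (v - w) = proj v - proj w := rfl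

theorem torusDist_nonneg (z : UnitAddTorus (Fin d)) : 0 ≤ torusDist z := Real.sqrt_nonneg _

/-- Nonnegative `L`-Lipschitz functions which vanish on the boundary of the unit cube. -/
structure IsBump (L : ℝ) (f : UnitAddTorus (Fin d) → ℝ) : Prop where
  nonneg : ∀ x, 0 ≤ f x
  le_add : ∀ x y, f x ≤ f y + L * torusDist (x - y)
  eq_zero : ∀ x j, x j = 0 → f x = 0

theorem IsBump.abs_sub_le {L : ℝ} {f : UnitAddTorus (Fin d) → ℝ} (hf : IsBump L f)
    (x z : UnitAddTorus (Fin d)) : |f (x + z) - f x| ≤ L * torusDist z := by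
  have h1 := hf.le_add (x + z) x
  have h2 := hf.le_add x (x + z)
  have h3 : torusDist (x - (x + z)) = torusDist z := by
    simp [torusDist]
  rw [add_sub_cancel_left] at h1
  rw [h3] at h2
  exact abs_le.2 ⟨by linarith, by linarith⟩

/-- Some coordinate of `w` lies outside `(0, 1)`. The face of the cube on that side is no farther
from `w'` than `w` is, and `f` vanishes on it. -/
theorem IsBump.le_of_notMem_openCube {L : ℝ} (hL : 0 ≤ L) {f : UnitAddTorus (Fin d) → ℝ}
    (hf : IsBump L f) {w w' : Fin d → ℝ} (hw : w ∉ openCube d)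
    (hw' : w' ∈ Set.Icc (0 : Fin d → ℝ) 1) : f (proj w') ≤ L * euclNorm (w' - w) := by
  obtain ⟨j, hj⟩ : ∃ j, w j ∉ Set.Ioo (0 : ℝ) 1 := by
    by_contra! h
    exact hw fun j _ => h j
  have h0 : 0 ≤ w' j := hw'.1 j
  have h1 : w' j ≤ 1 := hw'.2 j
  obtain ⟨b, hb, hle⟩ : ∃ b : ℝ, (b : UnitAddCircle) = 0 ∧ |w' j - b| ≤ |w' j - w j| := by
    rw [Set.mem_Ioo, not_and_or, not_lt, not_lt] at hj
    rcases hj with hj | hj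
    · refine ⟨0, by simp, ?_⟩
      rw [sub_zero, abs_of_nonneg h0, abs_of_nonneg (by linarith)]
      linarith
    · refine ⟨1, AddCircle.coe_period 1, ?_⟩
      rw [abs_of_nonpos (by linarith), abs_of_nonpos (by linarith)]
      linarith
  have hz : f (proj (Function.update w' j b)) = 0 := hf.eq_zero _ j (by simp [proj, hb])
  have h2 := hf.le_add (proj w') (proj (Function.update w' j b))
  rw [hz, zero_add, ← proj_sub] at h2
  refine h2.trans (mul_le_mul_of_nonneg_left ?_ hL)
  refine (torusDist_proj_le _).trans ?_
  have h3 : euclNorm (w' - Function.update w' j b) = |w' j - b| := by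
    rw [euclNorm, Finset.sum_eq_single j]
    · simp [Real.sqrt_sq_eq_abs]
    · intro i _ hi
      simp [hi]
    · exact fun h => absurd (Finset.mem_univ j) h
  rw [h3]
  exact hle.trans (abs_le_euclNorm (w' - w) j)

namespace PiecewiseAffine

variable {B : PiecewiseAffine d}

theorem euclNorm_branch_sub (i : Fin B.M) (v w : Fin d → ℝ) :
    euclNorm (B.branch i v - B.branch i w) = (B.side i)⁻¹ * euclNorm (v - w) := by
  rw [← euclNorm_smul_mulVec (B.D_orthogonal i) (inv_nonneg.2 (B.side_pos i).le)]
  simp only [branch, affineBranch, side, add_sub_add_right_eq_sub, Matrix.mulVec_sub, smul_sub]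

theorem inv_side_le (i : Fin B.M) : (B.side i)⁻¹ ≤ (B.pMin ^ (1 / (d : ℝ)))⁻¹ :=
  inv_anti₀ (Real.rpow_pos_of_pos B.pMin_pos _)
    (Real.rpow_le_rpow B.pMin_pos.le (B.pMin_le i) (by positivity))

/-- Otherwise one could move the vanishing coordinate slightly below `0` and keep the image in the
open cube. The moved point would then lie in the cell, hence in the unit cube. -/
theorem branch_rep_notMem_openCube (hB : B.CubeAssumption) {x : UnitAddTorus (Fin d)} {j : Fin d}
    (hx : x j = 0) (i : Fin B.M) : B.branch i (rep x) ∉ openCube d := by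
  intro h
  have hr : rep x j = 0 := by
    have : rep x j = circleRep (x j) := rfl
    rw [this, hx, ← AddCircle.coe_zero, circleRep_coe ⟨le_rfl, one_pos⟩]
  have hc : Continuous fun t : ℝ => B.branch i (Function.update (rep x) j t) :=
    (B.continuous_branch i).comp (continuous_const.update j continuous_id)
  have ho := isOpen_openCube.preimage hc
  have h0 : (0 : ℝ) ∈ (fun t : ℝ => B.branch i (Function.update (rep x) j t)) ⁻¹' openCube d := by
    rw [Set.mem_preimage, ← hr, Function.update_eq_self]
    exact h
  obtain ⟨r, hr0, hball⟩ := Metric.isOpen_iff.1 ho 0 h0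
  have hneg : (-(r / 2) : ℝ) ∈ Metric.ball (0 : ℝ) r := by
    rw [Metric.mem_ball, Real.dist_eq, sub_zero, abs_neg, abs_of_pos (by linarith)]
    linarith
  have hcell := B.cell_subset_unitCube i (mem_cell_of_branch_mem_openCube hB (hball hneg)) j trivial
  rw [Function.update_self] at hcell
  linarith [hcell.1]

/-- Extend the affine branch at `x` to the lift of `y` nearest to `rep x`, even beyond the cell. If
the image stays in the open cube, the lift belongs to the same cell and the image is `φ y`, so the
Lipschitz bound is immediate. If not, the segment of images leaves the cube, and the vanishing of
`f` on the boundary bounds `f (φ x)` alone. The one-sided form of `le_add` is what allows using the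
branch at `x` only. -/
theorem isBump_comp_phi (hB : B.CubeAssumption) {L : ℝ} (hL : 0 ≤ L)
    {f : UnitAddTorus (Fin d) → ℝ} (hf : IsBump L f) :
    IsBump (L * (B.pMin ^ (1 / (d : ℝ)))⁻¹) (f ∘ B.phi) where
  nonneg x := hf.nonneg _
  le_add x y := by
    obtain ⟨v, hv, hvn⟩ := exists_proj_eq_euclNorm_eq (x - y)
    set i := B.index x
    have hx : B.phi x = proj (B.branch i (rep x)) := rfl
    have hIcc : B.branch i (rep x) ∈ Set.Icc (0 : Fin d → ℝ) 1 :=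
      B.mapsTo i (rep_mem_cell_index x)
    have hy : proj (rep x - v) = y := by rw [proj_sub, proj_rep, hv, sub_sub_cancel]
    have hdist : euclNorm (B.branch i (rep x) - B.branch i (rep x - v)) ≤
        (B.pMin ^ (1 / (d : ℝ)))⁻¹ * torusDist (x - y) := by
      rw [euclNorm_branch_sub, sub_sub_cancel, hvn]
      exact mul_le_mul_of_nonneg_right (inv_side_le i) (torusDist_nonneg _)
    simp only [Function.comp_apply, mul_assoc]
    rw [hx]
    by_cases hw : B.branch i (rep x - v) ∈ openCube d
    · have hcell := mem_cell_of_branch_mem_openCube hB hw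
      have hrep : rep y = rep x - v := by rw [← hy, rep_proj (B.cell_subset_unitCube i hcell)]
      have hphi : B.phi y = proj (B.branch i (rep x - v)) := by
        rw [phi, index_eq (hrep.symm ▸ hcell), torusBranch, hrep]
      rw [hphi]
      refine (hf.le_add _ _).trans (add_le_add le_rfl (mul_le_mul_of_nonneg_left ?_ hL))
      rw [← proj_sub]
      exact (torusDist_proj_le _).trans hdist
    · have h1 := hf.le_of_notMem_openCube hL hw hIcc
      have h2 := mul_le_mul_of_nonneg_left hdist hL
      linarith [hf.nonneg (B.phi y)]
  eq_zero x j hx := by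
    have hw := branch_rep_notMem_openCube hB hx (B.index x)
    have hIcc : B.branch (B.index x) (rep x) ∈ Set.Icc (0 : Fin d → ℝ) 1 :=
      B.mapsTo _ (rep_mem_cell_index x)
    have h := hf.le_of_notMem_openCube hL hw hIcc
    rw [sub_self] at h
    have h0 : euclNorm (0 : Fin d → ℝ) = 0 := by simp [euclNorm]
    rw [h0, mul_zero] at h
    exact le_antisymm h (hf.nonneg _)

theorem isBump_comp_phi_iterate (hB : B.CubeAssumption) {L : ℝ} (hL : 0 ≤ L)
    {f : UnitAddTorus (Fin d) → ℝ} (hf : IsBump L f) (n : ℕ) :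
    IsBump (L * ((B.pMin ^ (1 / (d : ℝ)))⁻¹) ^ n) (f ∘ B.phi^[n]) := by
  induction n with
  | zero => simpa using hf
  | succ n ih =>
    rw [Function.iterate_succ, ← Function.comp_assoc, pow_succ, ← mul_assoc]
    refine isBump_comp_phi hB (mul_nonneg hL (pow_nonneg (inv_nonneg.2 ?_) _)) ih
    exact (Real.rpow_pos_of_pos B.pMin_pos _).le

end PiecewiseAffine

/-- The distance in the maximum norm to the boundary of the unit cube. -/
def boundaryDist (d : ℕ) (x : UnitAddTorus (Fin d)) : ℝ := ⨅ j, ‖x j‖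

theorem isBump_boundaryDist [NeZero d] : IsBump 1 (boundaryDist d) where
  nonneg x := Real.iInf_nonneg fun _ => norm_nonneg _
  le_add x y := by
    rw [← sub_le_iff_le_add]
    refine le_ciInf fun j => ?_
    have h1 : boundaryDist d x ≤ ‖x j‖ := ciInf_le (Set.finite_range _).bddBelow j
    have h2 : ‖x j‖ ≤ ‖y j‖ + ‖(x - y) j‖ := by
      have := norm_add_le (y j) ((x - y) j)
      rwa [Pi.sub_apply, add_sub_cancel] at this
    linarith [norm_apply_le_torusDist (x - y) j]
  eq_zero x j hx := by
    refine le_antisymm ?_ (Real.iInf_nonneg fun _ => norm_nonneg _)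
    refine (ciInf_le (Set.finite_range _).bddBelow j).trans ?_
    rw [hx, norm_zero]

theorem continuous_boundaryDist [NeZero d] : Continuous (boundaryDist d) := by
  have h : boundaryDist d = fun x => Finset.univ.inf' Finset.univ_nonempty fun j => ‖x j‖ := by
    funext x
    rw [Finset.inf'_univ_eq_ciInf]
    rfl
  rw [h]
  exact Continuous.finset_inf'_apply _ fun j _ => (continuous_apply j).norm

theorem boundaryDist_le [NeZero d] (x : UnitAddTorus (Fin d)) : boundaryDist d x ≤ 1 / 2 :=
  (ciInf_le (Set.finite_range _).bddBelow 0).trans (norm_le_half _)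

/-- Continuity turns almost everywhere into everywhere, and the function is `0` at the origin and
`1/2` at the centre of the cube. This makes the norm of `slowObservable` positive. -/
theorem not_ae_const_boundaryDist [NeZero d] (m : ℝ) :
    ¬ boundaryDist d =ᵐ[volume] fun _ => m := by
  intro h
  have h1 : boundaryDist d = fun _ => m :=
    Measure.eq_of_ae_eq h continuous_boundaryDist continuous_const
  have h2 : boundaryDist d 0 = 0 := isBump_boundaryDist.eq_zero 0 0 rfl
  have h3 : boundaryDist d (fun _ => ((1 / 2 : ℝ) : UnitAddCircle)) = 1 / 2 := by
    have : ‖((1 / 2 : ℝ) : UnitAddCircle)‖ = 1 / 2 := by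
      rw [(AddCircle.norm_coe_eq_abs_iff (1 : ℝ) one_ne_zero).2 (by norm_num [abs_of_pos])]
      norm_num [abs_of_pos]
    simp only [boundaryDist, this, ciInf_const]
  rw [h1] at h2 h3
  simp only at h2 h3
  linarith

/-- A mean-zero observable whose evolution is slow to dissipate. -/
def slowObservable (d : ℕ) (x : UnitAddTorus (Fin d)) : ℝ :=
  boundaryDist d x - ∫ y, boundaryDist d y

theorem integrable_boundaryDist [NeZero d] : Integrable (boundaryDist d) :=
  memLp_one_iff_integrable.1 (MemLp.of_bound continuous_boundaryDist.aestronglyMeasurable (1 / 2)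
    (Filter.Eventually.of_forall fun x => by
      rw [Real.norm_of_nonneg (isBump_boundaryDist.nonneg x)]; exact boundaryDist_le x))

theorem measurable_slowObservable [NeZero d] : Measurable (slowObservable d) :=
  continuous_boundaryDist.measurable.sub_const _

theorem abs_slowObservable_le [NeZero d] (x : UnitAddTorus (Fin d)) :
    |slowObservable d x| ≤ 1 + |∫ y, boundaryDist d y| := by
  refine (abs_sub _ _).trans (add_le_add ?_ le_rfl)
  rw [abs_of_nonneg (isBump_boundaryDist.nonneg x)]
  linarith [boundaryDist_le x]

theorem memLp_slowObservable [NeZero d] : MemLp (slowObservable d) 2 volume :=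
  MemLp.of_bound measurable_slowObservable.aestronglyMeasurable _
    (Filter.Eventually.of_forall abs_slowObservable_le)

theorem integral_slowObservable [NeZero d] : ∫ x, slowObservable d x = 0 := by
  simp only [slowObservable]
  rw [integral_sub integrable_boundaryDist (integrable_const _), integral_const]
  simp

theorem l2norm_slowObservable_pos [NeZero d] : 0 < l2norm volume (slowObservable d) := by
  refine lt_of_le_of_ne (l2norm_nonneg _) fun h => ?_
  have h1 : ∫ x, ‖slowObservable d x‖ ^ 2 = 0 := by rw [← sq_l2norm, ← h]; norm_num
  rw [integral_eq_zero_iff_of_nonneg (fun _ => sq_nonneg _)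
    (integrable_norm_sq memLp_slowObservable)] at h1
  refine not_ae_const_boundaryDist (d := d) (∫ y, boundaryDist d y) (h1.mono fun x hx => ?_)
  have : slowObservable d x = 0 := by simpa using hx
  exact sub_eq_zero.1 this

namespace PiecewiseAffine

variable {B : PiecewiseAffine d}

/-- In the induction the first noise is inserted before `n` further applications of `φ`, whose
composition with the bump has Lipschitz constant `pMin ^ (-n/d)`. Measurability and boundedness are
carried along so that the integrals make sense at every point. -/
theorem step_iterate_slowObservable [NeZero d] (hB : B.CubeAssumption)
    {ν : Measure (UnitAddTorus (Fin d))} [IsProbabilityMeasure ν] {ε : ℝ}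
    (hν : ∀ᵐ z ∂ν, torusDist z ≤ ε) (n : ℕ) :
    Measurable ((step B.phi ν)^[n] (slowObservable d)) ∧
      (∀ x, |(step B.phi ν)^[n] (slowObservable d) x| ≤ 1 + |∫ y, boundaryDist d y|) ∧
      ∀ x, |(step B.phi ν)^[n] (slowObservable d) x - slowObservable d (B.phi^[n] x)| ≤
        ∑ j ∈ Finset.range n, ε * ((B.pMin ^ (1 / (d : ℝ)))⁻¹) ^ j := by
  induction n with
  | zero => exact ⟨measurable_slowObservable, abs_slowObservable_le, fun x => by simp⟩
  | succ n ih =>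
    obtain ⟨hm, hb, hd⟩ := ih
    rw [Function.iterate_succ_apply']
    set a := (step B.phi ν)^[n] (slowObservable d)
    have hi (x : UnitAddTorus (Fin d)) : Integrable (fun z => a (B.phi x + z)) ν :=
      memLp_one_iff_integrable.1 (MemLp.of_bound
        (hm.comp (measurable_const_add _)).aestronglyMeasurable _
        (Filter.Eventually.of_forall fun z => hb _))
    refine ⟨?_, fun x => ?_, fun x => ?_⟩
    · have h : StronglyMeasurable (fun p : UnitAddTorus (Fin d) × UnitAddTorus (Fin d) =>
          a (B.phi p.1 + p.2)) :=
        (hm.comp ((measurable_phi.comp measurable_fst).add measurable_snd)).stronglyMeasurable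
      exact h.integral_prod_right'.measurable
    · have := norm_integral_le_of_norm_le_const (μ := ν)
        (f := fun z => a (B.phi x + z)) (C := 1 + |∫ y, boundaryDist d y|)
        (Filter.Eventually.of_forall fun z => hb (B.phi x + z))
      simpa [step, avg] using this
    · rw [Finset.sum_range_succ]
      have h1 : step B.phi ν a x - slowObservable d (B.phi^[n + 1] x) =
          ∫ z, (a (B.phi x + z) - slowObservable d (B.phi^[n] (B.phi x))) ∂ν := by
        rw [integral_sub (hi x) (integrable_const _), integral_const]
        simp [step, avg]
      rw [h1]
      have h2 := norm_integral_le_of_norm_le_const (μ := ν)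
        (f := fun z => a (B.phi x + z) - slowObservable d (B.phi^[n] (B.phi x)))
        (C := ∑ j ∈ Finset.range n, ε * ((B.pMin ^ (1 / (d : ℝ)))⁻¹) ^ j +
          ε * ((B.pMin ^ (1 / (d : ℝ)))⁻¹) ^ n) ?_
      · simpa using h2
      · filter_upwards [hν] with z hz
        have h3 := hd (B.phi x + z)
        have h4 := (isBump_comp_phi_iterate hB zero_le_one isBump_boundaryDist n).abs_sub_le
          (B.phi x) z
        have h5 : slowObservable d (B.phi^[n] (B.phi x + z)) -
            slowObservable d (B.phi^[n] (B.phi x)) =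
            (boundaryDist d ∘ B.phi^[n]) (B.phi x + z) -
              (boundaryDist d ∘ B.phi^[n]) (B.phi x) := by
          simp [slowObservable]
        rw [← h5, one_mul] at h4
        have h6 : ((B.pMin ^ (1 / (d : ℝ)))⁻¹) ^ n * torusDist z ≤
            ε * ((B.pMin ^ (1 / (d : ℝ)))⁻¹) ^ n := by
          rw [mul_comm]
          refine mul_le_mul_of_nonneg_right hz (pow_nonneg (inv_nonneg.2 ?_) _)
          exact (Real.rpow_pos_of_pos B.pMin_pos _).le
        rw [Real.norm_eq_abs]
        calc _ = |(a (B.phi x + z) - slowObservable d (B.phi^[n] (B.phi x + z))) +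
              (slowObservable d (B.phi^[n] (B.phi x + z)) -
                slowObservable d (B.phi^[n] (B.phi x)))| := by ring_nf
          _ ≤ _ := (abs_add_le _ _).trans (add_le_add h3 (h4.trans h6))

/-- A dissipated time is so large that the accumulated perturbation is of order one. -/
theorem le_of_mem_dissipatedTimes [NeZero d] (hB : B.CubeAssumption)
    {k : UnitAddTorus (Fin d) → ℝ} (hk : IsDensity k) {ε : ℝ}
    (hs : ∀ᵐ x, ε < torusDist x → k x = 0) {δ : ℝ} (hδ : 0 ≤ δ) {n : ℕ}
    (hn : n ∈ dissipatedTimes B.phi k δ) :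
    (1 - δ) * l2norm volume (slowObservable d) ≤
      ∑ j ∈ Finset.range n, ε * ((B.pMin ^ (1 / (d : ℝ)))⁻¹) ^ j := by
  have := hk.isProbabilityMeasure
  have hφ := measurePreserving_phi hB
  obtain ⟨hm, hb, hd⟩ := step_iterate_slowObservable hB (ae_torusDist_le hk hs) n
  set e := ∑ j ∈ Finset.range n, ε * ((B.pMin ^ (1 / (d : ℝ)))⁻¹) ^ j
  have hθ : MemLp (slowObservable d) 2 volume := memLp_slowObservable
  have h1 := hn _ hθ integral_slowObservable
  rw [eLpNorm_congr_ae (evolve_ae_eq hφ hθ n), eLpNorm_two_eq (memLp_step_iterate hφ hθ _),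
    eLpNorm_two_eq hθ, ← ENNReal.ofReal_mul hδ,
    ENNReal.ofReal_le_ofReal_iff (mul_nonneg hδ (l2norm_nonneg _))] at h1
  set a := (step B.phi (noiseLaw k))^[n] (slowObservable d)
  have ha : MemLp a 2 volume := memLp_step_iterate hφ hθ n
  have hφn := hφ.iterate n
  have hc : MemLp (slowObservable d ∘ B.phi^[n]) 2 volume := hθ.comp_measurePreserving hφn
  -- The noiseless composition has the full norm of the observable; it exceeds the dissipated norm
  -- by at most the uniform distance `e`.
  have h2 := l2norm_add_le ha (hc.sub ha)
  rw [add_sub_cancel, l2norm_comp hφn hθ.1] at h2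
  have he : 0 ≤ e := (abs_nonneg _).trans (hd 0)
  have h3 : l2norm volume (slowObservable d ∘ B.phi^[n] - a) ≤ e := by
    refine Real.sqrt_le_iff.2 ⟨he, ?_⟩
    have h4 := integral_mono (integrable_norm_sq (hc.sub ha)) (integrable_const (e ^ 2))
      fun x => by
        have h := hd x
        rw [abs_sub_comm] at h
        exact pow_le_pow_left₀ (norm_nonneg _) h 2
    simpa using h4
  linarith

end PiecewiseAffine

end

/-! ### Choice of constants and logarithmic bookkeeping -/

section

open Filter Topology

theorem pow_ceil_log_le {κ y : ℝ} (hκ0 : 0 < κ) (hκ1 : κ < 1) (hy : 0 < y) :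
    κ ^ ⌈Real.log y / Real.log κ⌉₊ ≤ y := by
  have hl := Real.log_neg hκ0 hκ1
  rw [← Real.log_le_log_iff (pow_pos hκ0 _) hy, Real.log_pow]
  have h := Nat.le_ceil (Real.log y / Real.log κ)
  rwa [div_le_iff_of_neg hl] at h

theorem ceil_log_le {κ y : ℝ} (hκ0 : 0 < κ) (hκ1 : κ < 1) (hy : 0 < y) (hy1 : y ≤ 1) :
    (⌈Real.log y / Real.log κ⌉₊ : ℝ) ≤ Real.log y / Real.log κ + 1 :=
  (Nat.ceil_lt_add_one (div_nonneg_of_nonpos (Real.log_nonpos hy.le hy1)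
    (Real.log_neg hκ0 hκ1).le)).le

/-- The mixing phase has length of order `|log ε|`, and each of its steps leaks an error of order
`√ε`; the total tends to zero. -/
theorem exists_forall_sqrt_mul_log_le (a b : ℝ) {η : ℝ} (hη : 0 < η) :
    ∃ ε₀ : ℝ, 0 < ε₀ ∧ ∀ ε : ℝ, 0 < ε → ε < ε₀ → (a * Real.log ε + b) * Real.sqrt ε ≤ η := by
  have h1 : Tendsto (fun ε : ℝ => Real.log ε * Real.sqrt ε) (𝓝[>] 0) (𝓝 0) := by
    simp_rw [Real.sqrt_eq_rpow]
    exact tendsto_log_mul_rpow_nhdsGT_zero (by norm_num)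
  have h2 : Tendsto Real.sqrt (𝓝[>] 0) (𝓝 0) := by
    have := (Real.continuous_sqrt.tendsto 0).mono_left (nhdsWithin_le_nhds (s := Set.Ioi 0))
    rwa [Real.sqrt_zero] at this
  have h3 : Tendsto (fun ε : ℝ => (a * Real.log ε + b) * Real.sqrt ε) (𝓝[>] 0) (𝓝 0) := by
    have := (h1.const_mul a).add (h2.const_mul b)
    simp only [mul_zero, add_zero] at this
    refine this.congr fun ε => ?_
    ring
  have h4 := h3.eventually_le_const hη
  obtain ⟨ε₀, h0, hs⟩ := mem_nhdsGT_iff_exists_Ioo_subset.1 h4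
  exact ⟨ε₀, h0, fun ε he1 he2 => hs ⟨he1, he2⟩⟩

/-- The time is a mixing phase `N ≈ log (ε δ) / log κ` followed by a damping phase `n ≈ log δ / log
ρ`. Only the first depends on `ε`; `c`, `x` and `ρ` are fixed by `d`, `P` and `χ`. The threshold for
`ε` may depend on `δ`. -/
theorem exists_mem_dissipatedTimes_le (d : ℕ) [NeZero d] {P : ℝ} (hP0 : 0 < P) (hP1 : P < 1)
    (χ : ℝ → ℝ) (hχ : ∀ c : ℝ, 0 < c → 0 < χ c) :
    ∃ C : ℝ, 0 < C ∧ ∀ (B : PiecewiseAffine d) (K : ℝ → UnitAddTorus (Fin d) → ℝ),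
      B.CubeAssumption → B.pMax = P → IsLocalNoise K → HasFourierGap K χ →
      ∀ δ : ℝ, 0 < δ → δ < 1 → ∃ ε₀ : ℝ, 0 < ε₀ ∧ ∀ ε : ℝ, 0 < ε → ε < ε₀ →
        ∃ n ∈ dissipatedTimes B.phi (K ε) δ,
          (n : ℝ) ≤ (d : ℝ) * Real.log ε / Real.log P + C * (1 + |Real.log δ|) := by
  have hd0 : (0 : ℝ) < d := Nat.cast_pos.2 (NeZero.pos d)
  have hd1 : (1 : ℝ) ≤ d := Nat.one_le_cast.2 (NeZero.pos d)
  set κ := P ^ (1 / (d : ℝ)) with hκ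
  have hκ0 : 0 < κ := Real.rpow_pos_of_pos hP0 _
  have hκ1 : κ < 1 := Real.rpow_lt_one hP0.le hP1 (by positivity)
  have hlogκ : Real.log κ = Real.log P / d := by rw [hκ, Real.log_rpow hP0]; ring
  have hlκ := Real.log_neg hκ0 hκ1
  set lam := Real.sqrt κ with hlam
  have hlam0 : 0 ≤ lam := Real.sqrt_nonneg _
  have hlamsq : lam ^ 2 = κ := Real.sq_sqrt hκ0.le
  have hlam1 : lam < 1 := by
    rw [hlam, Real.sqrt_lt' one_pos, one_pow]; exact hκ1
  -- Chosen so that `c = s ^ 2` satisfies the smallness condition of the contraction step with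
  -- equality.
  set s := (1 - lam) / (160 * d) with hs
  have hs0 : 0 < s := div_pos (by linarith) (by positivity)
  have hs1 : s ≤ 1 := by
    rw [hs, div_le_one (by positivity)]; linarith
  set c := s ^ 2 with hc
  have hc0 : 0 < c := pow_pos hs0 2
  have hc1 : c ≤ 1 := pow_le_one₀ hs0.le hs1
  have hcl : d * (10 * Real.sqrt c) ≤ (1 - lam) / 16 := by
    rw [hc, Real.sqrt_sq hs0.le, hs]
    refine le_of_eq ?_
    field_simp
    ring
  set x := min (χ c) 1 with hx
  have hx0 : 0 < x := lt_min (hχ c hc0) one_pos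
  have hx1 : x ≤ 1 := min_le_right _ _
  set ρ := max (1 - 3 * x / 8 / 2) ((1 + lam) / 2) with hρ
  have hρ0 : 0 < ρ := lt_of_lt_of_le (by linarith) (le_max_left _ _)
  have hρ1 : ρ < 1 := max_lt (by linarith) (by linarith)
  have hlρ := Real.log_neg hρ0 hρ1
  set C₁ := 1 + (1 - lam)⁻¹ with hC₁
  have hC1 : 1 ≤ C₁ := by
    have : 0 < (1 - lam)⁻¹ := inv_pos.2 (by linarith)
    linarith
  have hlC := Real.log_nonneg hC1
  have h56 : (1 : ℝ) ≤ 56 * d := by linarith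
  have hl56 := Real.log_nonneg h56
  set C := (1 + Real.log (56 * d)) / (-Real.log κ) + (1 + Real.log C₁) / (-Real.log ρ) + 2 with hC
  have hCa : 0 ≤ (1 + Real.log (56 * d)) / (-Real.log κ) :=
    div_nonneg (by linarith) (by linarith)
  have hCb : 0 ≤ (1 + Real.log C₁) / (-Real.log ρ) := div_nonneg (by linarith) (by linarith)
  refine ⟨C, by linarith, fun B K hB hBP hK hgap δ hδ0 hδ1 => ?_⟩
  obtain ⟨ε₁, hε₁, hε₁'⟩ := hgap c hc0
  set b := (Real.log δ - Real.log (56 * d)) / Real.log κ + 1 with hb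
  obtain ⟨ε₂, hε₂, hε₂'⟩ := exists_forall_sqrt_mul_log_le (2 * d * (1 / Real.log κ)) (2 * d * b)
    (show 0 < δ / 8 by linarith)
  refine ⟨min ε₁ (min ε₂ 1), lt_min hε₁ (lt_min hε₂ one_pos), fun ε hε hεlt => ?_⟩
  have hlt1 : ε < ε₁ := hεlt.trans_le (min_le_left _ _)
  have hlt2 : ε < ε₂ := hεlt.trans_le ((min_le_right _ _).trans (min_le_left _ _))
  have hlt3 : ε < 1 := hεlt.trans_le ((min_le_right _ _).trans (min_le_right _ _))
  have hlδ : Real.log δ < 0 := Real.log_neg hδ0 hδ1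
  -- The factor `56 = 7 * 8` makes the Poincaré term `d * 7 * κ ^ N / ε` at most `δ / 8`. The other
  -- `δ / 8` is reserved for the accumulated `√ε` errors.
  set y := ε * δ / (56 * d) with hy
  have hy0 : 0 < y := by positivity
  have hy1 : y ≤ 1 := by
    rw [hy, div_le_one (by positivity)]
    exact (mul_le_one₀ hlt3.le hδ0.le hδ1.le).trans h56
  have hlogy : Real.log y = Real.log ε + Real.log δ - Real.log (56 * d) := by
    rw [hy, Real.log_div (by positivity) (by positivity), Real.log_mul hε.ne' hδ0.ne']
  set N := ⌈Real.log y / Real.log κ⌉₊ with hN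
  have hN1 : κ ^ N ≤ y := pow_ceil_log_le hκ0 hκ1 hy0
  have hN2 : (N : ℝ) ≤ Real.log ε / Real.log κ + b := by
    refine (ceil_log_le hκ0 hκ1 hy0 hy1).trans_eq ?_
    rw [hlogy, hb]; ring
  set n := ⌈Real.log (δ / C₁) / Real.log ρ⌉₊ with hn
  have hz0 : 0 < δ / C₁ := by positivity
  have hz1 : δ / C₁ ≤ 1 := by rw [div_le_one (by linarith)]; linarith
  have hn1 : ρ ^ n ≤ δ / C₁ := pow_ceil_log_le hρ0 hρ1 hz0
  have hn2 : (n : ℝ) ≤ (Real.log δ - Real.log C₁) / Real.log ρ + 1 := by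
    refine (ceil_log_le hρ0 hρ1 hz0 hz1).trans_eq ?_
    rw [Real.log_div hδ0.ne' (by linarith)]
  refine ⟨N + n, B.add_mem_dissipatedTimes hB (hK ε hε).1 hε (hK ε hε).2 hc0 hc1 hlam0 hlam1
    (by rw [hBP]; exact hlamsq) hx0 hx1 (fun m hm => ?_) hcl hδ0 ?_ ?_, ?_⟩
  · have h1 := hε₁' ε hε hlt1 m hm
    have h2 : x ≤ χ c := min_le_left _ _
    linarith
  · rw [hBP, ← hκ]
    have h1 := hε₂' ε hε hlt2
    have h2 : d * (2 * N * Real.sqrt ε) ≤ δ / 8 := by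
      refine le_trans ?_ h1
      have := mul_le_mul_of_nonneg_right hN2 (Real.sqrt_nonneg ε)
      have := mul_le_mul_of_nonneg_left this (by positivity : (0 : ℝ) ≤ 2 * d)
      calc _ = 2 * d * (N * Real.sqrt ε) := by ring
        _ ≤ _ := this
        _ = _ := by ring
    have h3 : d * (7 * κ ^ N / ε) ≤ δ / 8 := by
      calc d * (7 * κ ^ N / ε) ≤ d * (7 * y / ε) := by gcongr
        _ = δ / 8 := by rw [hy]; field_simp; norm_num
    rw [mul_add]
    linarith
  · calc ρ ^ n * C₁ ≤ δ / C₁ * C₁ := mul_le_mul_of_nonneg_right hn1 (by linarith)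
      _ = δ := by field_simp
  · push_cast
    have e1 : Real.log ε / Real.log κ = d * Real.log ε / Real.log P := by
      rw [hlogκ]
      have : Real.log P ≠ 0 := (Real.log_neg hP0 hP1).ne
      field_simp
    have habs : |Real.log δ| = -Real.log δ := abs_of_neg hlδ
    set w := -Real.log δ with hw
    have hw0 : 0 < w := by linarith
    have e2 : (Real.log δ - Real.log (56 * d)) / Real.log κ ≤
        (1 + Real.log (56 * d)) / (-Real.log κ) * (1 + w) := by
      rw [← neg_div_neg_eq, div_mul_eq_mul_div]
      refine div_le_div_of_nonneg_right ?_ (by linarith)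
      rw [one_add_mul, mul_one_add]
      linarith [mul_nonneg hl56 hw0.le]
    have e3 : (Real.log δ - Real.log C₁) / Real.log ρ ≤
        (1 + Real.log C₁) / (-Real.log ρ) * (1 + w) := by
      rw [← neg_div_neg_eq, div_mul_eq_mul_div]
      refine div_le_div_of_nonneg_right ?_ (by linarith)
      rw [one_add_mul, mul_one_add]
      linarith [mul_nonneg hlC hw0.le]
    rw [habs, hC]
    linarith

/-- Summing the geometric series gives `(1 - δ) V (r - 1) ≤ ε r ^ n` with `r = P ^ (-1/d)`, and one
takes logarithms. The norm `V` of the slow observable depends on `d` only, so it may enter the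
constant. -/
theorem exists_le_of_mem_dissipatedTimes (d : ℕ) [NeZero d] {P : ℝ} (hP0 : 0 < P) (hP1 : P < 1) :
    ∃ C : ℝ, 0 < C ∧ ∀ (B : PiecewiseAffine d) (K : ℝ → UnitAddTorus (Fin d) → ℝ),
      B.CubeAssumption → B.pMin = P → IsLocalNoise K →
      ∀ δ : ℝ, 0 < δ → δ < 1 → ∀ ε : ℝ, 0 < ε → ∀ n ∈ dissipatedTimes B.phi (K ε) δ,
        (d : ℝ) * Real.log ε / Real.log P - C * (1 + |Real.log (1 - δ)|) ≤ (n : ℝ) := by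
  have hd0 : (0 : ℝ) < d := Nat.cast_pos.2 (NeZero.pos d)
  set κ := P ^ (1 / (d : ℝ)) with hκ
  have hκ0 : 0 < κ := Real.rpow_pos_of_pos hP0 _
  have hκ1 : κ < 1 := Real.rpow_lt_one hP0.le hP1 (by positivity)
  have hlogκ : Real.log κ = Real.log P / d := by rw [hκ, Real.log_rpow hP0]; ring
  set r := κ⁻¹ with hr
  have hr1 : 1 < r := (one_lt_inv₀ hκ0).2 hκ1
  have hlr : 0 < Real.log r := Real.log_pos hr1
  set V := l2norm volume (slowObservable d)
  have hV : 0 < V := l2norm_slowObservable_pos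
  have hVr : 0 < V * (r - 1) := mul_pos hV (by linarith)
  refine ⟨(1 + |Real.log (V * (r - 1))|) / Real.log r, by positivity,
    fun B K hB hBP hK δ hδ0 hδ1 ε hε n hn => ?_⟩
  have h1 := B.le_of_mem_dissipatedTimes hB (hK ε hε).1 (hK ε hε).2 hδ0.le hn
  rw [hBP, ← hκ, ← hr, ← Finset.mul_sum, geom_sum_eq hr1.ne'] at h1
  have h1δ : 0 < 1 - δ := by linarith
  have h2 : (1 - δ) * (V * (r - 1)) ≤ ε * r ^ n := by
    rw [← mul_div_assoc, le_div_iff₀ (by linarith)] at h1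
    nlinarith
  have h3 := Real.log_le_log (by positivity) h2
  rw [Real.log_mul h1δ.ne' hVr.ne', Real.log_mul hε.ne' (by positivity), Real.log_pow] at h3
  have e1 : d * Real.log ε / Real.log P = -Real.log ε / Real.log r := by
    rw [hr, Real.log_inv, hlogκ]
    have : Real.log P ≠ 0 := (Real.log_neg hP0 hP1).ne
    field_simp
  rw [e1, div_mul_eq_mul_div, ← sub_div, div_le_iff₀ hlr]
  have a1 := neg_abs_le (Real.log (1 - δ))
  have a2 := neg_abs_le (Real.log (V * (r - 1)))
  nlinarith [abs_nonneg (Real.log (1 - δ)), abs_nonneg (Real.log (V * (r - 1))),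
    mul_nonneg (abs_nonneg (Real.log (1 - δ))) (abs_nonneg (Real.log (V * (r - 1))))]

end

end BernoulliTorus

end

/-! ### Assembly of the two bounds -/

theorem theorem3 (d : ℕ) (hd : 1 ≤ d) (pmin pmax : ℝ) (χ : ℝ → ℝ) (hχ : ∀ c : ℝ, 0 < c → 0 < χ c) :
    ∃ C : ℝ, 0 < C ∧
      ∀ (B : BernoulliTorus.PiecewiseAffine d) (K : ℝ → UnitAddTorus (Fin d) → ℝ),
        B.CubeAssumption → B.pMin = pmin → B.pMax = pmax →
        BernoulliTorus.IsLocalNoise K → BernoulliTorus.HasFourierGap K χ →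
        ∀ δ : ℝ, 0 < δ → δ < 1 → ∃ ε₀ : ℝ, 0 < ε₀ ∧ ∀ ε : ℝ, 0 < ε → ε < ε₀ →
          ∃ t : ℕ, BernoulliTorus.IsDissipationTime B.phi (K ε) δ t ∧
            (d : ℝ) * Real.log ε / Real.log pmin - C * (1 + |Real.log (1 - δ)|) ≤ (t : ℝ) ∧
            (t : ℝ) ≤ (d : ℝ) * Real.log ε / Real.log pmax + C * (1 + |Real.log δ| / δ ^ 2) ∧
            ∀ q : ℝ, (∀ i, B.p i = q) →
              |(t : ℝ) - (d : ℝ) * Real.log ε / Real.log q| ≤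
                C * (1 + |Real.log (1 - δ)| + |Real.log δ| / δ ^ 2) := by
  have : NeZero d := ⟨by omega⟩
  -- Values outside `(0, 1)` are not attained by any partition, so in that case every constant
  -- works.
  by_cases hp : (0 < pmin ∧ pmin < 1) ∧ 0 < pmax ∧ pmax < 1
  swap
  · refine ⟨1, one_pos, fun B K _ hmin hmax => absurd ?_ hp⟩
    have h1 := B.pMin_pos
    have h2 := B.pMin_le_pMax
    have h3 := B.pMax_lt_one
    rw [hmin] at h1 h2
    rw [hmax] at h2 h3
    exact ⟨⟨h1, h2.trans_lt h3⟩, h1.trans_le h2, h3⟩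
  obtain ⟨⟨hm0, hm1⟩, hM0, hM1⟩ := hp
  obtain ⟨C₁, hC₁, hlow⟩ := BernoulliTorus.exists_le_of_mem_dissipatedTimes d hm0 hm1
  obtain ⟨C₂, hC₂, hup⟩ := BernoulliTorus.exists_mem_dissipatedTimes_le d hM0 hM1 χ hχ
  refine ⟨max C₁ C₂, lt_max_of_lt_left hC₁, fun B K hB hmin hmax hK hgap δ hδ0 hδ1 => ?_⟩
  obtain ⟨ε₀, hε₀, h⟩ := hup B K hB hmax hK hgap δ hδ0 hδ1
  refine ⟨ε₀, hε₀, fun ε hε hlt => ?_⟩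
  obtain ⟨n, hn, hnle⟩ := h ε hε hlt
  have hmem := Nat.sInf_mem ⟨n, hn⟩
  have hle : ((sInf (BernoulliTorus.dissipatedTimes B.phi (K ε) δ) : ℕ) : ℝ) ≤ n :=
    Nat.cast_le.2 (Nat.sInf_le hn)
  have hlower := hlow B K hB hmin hK δ hδ0 hδ1 ε hε _ hmem
  set t := sInf (BernoulliTorus.dissipatedTimes B.phi (K ε) δ)
  -- The argument yields the error `|log δ|`, which is stronger than the stated one since `δ < 1`.
  have habs : |Real.log δ| ≤ |Real.log δ| / δ ^ 2 := by
    rw [le_div_iff₀ (by positivity)]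
    exact mul_le_of_le_one_right (abs_nonneg _) (pow_le_one₀ hδ0.le hδ1.le)
  have b1 : (d : ℝ) * Real.log ε / Real.log pmin - max C₁ C₂ * (1 + |Real.log (1 - δ)|) ≤ t := by
    have := mul_le_mul_of_nonneg_right (le_max_left C₁ C₂)
      (by positivity : 0 ≤ 1 + |Real.log (1 - δ)|)
    linarith
  have b2 : (t : ℝ) ≤ (d : ℝ) * Real.log ε / Real.log pmax +
      max C₁ C₂ * (1 + |Real.log δ| / δ ^ 2) := by
    have h1 : C₂ * (1 + |Real.log δ|) ≤ max C₁ C₂ * (1 + |Real.log δ| / δ ^ 2) := by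
      gcongr
      exact le_max_right _ _
    linarith
  refine ⟨t, ⟨hmem, fun m hm => Nat.sInf_le hm⟩, b1, b2, fun q hq => ?_⟩
  have := B.nonempty_index
  have hq1 : pmin = q := by
    rw [← hmin, BernoulliTorus.PiecewiseAffine.pMin]; simp [hq]
  have hq2 : pmax = q := by
    rw [← hmax, BernoulliTorus.PiecewiseAffine.pMax]; simp [hq]
  rw [hq1] at b1
  rw [hq2] at b2
  have hC : 0 ≤ max C₁ C₂ := (lt_max_of_lt_left hC₁).le
  have g1 := mul_nonneg hC (abs_nonneg (Real.log (1 - δ)))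
  have g2 : 0 ≤ max C₁ C₂ * (|Real.log δ| / δ ^ 2) := by positivity
  rw [abs_le]
  constructor <;> linarith
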